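/- Let $n\ge 3$, let $M$ be a closed (compact, without boundary) connected smooth manifold of dimension $n$, and let $g$ be a smooth Riemannian metric on $M$ with volume measure $dvol$, total volume $vol_g(M)$ and scalar curvature $R$. Put $R^-=\min(R,0)$, and let $\min R^-$ be the minimum of $R^-$ over $M$. Let $\lambda_0(g)$ be the first (smallest) eigenvalue of the operator $-\Delta+\frac R4$, with eigenfunctions in $W^{1,2}(M)$ understood in the weak sense. Let $\tilde C_S=\tilde C_S(M,g)$ be the modified Sobolev constant, i.e. the smallest number $C\ge 0$ such that $$\|u\|_{\frac{2n}{n-2}}\le C\,\|\nabla u\|_2+\frac{1}{vol_g(M)^{1/n}}\,\|u\|_2\qquad\text{for all }u\in W^{1,2}(M).$$ For $a>-\lambda_0(g)$ define the logarithmic Sobolev constant $$C_{S,\log,a}(M,g)=\inf\Big\{-\int_M u^2\ln u^2\,dvol+\frac n2\ln\Big(\int_M\big(|\nabla u|^2+(\tfrac R4+a)u^2\big)dvol\Big): u\in W^{1,2}(M),\ \int_M u^2\,dvol=1\Big\}.$$ Let $a>-\lambda_0(g)$ and put $$B=-a-\frac{\min R^-}{4}+\tilde C_S^{-2}\,vol_g(M)^{-2/n}.$$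 Then $vol_g(M)>0$ and $\tilde C_S>0$, and for every $u\in W^{1,2}(M)$ with $\int_M u^2\,dvol=1$ the function $u^2\ln u^2$ is integrable and $\int_M(|\nabla u|^2+\frac R4u^2)\,dvol+a>0$. Moreover: 1. If $a\ge-\frac{\min R^-}{4}+\tilde C_S^{-2}\,vol_g(M)^{-2/n}$, then $$\int_M u^2\ln u^2\,dvol\le\frac n2\ln\Big(\int_M\big(|\nabla u|^2+\tfrac R4u^2\big)dvol+a\Big)+\frac n2\ln(2\tilde C_S^2)$$ for all $u\in W^{1,2}(M)$ with $\int_M u^2\,dvol=1$, and $C_{S,\log,a}(M,g)\ge-\frac n2\ln(2\tilde C_S^2)$. 2. If $a<-\frac{\min R^-}{4}+\tilde C_S^{-2}\,vol_g(M)^{-2/n}$, then $$\int_M u^2\ln u^2\,dvol\le\frac n2\ln\Big(\int_M\big(|\nabla u|^2+\tfrac R4u^2\big)dvol+a\Big)+\frac n2\ln\Big(1+\frac{B}{a+\lambda_0(g)}\Big)+\frac n2\ln(2\tilde C_S^2)$$ for all $u\in W^{1,2}(M)$ with $\int_M u^2\,dvol=1$, and $C_{S,\log,a}(M,g)\ge-\frac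 n2\ln\big(1+\frac{B}{a+\lambda_0(g)}\big)-\frac n2\ln(2\tilde C_S^2)$. -/

import Mathlib

open MeasureTheory Filter Set Bundle
open scoped Manifold ContDiff Topology ENNReal

noncomputable section

namespace RiemannLogSobolev

/-- Smooth Riemannian metrics on an `n`-dimensional manifold `M` (without boundary). -/
abbrev Metric (n : ℕ) (M : Type*) [TopologicalSpace M]
    [ChartedSpace (EuclideanSpace ℝ (Fin n)) M] [IsManifold (𝓡 n) ∞ M] :=
  ContMDiffRiemannianMetric (𝓡 n) ∞ (EuclideanSpace ℝ (Fin n))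
    (fun x : M => TangentSpace (𝓡 n) x)

section Coordinates

/-- The partial derivative `∂_i f` of a function of `n` real variables. -/
def pderiv {n : ℕ} (i : Fin n) (f : EuclideanSpace ℝ (Fin n) → ℝ)
    (y : EuclideanSpace ℝ (Fin n)) : ℝ :=
  fderiv ℝ f y (EuclideanSpace.single i 1)

/-- Christoffel symbols of the second kind of a matrix-valued function `G = (g_ij)` on `ℝⁿ`:
`Γ^k_{ij} = ½ ∑_l g^{kl} (∂_i g_{jl} + ∂_j g_{il} - ∂_l g_{ij})`. -/
def christoffel {n : ℕ} (G : EuclideanSpace ℝ (Fin n) → Matrix (Fin n) (Fin n) ℝ)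
    (k i j : Fin n) (y : EuclideanSpace ℝ (Fin n)) : ℝ :=
  (1 / 2) * ∑ l, (G y)⁻¹ k l *
    (pderiv i (fun z => G z j l) y + pderiv j (fun z => G z i l) y
      - pderiv l (fun z => G z i j) y)

/-- Ricci curvature in coordinates:
`R_{jk} = ∑_i (∂_i Γ^i_{jk} - ∂_j Γ^i_{ik}) + ∑_{i,p} (Γ^i_{ip} Γ^p_{jk} - Γ^i_{jp} Γ^p_{ik})`. -/
def ricciCoord {n : ℕ} (G : EuclideanSpace ℝ (Fin n) → Matrix (Fin n) (Fin n) ℝ)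
    (j k : Fin n) (y : EuclideanSpace ℝ (Fin n)) : ℝ :=
  ∑ i, (pderiv i (christoffel G i j k) y - pderiv j (christoffel G i i k) y
    + ∑ p, (christoffel G i i p y * christoffel G p j k y
      - christoffel G i j p y * christoffel G p i k y))

/-- Scalar curvature in coordinates: `∑_{j,k} g^{jk} R_{jk}`. -/
def scalarCoord {n : ℕ} (G : EuclideanSpace ℝ (Fin n) → Matrix (Fin n) (Fin n) ℝ)
    (y : EuclideanSpace ℝ (Fin n)) : ℝ :=
  ∑ j, ∑ k, (G y)⁻¹ j k * ricciCoord G j k y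

end Coordinates

section Manifold

variable {n : ℕ} {M : Type*} [TopologicalSpace M]
  [ChartedSpace (EuclideanSpace ℝ (Fin n)) M] [IsManifold (𝓡 n) ∞ M]

/-- The `i`-th coordinate vector field `∂_i` of the chart centred at `c`, at the point with
coordinates `y`. -/
def coordVec (c : M) (y : EuclideanSpace ℝ (Fin n)) (i : Fin n) :
    TangentSpace (𝓡 n) ((extChartAt (𝓡 n) c).symm y) :=
  mfderiv 𝓘(ℝ, EuclideanSpace ℝ (Fin n)) (𝓡 n) (extChartAt (𝓡 n) c).symm y
    (EuclideanSpace.single i (1 : ℝ))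

/-- The matrix `g_{ij} = g(∂_i, ∂_j)` of the metric in the chart centred at `c`, as a function of
the coordinates. -/
def gram (g : Metric n M) (c : M) (y : EuclideanSpace ℝ (Fin n)) : Matrix (Fin n) (Fin n) ℝ :=
  fun i j => g.inner ((extChartAt (𝓡 n) c).symm y) (coordVec c y i) (coordVec c y j)

/-- The scalar curvature `R` of `g` at `x`, computed in the chart at `x` (the value does not depend
on the chart). -/
def scalarCurv (g : Metric n M) (x : M) : ℝ :=
  scalarCoord (gram g x) (extChartAt (𝓡 n) x x)

/-- `min R⁻`, where `R⁻ = min (R, 0)`. -/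
def minScalarNeg (g : Metric n M) : ℝ := ⨅ x : M, min (scalarCurv g x) 0

/-- The length `|v|_g` of a tangent vector. -/
def vnorm (g : Metric n M) {x : M} (v : TangentSpace (𝓡 n) x) : ℝ := √(g.inner x v v)

/-- Every linear form on a tangent space is represented by a unique tangent vector. -/
theorem exists_riesz (g : Metric n M) (x : M) (L : TangentSpace (𝓡 n) x →L[ℝ] ℝ) :
    ∃! v : TangentSpace (𝓡 n) x, ∀ w, g.inner x v w = L w := by
  have : FiniteDimensional ℝ (TangentSpace (𝓡 n) x) :=
    inferInstanceAs (FiniteDimensional ℝ (EuclideanSpace ℝ (Fin n)))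
  let T : TangentSpace (𝓡 n) x →ₗ[ℝ] Module.Dual ℝ (TangentSpace (𝓡 n) x) :=
    { toFun := fun v => (g.inner x v : TangentSpace (𝓡 n) x →ₗ[ℝ] ℝ)
      map_add' := fun v w => by ext; simp
      map_smul' := fun a v => by ext; simp }
  have hT : Function.Injective T := by
    rw [injective_iff_map_eq_zero]
    intro v hv
    by_contra h
    have h1 := g.pos x v h
    have h2 : g.inner x v v = 0 := by
      have := congrArg (fun l : Module.Dual ℝ (TangentSpace (𝓡 n) x) => l v) hv
      simpa [T] using this
    linarith
  have hS : Function.Surjective T :=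
    (LinearMap.injective_iff_surjective_of_finrank_eq_finrank
      (Subspace.dual_finrank_eq).symm).1 hT
  obtain ⟨v, hv⟩ := hS (L : TangentSpace (𝓡 n) x →ₗ[ℝ] ℝ)
  refine ⟨v, fun w => ?_, fun v' hv' => ?_⟩
  · have := congrArg (fun l : Module.Dual ℝ (TangentSpace (𝓡 n) x) => l w) hv
    simpa [T] using this
  · apply hT
    rw [hv]
    ext w
    simpa [T] using hv' w

/-- The gradient `∇f` of a function: `g(∇f, w) = df(w)` for all tangent vectors `w`. -/
def grad (g : Metric n M) (f : M → ℝ) (x : M) : TangentSpace (𝓡 n) x :=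
  Classical.choose (exists_riesz g x (mfderiv (𝓡 n) 𝓘(ℝ, ℝ) f x)).exists

theorem grad_spec (g : Metric n M) (f : M → ℝ) (x : M) (w : TangentSpace (𝓡 n) x) :
    g.inner x (grad g f x) w = mfderiv (𝓡 n) 𝓘(ℝ, ℝ) f x w :=
  Classical.choose_spec (exists_riesz g x (mfderiv (𝓡 n) 𝓘(ℝ, ℝ) f x)).exists w


/-- A compact manifold is covered by a sequence of charts. -/
theorem exists_chart_cover (n : ℕ) (M : Type*) [TopologicalSpace M]
    [ChartedSpace (EuclideanSpace ℝ (Fin n)) M] [CompactSpace M] [Nonempty M] :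
    ∃ c : ℕ → M, ∀ x : M, ∃ k, x ∈ (extChartAt (𝓡 n) (c k)).source := by
  obtain ⟨t, ht⟩ := isCompact_univ.elim_finite_subcover
    (fun c : M => (extChartAt (𝓡 n) c).source) (fun c => isOpen_extChartAt_source c)
    (fun x _ => mem_iUnion.2 ⟨x, mem_extChartAt_source x⟩)
  obtain ⟨x0⟩ := ‹Nonempty M›
  have hne : ((t : Set M) ∪ {x0}).Nonempty := ⟨x0, by simp⟩
  obtain ⟨c, hc⟩ := (t.countable_toSet.union (countable_singleton x0)).exists_eq_range hne
  refine ⟨c, fun x => ?_⟩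
  obtain ⟨y, hy, hxy⟩ := mem_iUnion₂.1 (ht (mem_univ x))
  obtain ⟨k, rfl⟩ : y ∈ range c := hc ▸ Or.inl hy
  exact ⟨k, hxy⟩

/-- A sequence of (centres of) charts covering `M`. -/
def chartSeq (n : ℕ) (M : Type*) [TopologicalSpace M]
    [ChartedSpace (EuclideanSpace ℝ (Fin n)) M] [CompactSpace M] [Nonempty M] : ℕ → M :=
  Classical.choose (exists_chart_cover n M)

variable [CompactSpace M] [Nonempty M] [MeasurableSpace M] [BorelSpace M]

/-- The part of the domain of the `k`-th chart that lies in no earlier chart. These sets form a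
Borel partition of `M`. -/
def piece (n : ℕ) (M : Type*) [TopologicalSpace M]
    [ChartedSpace (EuclideanSpace ℝ (Fin n)) M] [CompactSpace M] [Nonempty M] (k : ℕ) : Set M :=
  (extChartAt (𝓡 n) (chartSeq n M k)).source \
    ⋃ j, ⋃ _ : j < k, (extChartAt (𝓡 n) (chartSeq n M j)).source

/-- The measure `√det(g_{ij}) dy¹⋯dyⁿ` on the domain of the chart centred at `c` (extended by zero
to `M`). -/
def chartVol (g : Metric n M) (c : M) : Measure M :=
  ((volume.restrict (extChartAt (𝓡 n) c).target).withDensity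
    fun y => ENNReal.ofReal (√(gram g c y).det)).map (extChartAt (𝓡 n) c).symm

/-- The Riemannian volume measure of `g`, glued from the coordinate expressions
`√det(g_{ij}) dy¹⋯dyⁿ` along a partition of `M` into Borel subsets of chart domains. -/
def vol (g : Metric n M) : Measure M :=
  Measure.sum fun k => (chartVol g (chartSeq n M k)).restrict (piece n M k)

/-- The total volume `vol_g(M)`. -/
def totalVol (g : Metric n M) : ℝ := (vol g).real univ

/-- `u ∈ W^{1,2}(M)` with (weak) gradient `∇u = X`. Here `W^{1,2}(M)` is the completion of the
smooth functions for the norm `(‖u‖₂² + ‖∇u‖₂²)^{1/2}`: the function `u ∈ L²` and the measurable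
vector field `X ∈ L²` are the simultaneous `L²`-limits of smooth functions `f k` and of their
gradients. -/
structure IsW12 (g : Metric n M) (u : M → ℝ) (X : ∀ x : M, TangentSpace (𝓡 n) x) : Prop where
  memLp : MemLp u 2 (vol g)
  aestronglyMeasurable :
    AEStronglyMeasurable (fun x => (⟨x, X x⟩ : TangentBundle (𝓡 n) M)) (vol g)
  memLp_grad : MemLp (fun x => vnorm g (X x)) 2 (vol g)
  approx : ∃ f : ℕ → M → ℝ, (∀ k, ContMDiff (𝓡 n) 𝓘(ℝ, ℝ) ∞ (f k)) ∧
    Tendsto (fun k => eLpNorm (fun x => f k x - u x) 2 (vol g)) atTop (𝓝 0) ∧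
    Tendsto (fun k => eLpNorm (fun x => vnorm g (grad g (f k) x - X x)) 2 (vol g)) atTop (𝓝 0)

/-- `∫_M (|∇u|² + (R/4) u²) dvol`, where `X = ∇u`. -/
def energy (g : Metric n M) (u : M → ℝ) (X : ∀ x : M, TangentSpace (𝓡 n) x) : ℝ :=
  ∫ x, (vnorm g (X x) ^ 2 + scalarCurv g x / 4 * u x ^ 2) ∂(vol g)

/-- `∫_M u² ln u² dvol`. -/
def entropy (g : Metric n M) (u : M → ℝ) : ℝ :=
  ∫ x, u x ^ 2 * Real.log (u x ^ 2) ∂(vol g)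

/-- `μ` is an eigenvalue of `-Δ + R/4`: there is an eigenfunction `u ∈ W^{1,2}(M)`, not almost
everywhere zero, of `-Δu + (R/4) u = μ u` in the weak sense. -/
def IsEigenvalue (g : Metric n M) (μ : ℝ) : Prop :=
  ∃ (u : M → ℝ) (X : ∀ x : M, TangentSpace (𝓡 n) x), IsW12 g u X ∧ ¬ (u =ᵐ[vol g] 0) ∧
    ∀ φ : M → ℝ, ContMDiff (𝓡 n) 𝓘(ℝ, ℝ) ∞ φ →
      ∫ x, (g.inner x (X x) (grad g φ x) + scalarCurv g x / 4 * u x * φ x) ∂(vol g)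
        = μ * ∫ x, u x * φ x ∂(vol g)

/-- The first (smallest) eigenvalue `λ₀(g)` of `-Δ + R/4`. -/
def lambda0 (g : Metric n M) : ℝ := sInf {μ | IsEigenvalue g μ}

/-- The modified Sobolev constant `C̃_S(M, g)`: the smallest `C ≥ 0` such that
`‖u‖_{2n/(n-2)} ≤ C ‖∇u‖₂ + vol_g(M)^{-1/n} ‖u‖₂` for all `u ∈ W^{1,2}(M)`. -/
def sobolevConst (g : Metric n M) : ℝ :=
  sInf {C : ℝ | 0 ≤ C ∧ ∀ (u : M → ℝ) (X : ∀ x : M, TangentSpace (𝓡 n) x), IsW12 g u X →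
    eLpNorm u (ENNReal.ofReal (2 * n / (n - 2))) (vol g) ≤
      ENNReal.ofReal C * eLpNorm (fun x => vnorm g (X x)) 2 (vol g)
        + ENNReal.ofReal (totalVol g ^ (-(1 / (n : ℝ)))) * eLpNorm u 2 (vol g)}

/-- The logarithmic Sobolev constant `C_{S,log,a}(M, g)` with the `a`-adjusted scalar curvature
potential. -/
def logSobolevConst (g : Metric n M) (a : ℝ) : ℝ :=
  sInf {y : ℝ | ∃ (u : M → ℝ) (X : ∀ x : M, TangentSpace (𝓡 n) x), IsW12 g u X ∧
    ∫ x, u x ^ 2 ∂(vol g) = 1 ∧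
    y = -∫ x, u x ^ 2 * Real.log (u x ^ 2) ∂(vol g) + (n : ℝ) / 2 *
      Real.log (∫ x, (vnorm g (X x) ^ 2 + (scalarCurv g x / 4 + a) * u x ^ 2) ∂(vol g))}

end Manifold

end RiemannLogSobolev

end

set_option linter.unusedSectionVars false

namespace RiemannLogSobolev

/-! ### Charts and the coordinate matrix of the metric -/

section ChartGeometry

variable {n : ℕ} {M : Type*} [TopologicalSpace M]
  [ChartedSpace (EuclideanSpace ℝ (Fin n)) M] [IsManifold (𝓡 n) ∞ M]

/-! Write `q = 2n/(n-2)`, `V` for the volume, `C` for the modified Sobolev constant and `E` for the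
energy of `u`, where `∫u² = 1`. Jensen's inequality for the probability measure `u² dvol` bounds `∫
u² ln u²` by `n ln ‖u‖_q` (`integral_sq_mul_log_le`). The Sobolev inequality bounds `‖u‖_q` by
`C‖∇u‖₂ + V^(-1/n)`, and `(x+y)² ≤ 2x² + 2y²` turns this into `‖u‖_q² ≤ 2C²(‖∇u‖₂² + C⁻²V^(-2/n))`
(`IsW12.entropy_le`). Since `R ≥ min R⁻`, the last bracket is at most `E + a + B`. If `B ≤ 0`, the
term `B` is dropped. If `B > 0`, the variational bound `E + a ≥ a + λ₀ > 0` gives `E + a + B ≤ (E +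
a)(1 + B/(a + λ₀))`. Taking logarithms yields the two cases.

Most of the work lies in showing that the constants mean what they should.

Scalar curvature: it is defined in a different chart at each point, so its continuity and
boundedness rest on invariance under coordinate changes (`scalarCoord_pullback`), proved by viewing
the Christoffel symbols as connection matrices that undergo a pullback and a gauge transformation.

Sobolev constant: the defining set is nonempty by `exists_sobolev_smooth`, which splits `f` into its
mean and the rest. The mean costs exactly `V^(-1/n)‖f‖₂`; the rest is controlled by the local
Sobolev inequality and the Poincaré inequality on a connected closed manifold. The infimum is
attained (`IsW12.sobolev`) and positive (`sobolevConst_pos`).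

First eigenvalue: the infimum of the Rayleigh quotient is an eigenvalue by the direct method
(`isEigenvalue_bottom`), using Rellich's theorem and completeness of `W^{1,2}`. It bounds every
eigenvalue from below, so it equals `lambda0`, and `IsW12.lambda0_mul_le` follows. -/

theorem contMDiffAt_extChartAt_symm {c : M} {y : EuclideanSpace ℝ (Fin n)}
    (hy : y ∈ (extChartAt (𝓡 n) c).target) :
    ContMDiffAt 𝓘(ℝ, EuclideanSpace ℝ (Fin n)) (𝓡 n) ∞ (extChartAt (𝓡 n) c).symm y :=
  (contMDiffOn_extChartAt_symm c).contMDiffAt ((isOpen_extChartAt_target c).mem_nhds hy)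

theorem mdifferentiableAt_extChartAt_symm {c : M} {y : EuclideanSpace ℝ (Fin n)}
    (hy : y ∈ (extChartAt (𝓡 n) c).target) :
    MDifferentiableAt 𝓘(ℝ, EuclideanSpace ℝ (Fin n)) (𝓡 n) (extChartAt (𝓡 n) c).symm y :=
  (contMDiffAt_extChartAt_symm hy).mdifferentiableAt (by simp)

/-- The coordinate vector fields are smooth sections along the inverse chart. -/
theorem contMDiffOn_coordVec (c : M) (i : Fin n) :
    ContMDiffOn 𝓘(ℝ, EuclideanSpace ℝ (Fin n)) ((𝓡 n).prod 𝓘(ℝ, EuclideanSpace ℝ (Fin n))) ∞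
      (fun y => (⟨(extChartAt (𝓡 n) c).symm y, coordVec c y i⟩ : TangentBundle (𝓡 n) M))
      (extChartAt (𝓡 n) c).target := by
  have h1 := (contMDiffOn_extChartAt_symm (I := 𝓡 n) (n := ∞) c).contMDiffOn_tangentMapWithin
    (m := ∞) (by simp) (isOpen_extChartAt_target c).uniqueMDiffOn
  have h2 : ContMDiff 𝓘(ℝ, EuclideanSpace ℝ (Fin n))
      (𝓘(ℝ, EuclideanSpace ℝ (Fin n)).prod 𝓘(ℝ, EuclideanSpace ℝ (Fin n))) ∞
      (fun y : EuclideanSpace ℝ (Fin n) =>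
        (⟨y, EuclideanSpace.single i (1 : ℝ)⟩ : TangentBundle 𝓘(ℝ, EuclideanSpace ℝ (Fin n))
          (EuclideanSpace ℝ (Fin n)))) :=
    contMDiff_vectorSpace_iff_contDiff.2 contDiff_const
  refine (h1.comp h2.contMDiffOn (fun y hy => hy)).congr fun y hy => ?_
  simp only [Function.comp, tangentMapWithin]
  rw [mfderivWithin_of_isOpen (isOpen_extChartAt_target c) hy]
  rfl

/-- The metric, restricted along the inverse chart, is a smooth section of bilinear forms; it is
evaluated on two smooth sections of coordinate vectors. -/
theorem contDiffOn_gram (g : Metric n M) (c : M) (i j : Fin n) :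
    ContDiffOn ℝ ∞ (fun y => gram g c y i j) (extChartAt (𝓡 n) c).target := by
  have h1 : ContMDiffOn 𝓘(ℝ, EuclideanSpace ℝ (Fin n)) ((𝓡 n).prod
      𝓘(ℝ, EuclideanSpace ℝ (Fin n) →L[ℝ] EuclideanSpace ℝ (Fin n) →L[ℝ] ℝ)) ∞
      (fun y => TotalSpace.mk' (EuclideanSpace ℝ (Fin n) →L[ℝ] EuclideanSpace ℝ (Fin n) →L[ℝ] ℝ)
        (E := fun x : M => TangentSpace (𝓡 n) x →L[ℝ] TangentSpace (𝓡 n) x →L[ℝ] ℝ)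
        ((extChartAt (𝓡 n) c).symm y) (g.inner ((extChartAt (𝓡 n) c).symm y)))
      (extChartAt (𝓡 n) c).target :=
    g.contMDiff.comp_contMDiffOn (contMDiffOn_extChartAt_symm c)
  have h2 : ContMDiffOn 𝓘(ℝ, EuclideanSpace ℝ (Fin n)) ((𝓡 n).prod 𝓘(ℝ, ℝ)) ∞
      (fun y => TotalSpace.mk' ℝ (E := Bundle.Trivial M ℝ) ((extChartAt (𝓡 n) c).symm y)
        (gram g c y i j))
      (extChartAt (𝓡 n) c).target := fun y hy =>
    ContMDiffWithinAt.clm_bundle_apply₂ (F₁ := EuclideanSpace ℝ (Fin n))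
      (F₂ := EuclideanSpace ℝ (Fin n)) (h1 y hy) (contMDiffOn_coordVec c i y hy)
      (contMDiffOn_coordVec c j y hy)
  intro y hy
  have h3 := h2 y hy
  simp only [contMDiffWithinAt_totalSpace] at h3
  exact h3.2.contDiffWithinAt

/-- The coordinate expression of the metric on tangent vectors. -/
theorem inner_mfderiv_symm (g : Metric n M) (c : M) (y v w : EuclideanSpace ℝ (Fin n)) :
    g.inner ((extChartAt (𝓡 n) c).symm y)
      (mfderiv 𝓘(ℝ, EuclideanSpace ℝ (Fin n)) (𝓡 n) (extChartAt (𝓡 n) c).symm y v)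
      (mfderiv 𝓘(ℝ, EuclideanSpace ℝ (Fin n)) (𝓡 n) (extChartAt (𝓡 n) c).symm y w)
      = ∑ i, ∑ j, v i * w j * gram g c y i j := by
  have hexp : ∀ v : EuclideanSpace ℝ (Fin n),
      mfderiv 𝓘(ℝ, EuclideanSpace ℝ (Fin n)) (𝓡 n) (extChartAt (𝓡 n) c).symm y v
        = ∑ i, v i • coordVec c y i := by
    intro v
    let T : EuclideanSpace ℝ (Fin n) →L[ℝ] TangentSpace (𝓡 n) ((extChartAt (𝓡 n) c).symm y) :=
      mfderiv 𝓘(ℝ, EuclideanSpace ℝ (Fin n)) (𝓡 n) (extChartAt (𝓡 n) c).symm y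
    have h : v = ∑ i, v i • (EuclideanSpace.single i (1 : ℝ) : EuclideanSpace ℝ (Fin n)) := by
      ext k; simp [Finset.sum_apply, Pi.single_apply]
    calc T v = T (∑ i, v i • (EuclideanSpace.single i (1 : ℝ) : EuclideanSpace ℝ (Fin n))) := by
          rw [← h]
      _ = ∑ i, v i • T (EuclideanSpace.single i (1 : ℝ)) := by
          rw [map_sum]; simp only [map_smul]
  rw [hexp v, hexp w]
  simp only [map_sum, map_smul, sum_apply, smul_apply,
    smul_eq_mul, gram, Finset.mul_sum]
  rw [Finset.sum_comm]
  refine Finset.sum_congr rfl fun i _ => Finset.sum_congr rfl fun j _ => by ring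

theorem gram_symm (g : Metric n M) (c : M) (y : EuclideanSpace ℝ (Fin n)) (i j : Fin n) :
    gram g c y i j = gram g c y j i := g.symm _ _ _

theorem mfderiv_symm_injective {c : M} {y : EuclideanSpace ℝ (Fin n)}
    (hy : y ∈ (extChartAt (𝓡 n) c).target) :
    Function.Injective
      (mfderiv 𝓘(ℝ, EuclideanSpace ℝ (Fin n)) (𝓡 n) (extChartAt (𝓡 n) c).symm y) := by
  have h := isInvertible_mfderivWithin_extChartAt_symm (I := 𝓡 n) hy
  simp only [ModelWithCorners.range_eq_univ, mfderivWithin_univ] at h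
  exact h.bijective.injective

/-- The quadratic form of the matrix is `g` evaluated on the image of `v` under the differential of
the inverse chart, which is injective. -/
theorem posDef_gram (g : Metric n M) {c : M} {y : EuclideanSpace ℝ (Fin n)}
    (hy : y ∈ (extChartAt (𝓡 n) c).target) : (gram g c y).PosDef := by
  refine Matrix.PosDef.of_dotProduct_mulVec_pos ?_ fun v hv => ?_
  · ext i j
    simp [Matrix.conjTranspose_apply, gram_symm g c y i j]
  · have h := inner_mfderiv_symm g c y (WithLp.toLp 2 v) (WithLp.toLp 2 v)
    have h2 : star v ⬝ᵥ Matrix.mulVec (gram g c y) v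
        = ∑ i, ∑ j, v i * v j * gram g c y i j := by
      simp only [dotProduct, Matrix.mulVec, Finset.mul_sum, Pi.star_apply, star_trivial]
      exact Finset.sum_congr rfl fun i _ => Finset.sum_congr rfl fun j _ => by ring
    rw [h2]
    change _ = ∑ i, ∑ j, v i * v j * gram g c y i j at h
    rw [← h]
    refine g.pos _ _ fun h0 => hv ?_
    have := mfderiv_symm_injective hy (h0.trans (map_zero _).symm)
    exact congrArg WithLp.ofLp this

/-- The coordinate change from the chart centred at `c` to the chart centred at `c'`. -/
noncomputable def coordChange (c c' : M) : EuclideanSpace ℝ (Fin n) → EuclideanSpace ℝ (Fin n) :=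
  extChartAt (𝓡 n) c' ∘ (extChartAt (𝓡 n) c).symm

/-- The domain of the coordinate change. -/
def coordDom (c c' : M) : Set (EuclideanSpace ℝ (Fin n)) :=
  (extChartAt (𝓡 n) c).target ∩ (extChartAt (𝓡 n) c).symm ⁻¹' (extChartAt (𝓡 n) c').source

theorem isOpen_coordDom (c c' : M) : IsOpen (coordDom (n := n) c c') :=
  (continuousOn_extChartAt_symm c).isOpen_inter_preimage (isOpen_extChartAt_target c)
    (isOpen_extChartAt_source c')

theorem coordChange_mem_target {c c' : M} {y : EuclideanSpace ℝ (Fin n)}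
    (hy : y ∈ coordDom c c') : coordChange c c' y ∈ (extChartAt (𝓡 n) c').target :=
  (extChartAt (𝓡 n) c').map_source hy.2

theorem symm_coordChange {c c' : M} {y : EuclideanSpace ℝ (Fin n)} (hy : y ∈ coordDom c c') :
    (extChartAt (𝓡 n) c').symm (coordChange c c' y) = (extChartAt (𝓡 n) c).symm y :=
  (extChartAt (𝓡 n) c').left_inv hy.2

theorem contDiffOn_coordChange (c c' : M) :
    ContDiffOn ℝ ∞ (coordChange (n := n) c c') (coordDom c c') := by
  intro y hy
  have h1 : ContMDiffAt (𝓡 n) 𝓘(ℝ, EuclideanSpace ℝ (Fin n)) ∞ (extChartAt (𝓡 n) c')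
      ((extChartAt (𝓡 n) c).symm y) :=
    contMDiffAt_extChartAt' (by simpa using hy.2)
  exact (h1.comp y (contMDiffAt_extChartAt_symm hy.1)).contDiffAt.contDiffWithinAt

theorem contDiffAt_coordChange {c c' : M} {y : EuclideanSpace ℝ (Fin n)}
    (hy : y ∈ coordDom c c') : ContDiffAt ℝ ∞ (coordChange c c') y :=
  (contDiffOn_coordChange c c').contDiffAt ((isOpen_coordDom c c').mem_nhds hy)

/-- The tensor law `G = Jᵀ (G' ∘ φ) J`, from the chain rule for `ψ' ∘ φ = ψ`. Both the volume and
the scalar curvature are shown chart-independent through it. -/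
theorem gram_coordChange (g : Metric n M) {c c' : M} {y : EuclideanSpace ℝ (Fin n)}
    (hy : y ∈ coordDom c c') (i j : Fin n) :
    gram g c y i j = ∑ a, ∑ b, pderiv i (fun z => coordChange c c' z a) y *
      pderiv j (fun z => coordChange c c' z b) y * gram g c' (coordChange c c' y) a b := by
  have hd : DifferentiableAt ℝ (coordChange c c') y :=
    (contDiffAt_coordChange hy).differentiableAt (by simp)
  have hcomp : (extChartAt (𝓡 n) c').symm ∘ coordChange c c' =ᶠ[𝓝 y] (extChartAt (𝓡 n) c).symm := by
    filter_upwards [(isOpen_coordDom c c').mem_nhds hy] with z hz using symm_coordChange hz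
  have h1 : ∀ v : EuclideanSpace ℝ (Fin n),
      mfderiv 𝓘(ℝ, EuclideanSpace ℝ (Fin n)) (𝓡 n) (extChartAt (𝓡 n) c).symm y v =
      mfderiv 𝓘(ℝ, EuclideanSpace ℝ (Fin n)) (𝓡 n) (extChartAt (𝓡 n) c').symm
        (coordChange c c' y) (fderiv ℝ (coordChange c c') y v) := by
    intro v
    rw [← hcomp.mfderiv_eq, mfderiv_comp y
      (mdifferentiableAt_extChartAt_symm (coordChange_mem_target hy)) hd.mdifferentiableAt,
      mfderiv_eq_fderiv]
    rfl
  have h2 : ∀ (i a : Fin n), fderiv ℝ (coordChange c c') y (EuclideanSpace.single i 1) a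
      = pderiv i (fun z => coordChange c c' z a) y := by
    intro i a
    have := ((EuclideanSpace.proj a : EuclideanSpace ℝ (Fin n) →L[ℝ] ℝ).hasFDerivAt.comp y
      hd.hasFDerivAt).fderiv
    simp only [pderiv]
    exact (congrArg (fun L : EuclideanSpace ℝ (Fin n) →L[ℝ] ℝ => L (EuclideanSpace.single i 1))
      this).symm
  have h3 := inner_mfderiv_symm g c' (coordChange c c' y)
    (fderiv ℝ (coordChange c c') y (EuclideanSpace.single i 1))
    (fderiv ℝ (coordChange c c') y (EuclideanSpace.single j 1))
  simp only [h2] at h3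
  rw [← h3]
  -- The base points agree only propositionally; vectors are compared in the model space after
  -- generalising to arbitrary `p = q`.
  have h4 : ∀ (p q : M) (hpq : p = q) (v w v' w' : EuclideanSpace ℝ (Fin n)), v = v' → w = w' →
      g.inner p (show TangentSpace (𝓡 n) p from v) (show TangentSpace (𝓡 n) p from w) =
      g.inner q (show TangentSpace (𝓡 n) q from v') (show TangentSpace (𝓡 n) q from w') := by
    rintro p _ rfl v w _ _ rfl rfl; rfl
  exact h4 _ _ (symm_coordChange hy).symm _ _ _ _ (h1 _) (h1 _)

end ChartGeometry

/-! ### Calculus of matrix-valued functions; curvature as a gauge field -/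

section CoordinateInvariance

variable {n : ℕ}

theorem pderiv_congr {f h : EuclideanSpace ℝ (Fin n) → ℝ} {y : EuclideanSpace ℝ (Fin n)}
    (hfh : f =ᶠ[𝓝 y] h) (i : Fin n) : pderiv i f y = pderiv i h y := by
  simp only [pderiv, hfh.fderiv_eq]

theorem pderiv_add {f h : EuclideanSpace ℝ (Fin n) → ℝ} {y : EuclideanSpace ℝ (Fin n)}
    (hf : DifferentiableAt ℝ f y) (hh : DifferentiableAt ℝ h y) (i : Fin n) :
    pderiv i (fun z => f z + h z) y = pderiv i f y + pderiv i h y := by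
  simp only [pderiv, fderiv_fun_add hf hh, add_apply]

theorem pderiv_mul {f h : EuclideanSpace ℝ (Fin n) → ℝ} {y : EuclideanSpace ℝ (Fin n)}
    (hf : DifferentiableAt ℝ f y) (hh : DifferentiableAt ℝ h y) (i : Fin n) :
    pderiv i (fun z => f z * h z) y = pderiv i f y * h y + f y * pderiv i h y := by
  simp only [pderiv, fderiv_fun_mul hf hh, add_apply, smul_apply, smul_eq_mul]
  ring

theorem pderiv_sum {ι : Type*} (s : Finset ι) {f : ι → EuclideanSpace ℝ (Fin n) → ℝ}
    {y : EuclideanSpace ℝ (Fin n)} (hf : ∀ k ∈ s, DifferentiableAt ℝ (f k) y) (i : Fin n) :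
    pderiv i (fun z => ∑ k ∈ s, f k z) y = ∑ k ∈ s, pderiv i (f k) y := by
  simp only [pderiv, fderiv_fun_sum hf, sum_apply]

theorem pderiv_comp {f : EuclideanSpace ℝ (Fin n) → ℝ}
    {φ : EuclideanSpace ℝ (Fin n) → EuclideanSpace ℝ (Fin n)} {y : EuclideanSpace ℝ (Fin n)}
    (hf : DifferentiableAt ℝ f (φ y)) (hφ : DifferentiableAt ℝ φ y) (i : Fin n) :
    pderiv i (fun z => f (φ z)) y = ∑ a, pderiv i (fun z => φ z a) y * pderiv a f (φ y) := by
  have h2 : ∀ a, fderiv ℝ φ y (EuclideanSpace.single i 1) a = pderiv i (fun z => φ z a) y := by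
    intro a
    have := ((EuclideanSpace.proj a : EuclideanSpace ℝ (Fin n) →L[ℝ] ℝ).hasFDerivAt.comp y
      hφ.hasFDerivAt).fderiv
    exact (congrArg (fun L : EuclideanSpace ℝ (Fin n) →L[ℝ] ℝ => L (EuclideanSpace.single i 1))
      this).symm
  have h1 : fderiv ℝ φ y (EuclideanSpace.single i 1)
      = ∑ a, pderiv i (fun z => φ z a) y • (EuclideanSpace.single a (1 : ℝ)) := by
    ext k
    simp [h2, Finset.sum_apply, Pi.single_apply]
  have h3 : fderiv ℝ (fun z => f (φ z)) y = (fderiv ℝ f (φ y)).comp (fderiv ℝ φ y) :=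
    fderiv_comp y hf hφ
  simp only [pderiv] at h1 ⊢
  rw [h3, ContinuousLinearMap.comp_apply, h1, map_sum]
  simp only [map_smul, smul_eq_mul]

theorem contDiffOn_pderiv {f : EuclideanSpace ℝ (Fin n) → ℝ} {U : Set (EuclideanSpace ℝ (Fin n))}
    (hU : IsOpen U) (hf : ContDiffOn ℝ ∞ f U) (i : Fin n) : ContDiffOn ℝ ∞ (pderiv i f) U :=
  (hf.fderiv_of_isOpen hU (by simp)).clm_apply contDiffOn_const

/-- Symmetry of the second derivative. It is what cancels every second-derivative term of a
coordinate change below. -/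
theorem pderiv_comm {f : EuclideanSpace ℝ (Fin n) → ℝ} {y : EuclideanSpace ℝ (Fin n)}
    (hf : ContDiffAt ℝ ∞ f y) (i j : Fin n) :
    pderiv i (pderiv j f) y = pderiv j (pderiv i f) y := by
  have hs : IsSymmSndFDerivAt ℝ f y := hf.isSymmSndFDerivAt (by
    simp only [minSmoothness_of_isRCLikeNormedField]; exact ENat.LEInfty.out)
  have hd : DifferentiableAt ℝ (fderiv ℝ f) y :=
    (hf.fderiv_right (m := 1) (by norm_cast)).differentiableAt (by simp)
  have h : ∀ v w : EuclideanSpace ℝ (Fin n),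
      fderiv ℝ (fun z => fderiv ℝ f z v) y w = fderiv ℝ (fderiv ℝ f) y w v := by
    intro v w
    rw [fderiv_clm_apply hd (differentiableAt_const v)]
    simp
  simp only [pderiv]
  change fderiv ℝ (fun z => fderiv ℝ f z _) y _ = fderiv ℝ (fun z => fderiv ℝ f z _) y _
  rw [h, h]
  exact hs.eq _ _

/-- The entrywise partial derivative of a matrix-valued function. -/
noncomputable def matDeriv (i : Fin n) (F : EuclideanSpace ℝ (Fin n) → Matrix (Fin n) (Fin n) ℝ)
    (y : EuclideanSpace ℝ (Fin n)) : Matrix (Fin n) (Fin n) ℝ :=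
  fun a b => pderiv i (fun z => F z a b) y

/-- Entrywise smoothness of a matrix-valued function on a set. -/
def MatSmooth (F : EuclideanSpace ℝ (Fin n) → Matrix (Fin n) (Fin n) ℝ)
    (U : Set (EuclideanSpace ℝ (Fin n))) : Prop :=
  ∀ a b, ContDiffOn ℝ ∞ (fun z => F z a b) U

theorem MatSmooth.differentiableAt {F : EuclideanSpace ℝ (Fin n) → Matrix (Fin n) (Fin n) ℝ}
    {U : Set (EuclideanSpace ℝ (Fin n))} (hF : MatSmooth F U) (hU : IsOpen U) {y} (hy : y ∈ U)
    (a b : Fin n) : DifferentiableAt ℝ (fun z => F z a b) y :=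
  ((hF a b).contDiffAt (hU.mem_nhds hy)).differentiableAt (by simp)

theorem MatSmooth.mul {F H : EuclideanSpace ℝ (Fin n) → Matrix (Fin n) (Fin n) ℝ}
    {U : Set (EuclideanSpace ℝ (Fin n))} (hF : MatSmooth F U) (hH : MatSmooth H U) :
    MatSmooth (fun z => F z * H z) U := fun a b => by
  simp only [Matrix.mul_apply]
  exact ContDiffOn.sum fun k _ => (hF a k).mul (hH k b)

theorem MatSmooth.matDeriv {F : EuclideanSpace ℝ (Fin n) → Matrix (Fin n) (Fin n) ℝ}
    {U : Set (EuclideanSpace ℝ (Fin n))} (hU : IsOpen U) (hF : MatSmooth F U) (i : Fin n) :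
    MatSmooth (matDeriv i F) U := fun a b => contDiffOn_pderiv hU (hF a b) i

theorem MatSmooth.det {F : EuclideanSpace ℝ (Fin n) → Matrix (Fin n) (Fin n) ℝ}
    {U : Set (EuclideanSpace ℝ (Fin n))} (hF : MatSmooth F U) :
    ContDiffOn ℝ ∞ (fun z => (F z).det) U := by
  simp only [Matrix.det_apply]
  refine ContDiffOn.sum fun σ _ => ?_
  exact (contDiffOn_prod fun k _ => hF (σ k) k).const_smul _

/-- Cramer's rule: an entry of the inverse is `(det F)⁻¹` times the determinant of `F` with a row
replaced by a basis vector. -/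
theorem MatSmooth.inv {F : EuclideanSpace ℝ (Fin n) → Matrix (Fin n) (Fin n) ℝ}
    {U : Set (EuclideanSpace ℝ (Fin n))} (hF : MatSmooth F U) (h0 : ∀ z ∈ U, (F z).det ≠ 0) :
    MatSmooth (fun z => (F z)⁻¹) U := fun a b => by
  simp only [Matrix.inv_def, Matrix.smul_apply, Matrix.adjugate_apply, smul_eq_mul,
    Ring.inverse_eq_inv']
  refine (hF.det.inv h0).mul (MatSmooth.det (F := fun z => (F z).updateRow b (Pi.single a 1)) ?_)
  intro k l
  by_cases hk : k = b
  · subst hk; simpa using contDiffOn_const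
  · simpa [Matrix.updateRow_ne hk] using hF k l

theorem matDeriv_mul {F H : EuclideanSpace ℝ (Fin n) → Matrix (Fin n) (Fin n) ℝ}
    {U : Set (EuclideanSpace ℝ (Fin n))} (hU : IsOpen U) (hF : MatSmooth F U) (hH : MatSmooth H U)
    {y} (hy : y ∈ U) (i : Fin n) :
    matDeriv i (fun z => F z * H z) y = matDeriv i F y * H y + F y * matDeriv i H y := by
  ext a b
  simp only [matDeriv, Matrix.mul_apply, Matrix.add_apply]
  rw [pderiv_sum _ fun k _ => (hF.differentiableAt hU hy a k).fun_mul (hH.differentiableAt hU hy k b),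
    ← Finset.sum_add_distrib]
  exact Finset.sum_congr rfl fun k _ =>
    pderiv_mul (hF.differentiableAt hU hy a k) (hH.differentiableAt hU hy k b) i

theorem matDeriv_add {F H : EuclideanSpace ℝ (Fin n) → Matrix (Fin n) (Fin n) ℝ}
    {U : Set (EuclideanSpace ℝ (Fin n))} (hU : IsOpen U) (hF : MatSmooth F U) (hH : MatSmooth H U)
    {y} (hy : y ∈ U) (i : Fin n) :
    matDeriv i (fun z => F z + H z) y = matDeriv i F y + matDeriv i H y := by
  ext a b
  exact pderiv_add (hF.differentiableAt hU hy a b) (hH.differentiableAt hU hy a b) i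

/-- The matrix `(Γ_i)^k_j` of Christoffel symbols. -/
noncomputable def christoffelMat (G : EuclideanSpace ℝ (Fin n) → Matrix (Fin n) (Fin n) ℝ)
    (i : Fin n) (y : EuclideanSpace ℝ (Fin n)) : Matrix (Fin n) (Fin n) ℝ :=
  fun k j => christoffel G k i j y

/-- The curvature matrix `∂_i Γ_j - ∂_j Γ_i + [Γ_i, Γ_j]` of a connection. -/
noncomputable def curvMat (Γ : Fin n → EuclideanSpace ℝ (Fin n) → Matrix (Fin n) (Fin n) ℝ)
    (i j : Fin n) (y : EuclideanSpace ℝ (Fin n)) : Matrix (Fin n) (Fin n) ℝ :=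
  matDeriv i (Γ j) y - matDeriv j (Γ i) y + (Γ i y * Γ j y - Γ j y * Γ i y)

/-- Ricci as a trace of the curvature of the connection matrices `Γ_i`. In this form a change of
coordinates is a pullback followed by a gauge transformation, and the two can be treated separately.
-/
theorem ricciCoord_eq_curvMat (G : EuclideanSpace ℝ (Fin n) → Matrix (Fin n) (Fin n) ℝ)
    (j k : Fin n) (y : EuclideanSpace ℝ (Fin n)) :
    ricciCoord G j k y = ∑ i, curvMat (christoffelMat G) i j y i k := by
  simp only [ricciCoord, curvMat, Matrix.add_apply, Matrix.sub_apply, Matrix.mul_apply,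
    ← Finset.sum_sub_distrib]
  rfl

theorem matSmooth_christoffelMat {G : EuclideanSpace ℝ (Fin n) → Matrix (Fin n) (Fin n) ℝ}
    {U : Set (EuclideanSpace ℝ (Fin n))} (hU : IsOpen U) (hG : MatSmooth G U)
    (h0 : ∀ z ∈ U, (G z).det ≠ 0) (i : Fin n) : MatSmooth (christoffelMat G i) U := fun k j => by
  simp only [christoffelMat, christoffel]
  refine contDiffOn_const.mul (ContDiffOn.sum fun l _ => ((hG.inv h0) k l).mul ?_)
  exact ((contDiffOn_pderiv hU (hG _ _) _).add (contDiffOn_pderiv hU (hG _ _) _)).sub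
    (contDiffOn_pderiv hU (hG _ _) _)

theorem matSmooth_curvMat {Γ : Fin n → EuclideanSpace ℝ (Fin n) → Matrix (Fin n) (Fin n) ℝ}
    {U : Set (EuclideanSpace ℝ (Fin n))} (hU : IsOpen U) (hΓ : ∀ i, MatSmooth (Γ i) U)
    (i j : Fin n) : MatSmooth (curvMat Γ i j) U := fun a b =>
  (((hΓ j).matDeriv hU i a b).sub ((hΓ i).matDeriv hU j a b)).add
    ((((hΓ i).mul (hΓ j)) a b).sub (((hΓ j).mul (hΓ i)) a b))

theorem contDiffOn_scalarCoord {G : EuclideanSpace ℝ (Fin n) → Matrix (Fin n) (Fin n) ℝ}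
    {U : Set (EuclideanSpace ℝ (Fin n))} (hU : IsOpen U) (hG : MatSmooth G U)
    (h0 : ∀ z ∈ U, (G z).det ≠ 0) : ContDiffOn ℝ ∞ (scalarCoord G) U := by
  unfold scalarCoord
  simp only [ricciCoord_eq_curvMat]
  exact ContDiffOn.sum fun j _ => ContDiffOn.sum fun k _ => ((hG.inv h0) j k).mul
    (ContDiffOn.sum fun i _ => matSmooth_curvMat hU (matSmooth_christoffelMat hU hG h0) i j i k)

/-- Curvature transforms by conjugation under a change of gauge. -/
theorem curvMat_gauge {Γ A : Fin n → EuclideanSpace ℝ (Fin n) → Matrix (Fin n) (Fin n) ℝ}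
    {J : EuclideanSpace ℝ (Fin n) → Matrix (Fin n) (Fin n) ℝ}
    {U : Set (EuclideanSpace ℝ (Fin n))} (hU : IsOpen U) (hΓ : ∀ i, MatSmooth (Γ i) U)
    (hA : ∀ i, MatSmooth (A i) U) (hJ : MatSmooth J U)
    (h : ∀ i, ∀ z ∈ U, J z * Γ i z = matDeriv i J z + A i z * J z) {y} (hy : y ∈ U)
    (i j : Fin n) : J y * curvMat Γ i j y = curvMat A i j y * J y := by
  -- Differentiating `J Γ_j = ∂_j J + A_j J` gives terms `∂_i∂_j J` and `A_j ∂_i J + A_i ∂_j J`,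
  -- symmetric in `i, j`. Antisymmetrisation leaves only the curvature of `A` times `J`.
  have key : ∀ i j, J y * (matDeriv i (Γ j) y + Γ i y * Γ j y) =
      matDeriv i (matDeriv j J) y + matDeriv i (A j) y * J y + A j y * matDeriv i J y
        + A i y * matDeriv j J y + A i y * A j y * J y := by
    intro i j
    have e1 : matDeriv i (fun z => J z * Γ j z) y
        = matDeriv i (fun z => matDeriv j J z + A j z * J z) y := by
      ext a b
      refine pderiv_congr ?_ i
      filter_upwards [hU.mem_nhds hy] with z hz
      rw [h j z hz]
    rw [matDeriv_mul hU hJ (hΓ j) hy, matDeriv_add hU (hJ.matDeriv hU j) ((hA j).mul hJ) hy,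
      matDeriv_mul hU (hA j) hJ hy] at e1
    have e2 : matDeriv i J y = J y * Γ i y - A i y * J y := by rw [h i y hy]; abel
    have e3 : matDeriv i J y * Γ j y
        = J y * (Γ i y * Γ j y) - (A i y * matDeriv j J y + A i y * A j y * J y) := by
      rw [e2, sub_mul, mul_assoc, mul_assoc, h j y hy, mul_add, ← mul_assoc (A i y)]
    rw [e3] at e1
    rw [mul_add, ← sub_eq_zero]
    rw [← sub_eq_zero] at e1
    rw [← e1]
    abel
  have hcomm : matDeriv i (matDeriv j J) y = matDeriv j (matDeriv i J) y := by
    ext a b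
    exact pderiv_comm ((hJ a b).contDiffAt (hU.mem_nhds hy)) i j
  have e : J y * curvMat Γ i j y = J y * (matDeriv i (Γ j) y + Γ i y * Γ j y)
      - J y * (matDeriv j (Γ i) y + Γ j y * Γ i y) := by
    rw [← mul_sub]; congr 1; simp only [curvMat]; abel
  rw [e, key, key, hcomm]
  simp only [curvMat, add_mul, sub_mul]
  abel

end CoordinateInvariance

/-! ### Transformation law of the Christoffel symbols -/

section CoordinateInvariance

variable {n : ℕ}

/-- Multiplication by `G` lowers an index and produces the symbols of the first kind, which contain
no inverse matrix and can be compared entry by entry. -/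
theorem mul_christoffelMat_apply {G : EuclideanSpace ℝ (Fin n) → Matrix (Fin n) (Fin n) ℝ}
    {y : EuclideanSpace ℝ (Fin n)} (h0 : (G y).det ≠ 0) (i l j : Fin n) :
    (G y * christoffelMat G i y) l j = (1 / 2) * (pderiv i (fun z => G z j l) y
      + pderiv j (fun z => G z i l) y - pderiv l (fun z => G z i j) y) := by
  set X : Fin n → ℝ := fun m => pderiv i (fun z => G z j m) y
      + pderiv j (fun z => G z i m) y - pderiv m (fun z => G z i j) y with hX
  have h1 : christoffelMat G i y * 1 = christoffelMat G i y := mul_one _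
  have h2 : (fun k => christoffelMat G i y k j) = (1 / 2 : ℝ) • (Matrix.mulVec (G y)⁻¹ X) := by
    ext k
    simp [christoffelMat, christoffel, Matrix.mulVec, dotProduct, hX]
  have h3 : (G y * christoffelMat G i y) l j
      = Matrix.mulVec (G y) (fun k => christoffelMat G i y k j) l := by
    simp [Matrix.mul_apply, Matrix.mulVec, dotProduct]
  rw [h3, h2, Matrix.mulVec_smul, Matrix.mulVec_mulVec,
    Matrix.mul_nonsing_inv _ (isUnit_iff_ne_zero.2 h0), Matrix.one_mulVec]
  simp [hX]

/-- The Jacobian matrix `J^a_i = ∂_i φ^a`. -/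
noncomputable def jacobian (φ : EuclideanSpace ℝ (Fin n) → EuclideanSpace ℝ (Fin n))
    (y : EuclideanSpace ℝ (Fin n)) : Matrix (Fin n) (Fin n) ℝ :=
  fun a i => pderiv i (fun z => φ z a) y

theorem matSmooth_jacobian {φ : EuclideanSpace ℝ (Fin n) → EuclideanSpace ℝ (Fin n)}
    {U : Set (EuclideanSpace ℝ (Fin n))} (hU : IsOpen U) (hφ : ContDiffOn ℝ ∞ φ U) :
    MatSmooth (jacobian φ) U := fun a i =>
  contDiffOn_pderiv hU ((EuclideanSpace.proj a :
    EuclideanSpace ℝ (Fin n) →L[ℝ] ℝ).contDiff.comp_contDiffOn hφ) i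

/-- The pullback `∑_b J^b_i Γ_b ∘ φ` of a matrix-valued one-form. -/
noncomputable def pullbackForm (φ : EuclideanSpace ℝ (Fin n) → EuclideanSpace ℝ (Fin n))
    (Γ : Fin n → EuclideanSpace ℝ (Fin n) → Matrix (Fin n) (Fin n) ℝ)
    (i : Fin n) (y : EuclideanSpace ℝ (Fin n)) : Matrix (Fin n) (Fin n) ℝ :=
  ∑ b, jacobian φ y b i • Γ b (φ y)

theorem MatSmooth.comp {F : EuclideanSpace ℝ (Fin n) → Matrix (Fin n) (Fin n) ℝ}
    {φ : EuclideanSpace ℝ (Fin n) → EuclideanSpace ℝ (Fin n)}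
    {U V : Set (EuclideanSpace ℝ (Fin n))} (hF : MatSmooth F V) (hφ : ContDiffOn ℝ ∞ φ U)
    (hUV : MapsTo φ U V) : MatSmooth (fun z => F (φ z)) U := fun a b =>
  (hF a b).comp hφ hUV

theorem matSmooth_pullbackForm {φ : EuclideanSpace ℝ (Fin n) → EuclideanSpace ℝ (Fin n)}
    {Γ : Fin n → EuclideanSpace ℝ (Fin n) → Matrix (Fin n) (Fin n) ℝ}
    {U V : Set (EuclideanSpace ℝ (Fin n))} (hU : IsOpen U) (hφ : ContDiffOn ℝ ∞ φ U)
    (hUV : MapsTo φ U V) (hΓ : ∀ b, MatSmooth (Γ b) V) (i : Fin n) :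
    MatSmooth (pullbackForm φ Γ i) U := fun a c => by
  simp only [pullbackForm, Matrix.sum_apply, Matrix.smul_apply, smul_eq_mul]
  exact ContDiffOn.sum fun b _ => (matSmooth_jacobian hU hφ b i).mul ((hΓ b).comp hφ hUV a c)

/-- The product rule applied to `Jᵀ (G' ∘ φ) J`. Symmetry of `G'` brings the two second-derivative
sums to the same shape, with `j` and `l` exchanged, so that they can cancel later. -/
theorem pderiv_gram_pullback {φ : EuclideanSpace ℝ (Fin n) → EuclideanSpace ℝ (Fin n)}
    {G G' : EuclideanSpace ℝ (Fin n) → Matrix (Fin n) (Fin n) ℝ}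
    {U V : Set (EuclideanSpace ℝ (Fin n))} (hU : IsOpen U) (hV : IsOpen V)
    (hφ : ContDiffOn ℝ ∞ φ U) (hUV : MapsTo φ U V) (hG' : MatSmooth G' V)
    (hsymm : ∀ z ∈ V, ∀ a b, G' z a b = G' z b a)
    (h : ∀ z ∈ U, ∀ i j, G z i j = ∑ a, ∑ b, jacobian φ z a i * jacobian φ z b j * G' (φ z) a b)
    {y} (hy : y ∈ U) (i j l : Fin n) :
    pderiv i (fun z => G z j l) y =
      (∑ a, ∑ b, matDeriv i (jacobian φ) y a j * jacobian φ y b l * G' (φ y) a b)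
      + (∑ a, ∑ b, matDeriv i (jacobian φ) y a l * jacobian φ y b j * G' (φ y) a b)
      + ∑ c, ∑ a, ∑ b, jacobian φ y c i * jacobian φ y a j * jacobian φ y b l *
          pderiv c (fun z => G' z a b) (φ y) := by
  have hJ := matSmooth_jacobian hU hφ
  have hGφ := hG'.comp hφ hUV
  have e1 : pderiv i (fun z => G z j l) y = pderiv i (fun z => ∑ a, ∑ b,
      jacobian φ z a j * jacobian φ z b l * G' (φ z) a b) y := by
    refine pderiv_congr ?_ i
    filter_upwards [hU.mem_nhds hy] with z hz using h z hz j l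
  have dJ := fun a b => hJ.differentiableAt hU hy a b
  have dG := fun a b => hGφ.differentiableAt hU hy a b
  have d1 := fun a b => ((dJ a j).fun_mul (dJ b l)).fun_mul (dG a b)
  have dφ : DifferentiableAt ℝ φ y := (hφ.contDiffAt (hU.mem_nhds hy)).differentiableAt (by simp)
  rw [e1, pderiv_sum _ fun a _ => DifferentiableAt.fun_sum fun b _ => d1 a b]
  have e2 : ∀ a, pderiv i (fun z => ∑ b, jacobian φ z a j * jacobian φ z b l * G' (φ z) a b) y
      = ∑ b, (matDeriv i (jacobian φ) y a j * jacobian φ y b l * G' (φ y) a b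
        + matDeriv i (jacobian φ) y b l * jacobian φ y a j * G' (φ y) b a
        + ∑ c, jacobian φ y c i * jacobian φ y a j * jacobian φ y b l *
          pderiv c (fun z => G' z a b) (φ y)) := by
    intro a
    rw [pderiv_sum _ fun b _ => d1 a b]
    refine Finset.sum_congr rfl fun b _ => ?_
    rw [pderiv_mul ((dJ a j).fun_mul (dJ b l)) (dG a b), pderiv_mul (dJ a j) (dJ b l),
      pderiv_comp (hG'.differentiableAt hV (hUV hy) a b) dφ, hsymm _ (hUV hy) b a]
    simp only [matDeriv, Finset.mul_sum]
    rw [add_mul]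
    congr 1
    · ring
    · refine Finset.sum_congr rfl fun c _ => ?_
      simp only [jacobian]; ring
  simp only [e2, Finset.sum_add_distrib]
  congr 1
  · congr 1
    rw [Finset.sum_comm]
  · exact (Finset.sum_congr rfl fun a _ => Finset.sum_comm).trans Finset.sum_comm

/-- The transformation law of the Christoffel symbols. -/
theorem jacobian_mul_christoffelMat {φ : EuclideanSpace ℝ (Fin n) → EuclideanSpace ℝ (Fin n)}
    {G G' : EuclideanSpace ℝ (Fin n) → Matrix (Fin n) (Fin n) ℝ}
    {U V : Set (EuclideanSpace ℝ (Fin n))} (hU : IsOpen U) (hV : IsOpen V)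
    (hφ : ContDiffOn ℝ ∞ φ U) (hUV : MapsTo φ U V) (hG' : MatSmooth G' V)
    (hsymm : ∀ z ∈ V, ∀ a b, G' z a b = G' z b a)
    (h0 : ∀ z ∈ U, (G z).det ≠ 0) (h0' : ∀ z ∈ V, (G' z).det ≠ 0)
    (h : ∀ z ∈ U, ∀ i j, G z i j = ∑ a, ∑ b, jacobian φ z a i * jacobian φ z b j * G' (φ z) a b)
    {y} (hy : y ∈ U) (i : Fin n) :
    jacobian φ y * christoffelMat G i y
      = matDeriv i (jacobian φ) y + pullbackForm φ (christoffelMat G') i y * jacobian φ y := by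
  set J := jacobian φ y with hJdef
  have hGJ : G y = J.transpose * G' (φ y) * J := by
    ext i j
    rw [h y hy i j]
    simp only [Matrix.mul_apply, Finset.sum_mul, Matrix.transpose_apply]
    rw [Finset.sum_comm]
    exact Finset.sum_congr rfl fun a _ => Finset.sum_congr rfl fun b _ => by ring
  -- Since `Jᵀ G' J = G` is invertible, `Jᵀ G'` may be cancelled on the left. After multiplying by
  -- it, the left side becomes `G Γ_i`, the symbols of the first kind.
  have hu : IsUnit (J.transpose * G' (φ y)).det := by
    have := h0 y hy
    rw [hGJ, Matrix.det_mul] at this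
    exact isUnit_iff_ne_zero.2 (left_ne_zero_of_mul this)
  have hinj : ∀ X Y : Matrix (Fin n) (Fin n) ℝ,
      J.transpose * G' (φ y) * X = J.transpose * G' (φ y) * Y → X = Y := by
    intro X Y hXY
    have := congrArg (fun Z => (J.transpose * G' (φ y))⁻¹ * Z) hXY
    simpa [Matrix.nonsing_inv_mul_cancel_left _ _ hu] using this
  apply hinj
  rw [← mul_assoc, ← hGJ]
  have hcomm : ∀ i j a, matDeriv i (jacobian φ) y a j = matDeriv j (jacobian φ) y a i := by
    intro i j a
    exact pderiv_comm (((EuclideanSpace.proj a : EuclideanSpace ℝ (Fin n) →L[ℝ] ℝ).contDiff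
      |>.comp_contDiffOn hφ).contDiffAt (hU.mem_nhds hy)) i j
  ext l j
  rw [mul_christoffelMat_apply (h0 y hy)]
  have P := pderiv_gram_pullback hU hV hφ hUV hG' hsymm h hy
  rw [P i j l, P j i l, P l i j]
  -- Six second-derivative sums occur. After `∂_i J_j = ∂_j J_i` is used, four cancel and the other
  -- two coincide, which absorbs the factor `1/2`.
  have hS : ∀ i j l, (∑ a, ∑ b, matDeriv i (jacobian φ) y a j * jacobian φ y b l * G' (φ y) a b)
      = ∑ a, ∑ b, matDeriv j (jacobian φ) y a i * jacobian φ y b l * G' (φ y) a b := by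
    intro i j l
    simp only [hcomm i j]
  rw [hS j i l, hS l i j, hS l j i]
  have hT1 : (∑ c, ∑ a, ∑ b, jacobian φ y c j * jacobian φ y a i * jacobian φ y b l *
          pderiv c (fun z => G' z a b) (φ y)) =
      ∑ d, ∑ c, ∑ a, J d i * J c j * J a l * pderiv c (fun z => G' z d a) (φ y) := by
    rw [Finset.sum_comm]
    refine Finset.sum_congr rfl fun d _ => Finset.sum_congr rfl fun c _ =>
      Finset.sum_congr rfl fun a _ => by simp only [← hJdef]; ring
  have hT2 : (∑ c, ∑ a, ∑ b, jacobian φ y c l * jacobian φ y a i * jacobian φ y b j *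
          pderiv c (fun z => G' z a b) (φ y)) =
      ∑ d, ∑ c, ∑ a, J d i * J c j * J a l * pderiv a (fun z => G' z d c) (φ y) := by
    rw [Finset.sum_comm]
    refine Finset.sum_congr rfl fun d _ => ?_
    rw [Finset.sum_comm]
    refine Finset.sum_congr rfl fun c _ =>
      Finset.sum_congr rfl fun a _ => by simp only [← hJdef]; ring
  rw [hT1, hT2]
  have hR1 : (J.transpose * G' (φ y) * matDeriv i (jacobian φ) y) l j =
      ∑ a, ∑ b, matDeriv i (jacobian φ) y a j * jacobian φ y b l * G' (φ y) a b := by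
    simp only [Matrix.mul_apply, Finset.sum_mul, Matrix.transpose_apply]
    refine Finset.sum_congr rfl fun a _ => Finset.sum_congr rfl fun b _ => ?_
    rw [hsymm _ (hUV hy) a b, ← hJdef]; ring
  have hR2 : (J.transpose * G' (φ y) * (pullbackForm φ (christoffelMat G') i y * J)) l j =
      ∑ d, ∑ c, ∑ a, J d i * J c j * J a l * ((1 / 2) *
        (pderiv d (fun z => G' z c a) (φ y) + pderiv c (fun z => G' z d a) (φ y)
          - pderiv a (fun z => G' z d c) (φ y))) := by
    have e : J.transpose * G' (φ y) * (pullbackForm φ (christoffelMat G') i y * J)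
        = ∑ d, J d i • (J.transpose * (G' (φ y) * christoffelMat G' d (φ y)) * J) := by
      simp only [pullbackForm, Finset.sum_mul, Finset.mul_sum, Matrix.smul_mul, Matrix.mul_smul,
        mul_assoc, ← hJdef]
    rw [e, Matrix.sum_apply]
    refine Finset.sum_congr rfl fun d _ => ?_
    simp only [Matrix.smul_apply, Matrix.mul_apply (M := _ * _) (N := J),
      Matrix.mul_apply (M := J.transpose), mul_christoffelMat_apply (h0' _ (hUV hy)),
      Matrix.transpose_apply, smul_eq_mul, Finset.mul_sum, Finset.sum_mul]
    refine Finset.sum_congr rfl fun c _ => Finset.sum_congr rfl fun a _ => by ring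
  rw [mul_add, Matrix.add_apply, hR1, hR2]
  have hR3 : (∑ d, ∑ c, ∑ a, J d i * J c j * J a l * ((1 / 2) *
        (pderiv d (fun z => G' z c a) (φ y) + pderiv c (fun z => G' z d a) (φ y)
          - pderiv a (fun z => G' z d c) (φ y)))) = (1 / 2) *
      ((∑ d, ∑ c, ∑ a, J d i * J c j * J a l * pderiv d (fun z => G' z c a) (φ y))
      + (∑ d, ∑ c, ∑ a, J d i * J c j * J a l * pderiv c (fun z => G' z d a) (φ y))
      - ∑ d, ∑ c, ∑ a, J d i * J c j * J a l * pderiv a (fun z => G' z d c) (φ y)) := by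
    simp only [← Finset.sum_add_distrib, ← Finset.sum_sub_distrib, Finset.mul_sum]
    refine Finset.sum_congr rfl fun d _ => Finset.sum_congr rfl fun c _ =>
      Finset.sum_congr rfl fun a _ => by ring
  rw [hR3]
  ring

end CoordinateInvariance

/-! ### Invariance of the scalar curvature expression -/

section CoordinateInvariance

variable {n : ℕ}

/-- The second derivatives of `φ` enter `∂_i A_j` symmetrically in `i, j` and drop out of the
antisymmetrised expression; the rest is the chain rule and bilinearity. -/
theorem curvMat_pullbackForm {φ : EuclideanSpace ℝ (Fin n) → EuclideanSpace ℝ (Fin n)}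
    {Γ : Fin n → EuclideanSpace ℝ (Fin n) → Matrix (Fin n) (Fin n) ℝ}
    {U V : Set (EuclideanSpace ℝ (Fin n))} (hU : IsOpen U) (hV : IsOpen V)
    (hφ : ContDiffOn ℝ ∞ φ U) (hUV : MapsTo φ U V) (hΓ : ∀ b, MatSmooth (Γ b) V)
    {y} (hy : y ∈ U) (i j : Fin n) :
    curvMat (pullbackForm φ Γ) i j y =
      ∑ a, ∑ b, (jacobian φ y a i * jacobian φ y b j) • curvMat Γ a b (φ y) := by
  have dφ : DifferentiableAt ℝ φ y := (hφ.contDiffAt (hU.mem_nhds hy)).differentiableAt (by simp)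
  have hJ := matSmooth_jacobian hU hφ
  have e1 : ∀ i j, matDeriv i (pullbackForm φ Γ j) y =
      ∑ b, matDeriv i (jacobian φ) y b j • Γ b (φ y)
      + ∑ a, ∑ b, (jacobian φ y a i * jacobian φ y b j) • matDeriv a (Γ b) (φ y) := by
    intro i j
    rw [Finset.sum_comm (γ := Fin n), ← Finset.sum_add_distrib]
    ext p q
    have d1 := fun b => hJ.differentiableAt hU hy b j
    have d2 := fun b => ((hΓ b).comp hφ hUV).differentiableAt hU hy p q
    simp only [matDeriv, pullbackForm, Matrix.sum_apply, Matrix.smul_apply, smul_eq_mul]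
    rw [pderiv_sum _ fun b _ => (d1 b).fun_mul (d2 b)]
    refine Finset.sum_congr rfl fun b _ => ?_
    rw [pderiv_mul (d1 b) (d2 b), pderiv_comp ((hΓ b).differentiableAt hV (hUV hy) p q) dφ]
    simp only [Matrix.add_apply, Matrix.smul_apply, Matrix.sum_apply, smul_eq_mul, Finset.mul_sum]
    congr 1
    exact Finset.sum_congr rfl fun a _ => by simp only [jacobian, matDeriv]; ring
  have e2 : ∀ i j, pullbackForm φ Γ i y * pullbackForm φ Γ j y =
      ∑ a, ∑ b, (jacobian φ y a i * jacobian φ y b j) • (Γ a (φ y) * Γ b (φ y)) := by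
    intro i j
    simp only [pullbackForm, Finset.sum_mul, Finset.mul_sum, Matrix.smul_mul, Matrix.mul_smul,
      smul_smul]
    rw [Finset.sum_comm]
    exact Finset.sum_congr rfl fun a _ => Finset.sum_congr rfl fun b _ => by rw [mul_comm]
  have hcomm : ∀ b, matDeriv i (jacobian φ) y b j = matDeriv j (jacobian φ) y b i := by
    intro b
    exact pderiv_comm (((EuclideanSpace.proj b : EuclideanSpace ℝ (Fin n) →L[ℝ] ℝ).contDiff
      |>.comp_contDiffOn hφ).contDiffAt (hU.mem_nhds hy)) i j
  have e3 : ∀ X : Fin n → Fin n → Matrix (Fin n) (Fin n) ℝ,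
      ∑ a, ∑ b, (jacobian φ y a j * jacobian φ y b i) • X a b
      = ∑ a, ∑ b, (jacobian φ y a i * jacobian φ y b j) • X b a := by
    intro X
    rw [Finset.sum_comm]
    exact Finset.sum_congr rfl fun a _ => Finset.sum_congr rfl fun b _ => by rw [mul_comm]
  simp only [curvMat]
  rw [e1, e1, e2, e2, e3, e3]
  simp only [hcomm, smul_add, smul_sub, Finset.sum_add_distrib, Finset.sum_sub_distrib]
  abel

/-- The gauge law conjugates the curvature by `J` and the pullback adds one `J` for each form index.
In the Ricci trace one of these meets `J⁻¹`, so `Ric = Jᵀ Ric' J`; then `G⁻¹ = J⁻¹ G'⁻¹ J⁻ᵀ` and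
cyclicity of the trace remove the remaining factors. -/
theorem scalarCoord_pullback {φ : EuclideanSpace ℝ (Fin n) → EuclideanSpace ℝ (Fin n)}
    {G G' : EuclideanSpace ℝ (Fin n) → Matrix (Fin n) (Fin n) ℝ}
    {U V : Set (EuclideanSpace ℝ (Fin n))} (hU : IsOpen U) (hV : IsOpen V)
    (hφ : ContDiffOn ℝ ∞ φ U) (hUV : MapsTo φ U V) (hG : MatSmooth G U) (hG' : MatSmooth G' V)
    (hsymm : ∀ z ∈ V, ∀ a b, G' z a b = G' z b a)
    (h0 : ∀ z ∈ U, (G z).det ≠ 0) (h0' : ∀ z ∈ V, (G' z).det ≠ 0)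
    (h : ∀ z ∈ U, ∀ i j, G z i j = ∑ a, ∑ b, jacobian φ z a i * jacobian φ z b j * G' (φ z) a b)
    {y} (hy : y ∈ U) : scalarCoord G y = scalarCoord G' (φ y) := by
  have hΓ := matSmooth_christoffelMat hU hG h0
  have hΓ' := matSmooth_christoffelMat hV hG' h0'
  have hA := matSmooth_pullbackForm hU hφ hUV hΓ'
  have hJs := matSmooth_jacobian hU hφ
  have hgauge := curvMat_gauge hU hΓ hA hJs
    (fun i z hz => jacobian_mul_christoffelMat hU hV hφ hUV hG' hsymm h0 h0' h hz i) hy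
  set J := jacobian φ y with hJdef
  have hGJ : G y = J.transpose * G' (φ y) * J := by
    ext i j
    rw [h y hy i j]
    simp only [Matrix.mul_apply, Finset.sum_mul, Matrix.transpose_apply]
    rw [Finset.sum_comm]
    exact Finset.sum_congr rfl fun a _ => Finset.sum_congr rfl fun b _ => by ring
  have hJu : IsUnit J.det := by
    have := h0 y hy
    rw [hGJ, Matrix.det_mul] at this
    exact isUnit_iff_ne_zero.2 (right_ne_zero_of_mul this)
  have hJJ : J * J⁻¹ = 1 := Matrix.mul_nonsing_inv _ hJu
  set Ric : Matrix (Fin n) (Fin n) ℝ := fun j k => ricciCoord G j k y with hRic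
  set Ric' : Matrix (Fin n) (Fin n) ℝ := fun j k => ricciCoord G' j k (φ y) with hRic'
  have hR : Ric = J.transpose * Ric' * J := by
    ext j k
    have e1 : ∀ i, curvMat (christoffelMat G) i j y
        = J⁻¹ * (curvMat (pullbackForm φ (christoffelMat G')) i j y * J) := by
      intro i
      rw [← hgauge, Matrix.nonsing_inv_mul_cancel_left _ _ hJu]
    have e2 : ∀ i, curvMat (christoffelMat G) i j y i k = ∑ a, ∑ b, ∑ l, J b j *
        (J a i * J⁻¹ i l) * (curvMat (christoffelMat G') a b (φ y) * J) l k := by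
      intro i
      rw [e1, curvMat_pullbackForm hU hV hφ hUV hΓ' hy]
      simp only [Finset.sum_mul, Finset.mul_sum, Matrix.smul_mul, Matrix.mul_smul,
        Matrix.sum_apply, Matrix.smul_apply, ← hJdef]
      refine Finset.sum_congr rfl fun a _ => Finset.sum_congr rfl fun b _ => ?_
      rw [Matrix.mul_apply, smul_eq_mul, Finset.mul_sum]
      refine Finset.sum_congr rfl fun l _ => by ring
    have e3 : ∀ a b l, ∑ i, J b j * (J a i * J⁻¹ i l) *
        (curvMat (christoffelMat G') a b (φ y) * J) l k
        = if a = l then J b j * (curvMat (christoffelMat G') a b (φ y) * J) l k else 0 := by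
      intro a b l
      rw [← Finset.sum_mul, ← Finset.mul_sum]
      have : ∑ i, J a i * J⁻¹ i l = (1 : Matrix (Fin n) (Fin n) ℝ) a l := by
        rw [← hJJ, Matrix.mul_apply]
      rw [this, Matrix.one_apply]
      split_ifs <;> simp
    have e4 : Ric j k = ∑ a, ∑ b, J b j * (curvMat (christoffelMat G') a b (φ y) * J) a k := by
      simp only [hRic, ricciCoord_eq_curvMat]
      simp only [e2]
      rw [Finset.sum_comm]
      refine Finset.sum_congr rfl fun a _ => ?_
      rw [Finset.sum_comm]
      refine Finset.sum_congr rfl fun b _ => ?_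
      rw [Finset.sum_comm]
      simp only [e3]
      simp
    rw [e4, mul_assoc, Matrix.mul_apply, Finset.sum_comm]
    refine Finset.sum_congr rfl fun b _ => ?_
    rw [← Finset.mul_sum, Matrix.transpose_apply, Matrix.mul_apply]
    congr 1
    simp only [Matrix.mul_apply, hRic', ricciCoord_eq_curvMat, Finset.sum_mul]
    rw [Finset.sum_comm]
  have htr : ∀ A B : Matrix (Fin n) (Fin n) ℝ, ∑ j, ∑ k, A j k * B j k
      = (A * B.transpose).trace := by
    intro A B
    simp [Matrix.trace, Matrix.mul_apply]
  have e5 : scalarCoord G y = ((G y)⁻¹ * Ric.transpose).trace := htr _ _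
  have e6 : scalarCoord G' (φ y) = ((G' (φ y))⁻¹ * Ric'.transpose).trace := htr _ _
  rw [e5, e6, hR, hGJ, Matrix.transpose_mul, Matrix.transpose_mul, Matrix.transpose_transpose,
    Matrix.mul_inv_rev, Matrix.mul_inv_rev]
  have hJt : (J.transpose)⁻¹ * J.transpose = 1 := by
    rw [Matrix.nonsing_inv_mul]; rwa [Matrix.det_transpose]
  have e7 : J⁻¹ * ((G' (φ y))⁻¹ * (J.transpose)⁻¹) * (J.transpose * (Ric'.transpose * J))
      = J⁻¹ * ((G' (φ y))⁻¹ * Ric'.transpose * J) := by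
    calc _ = J⁻¹ * ((G' (φ y))⁻¹ * ((J.transpose)⁻¹ * J.transpose) * Ric'.transpose * J) := by
          simp only [mul_assoc]
      _ = _ := by rw [hJt, mul_one]
  rw [e7, Matrix.trace_mul_comm, mul_assoc, hJJ, mul_one]

end CoordinateInvariance

/-! ### Continuity and boundedness of the scalar curvature -/

section ScalarCurvature

variable {n : ℕ} {M : Type*} [TopologicalSpace M]
  [ChartedSpace (EuclideanSpace ℝ (Fin n)) M] [IsManifold (𝓡 n) ∞ M]

theorem matSmooth_gram (g : Metric n M) (c : M) :
    MatSmooth (gram g c) (extChartAt (𝓡 n) c).target := fun i j => contDiffOn_gram g c i j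

theorem det_gram_pos (g : Metric n M) {c : M} {y : EuclideanSpace ℝ (Fin n)}
    (hy : y ∈ (extChartAt (𝓡 n) c).target) : 0 < (gram g c y).det := (posDef_gram g hy).det_pos

/-- The scalar curvature may be computed in any chart. -/
theorem scalarCurv_eq (g : Metric n M) {c x : M} (hx : x ∈ (extChartAt (𝓡 n) c).source) :
    scalarCurv g x = scalarCoord (gram g c) (extChartAt (𝓡 n) c x) := by
  have hy : extChartAt (𝓡 n) x x ∈ coordDom (n := n) x c :=
    ⟨mem_extChartAt_target x, by simpa [extChartAt_to_inv] using hx⟩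
  have h := scalarCoord_pullback (φ := coordChange x c) (G := gram g x) (G' := gram g c)
    (isOpen_coordDom x c) (isOpen_extChartAt_target (I := 𝓡 n) c) (contDiffOn_coordChange x c)
    (fun z hz => coordChange_mem_target hz)
    (fun i j => (contDiffOn_gram g x i j).mono inter_subset_left) (matSmooth_gram g c)
    (fun z _ a b => gram_symm g c z a b) (fun z hz => (det_gram_pos g hz.1).ne')
    (fun z hz => (det_gram_pos g hz).ne') (fun z hz i j => gram_coordChange g hz i j) hy
  rw [scalarCurv, h]
  simp [coordChange]

/-- The definition uses a new chart at each point; by `scalarCurv_eq` the single chart at `c` serves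
a whole neighbourhood, where the expression is smooth in the coordinates. -/
theorem continuous_scalarCurv (g : Metric n M) : Continuous (scalarCurv g) := by
  refine continuous_iff_continuousAt.2 fun c => ?_
  have h1 : ContinuousAt (fun x => scalarCoord (gram g c) (extChartAt (𝓡 n) c x)) c := by
    refine ContinuousAt.comp (g := scalarCoord (gram g c)) ?_ (continuousAt_extChartAt c)
    exact ((contDiffOn_scalarCoord (isOpen_extChartAt_target c) (matSmooth_gram g c)
      (fun z hz => (det_gram_pos g hz).ne')).continuousOn).continuousAt
        (extChartAt_target_mem_nhds c)
  refine h1.congr ?_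
  filter_upwards [extChartAt_source_mem_nhds (I := 𝓡 n) c] with x hx
  exact (scalarCurv_eq g hx).symm

theorem exists_bound_scalarCurv [CompactSpace M] (g : Metric n M) :
    ∃ K : ℝ, 0 ≤ K ∧ ∀ x, |scalarCurv g x| ≤ K := by
  obtain ⟨K, hK⟩ := isCompact_univ.exists_bound_of_continuousOn
    (continuous_scalarCurv g).continuousOn
  exact ⟨max K 0, le_max_right _ _, fun x => (hK x (mem_univ x)).trans (le_max_left _ _)⟩

/-- Compactness bounds `R` from below; without such a bound the real infimum would be a default
value. -/
theorem minScalarNeg_le [CompactSpace M] (g : Metric n M) (x : M) :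
    minScalarNeg g ≤ scalarCurv g x := by
  obtain ⟨K, hK0, hK⟩ := exists_bound_scalarCurv g
  refine (ciInf_le ⟨-K, ?_⟩ x).trans (min_le_left _ _)
  rintro _ ⟨z, rfl⟩
  exact le_min (neg_le_of_abs_le (hK z)) (by linarith)

end ScalarCurvature

/-! ### Gradients in coordinates and Cauchy–Schwarz in the fibres -/

section Gradient

variable {n : ℕ} {M : Type*} [TopologicalSpace M]
  [ChartedSpace (EuclideanSpace ℝ (Fin n)) M] [IsManifold (𝓡 n) ∞ M]

theorem contDiffOn_comp_symm {f : M → ℝ} (hf : ContMDiff (𝓡 n) 𝓘(ℝ, ℝ) ∞ f) (c : M) :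
    ContDiffOn ℝ ∞ (f ∘ (extChartAt (𝓡 n) c).symm) (extChartAt (𝓡 n) c).target :=
  (hf.comp_contMDiffOn (contMDiffOn_extChartAt_symm c)).contDiffOn

theorem fderiv_comp_symm {f : M → ℝ} (hf : ContMDiff (𝓡 n) 𝓘(ℝ, ℝ) ∞ f) {c : M}
    {y : EuclideanSpace ℝ (Fin n)} (hy : y ∈ (extChartAt (𝓡 n) c).target)
    (w : EuclideanSpace ℝ (Fin n)) :
    fderiv ℝ (f ∘ (extChartAt (𝓡 n) c).symm) y w
      = mfderiv (𝓡 n) 𝓘(ℝ, ℝ) f ((extChartAt (𝓡 n) c).symm y)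
        (mfderiv 𝓘(ℝ, EuclideanSpace ℝ (Fin n)) (𝓡 n) (extChartAt (𝓡 n) c).symm y w) := by
  rw [← mfderiv_eq_fderiv, mfderiv_comp y (hf.mdifferentiableAt (by simp))
    (mdifferentiableAt_extChartAt_symm hy)]
  rfl

theorem mfderiv_symm_surjective {c : M} {y : EuclideanSpace ℝ (Fin n)}
    (hy : y ∈ (extChartAt (𝓡 n) c).target) :
    Function.Surjective
      (mfderiv 𝓘(ℝ, EuclideanSpace ℝ (Fin n)) (𝓡 n) (extChartAt (𝓡 n) c).symm y) := by
  have h := isInvertible_mfderivWithin_extChartAt_symm (I := 𝓡 n) hy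
  simp only [ModelWithCorners.range_eq_univ, mfderivWithin_univ] at h
  exact h.bijective.surjective

/-- The coordinates `g^{ij} ∂_j (f ∘ ψ)` of the gradient in the chart centred at `c`. -/
noncomputable def gradCoord (g : Metric n M) (f : M → ℝ) (c : M) (y : EuclideanSpace ℝ (Fin n)) :
    EuclideanSpace ℝ (Fin n) :=
  WithLp.toLp 2 (Matrix.mulVec (gram g c y)⁻¹
    fun j => pderiv j (f ∘ (extChartAt (𝓡 n) c).symm) y)

/-- The pushforward of `g^{ij}∂_j f` has the defining property of the gradient, and the representing
vector is unique. This gives the chosen gradient an explicit, visibly continuous form. -/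
theorem grad_symm (g : Metric n M) {f : M → ℝ} (hf : ContMDiff (𝓡 n) 𝓘(ℝ, ℝ) ∞ f) {c : M}
    {y : EuclideanSpace ℝ (Fin n)} (hy : y ∈ (extChartAt (𝓡 n) c).target) :
    grad g f ((extChartAt (𝓡 n) c).symm y)
      = mfderiv 𝓘(ℝ, EuclideanSpace ℝ (Fin n)) (𝓡 n) (extChartAt (𝓡 n) c).symm y
        (gradCoord g f c y) := by
  refine (exists_riesz g _ (mfderiv (𝓡 n) 𝓘(ℝ, ℝ) f _)).unique (grad_spec g f _) fun u => ?_
  obtain ⟨w, rfl⟩ := mfderiv_symm_surjective hy u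
  change EuclideanSpace ℝ (Fin n) at w
  refine (inner_mfderiv_symm g c y (gradCoord g f c y) w).trans
    (Eq.trans ?_ (fderiv_comp_symm hf hy w))
  have hw : w = ∑ i, w i • (EuclideanSpace.single i (1 : ℝ) : EuclideanSpace ℝ (Fin n)) := by
    ext k; simp [Finset.sum_apply, Pi.single_apply]
  have h1 : fderiv ℝ (f ∘ (extChartAt (𝓡 n) c).symm) y w
      = ∑ j, w j * pderiv j (f ∘ (extChartAt (𝓡 n) c).symm) y := by
    conv_lhs => rw [hw]
    rw [map_sum]
    simp only [map_smul, smul_eq_mul, pderiv]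
  rw [h1, Finset.sum_comm]
  refine Finset.sum_congr rfl fun j _ => ?_
  have h2 : Matrix.mulVec (gram g c y) (gradCoord g f c y) j
      = pderiv j (f ∘ (extChartAt (𝓡 n) c).symm) y := by
    rw [gradCoord, Matrix.mulVec_mulVec, Matrix.mul_nonsing_inv _
      (isUnit_iff_ne_zero.2 (det_gram_pos g hy).ne'), Matrix.one_mulVec]
  rw [← h2, Matrix.mulVec, dotProduct, Finset.mul_sum]
  refine Finset.sum_congr rfl fun i _ => ?_
  rw [gram_symm g c y i j]
  ring

theorem continuousOn_gradCoord (g : Metric n M) {f : M → ℝ} (hf : ContMDiff (𝓡 n) 𝓘(ℝ, ℝ) ∞ f)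
    (c : M) : ContinuousOn (gradCoord g f c) (extChartAt (𝓡 n) c).target := by
  refine (PiLp.continuous_toLp 2 _).comp_continuousOn ?_
  refine continuousOn_pi.2 fun i => ?_
  simp only [Matrix.mulVec, dotProduct]
  refine continuousOn_finsetSum _ fun j _ => ?_
  exact (((matSmooth_gram g c).inv (fun z hz => (det_gram_pos g hz).ne')) i j).continuousOn.mul
    (contDiffOn_pderiv (isOpen_extChartAt_target c) (contDiffOn_comp_symm hf c) j).continuousOn

/-- The gradient of a smooth function is a continuous vector field. -/
theorem continuous_grad (g : Metric n M) {f : M → ℝ} (hf : ContMDiff (𝓡 n) 𝓘(ℝ, ℝ) ∞ f) :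
    Continuous (fun x => (⟨x, grad g f x⟩ : TangentBundle (𝓡 n) M)) := by
  refine continuous_iff_continuousAt.2 fun c => ?_
  have h1 := (contMDiffOn_extChartAt_symm (I := 𝓡 n) (n := ∞) c).continuousOn_tangentMapWithin
    (by simp) (isOpen_extChartAt_target c).uniqueMDiffOn
  have h2 : ContinuousOn (fun y : EuclideanSpace ℝ (Fin n) =>
      (⟨y, gradCoord g f c y⟩ : TangentBundle 𝓘(ℝ, EuclideanSpace ℝ (Fin n))
          (EuclideanSpace ℝ (Fin n)))) (extChartAt (𝓡 n) c).target := by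
    have h3 : ContMDiffOn 𝓘(ℝ, EuclideanSpace ℝ (Fin n))
      (𝓘(ℝ, EuclideanSpace ℝ (Fin n)).prod 𝓘(ℝ, EuclideanSpace ℝ (Fin n))) 0
      (fun y : EuclideanSpace ℝ (Fin n) =>
        (⟨y, gradCoord g f c y⟩ : TangentBundle 𝓘(ℝ, EuclideanSpace ℝ (Fin n))
          (EuclideanSpace ℝ (Fin n)))) (extChartAt (𝓡 n) c).target :=
      contMDiffOn_vectorSpace_iff_contDiffOn.2 (contDiffOn_zero.2 (continuousOn_gradCoord g hf c))
    exact h3.continuousOn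
  have h4 := (h1.comp h2 (fun y hy => hy)).continuousAt (extChartAt_target_mem_nhds c)
  refine (ContinuousAt.comp (f := extChartAt (𝓡 n) c) h4 (continuousAt_extChartAt c)).congr ?_
  filter_upwards [extChartAt_source_mem_nhds (I := 𝓡 n) c] with x hx
  have hy := (extChartAt (𝓡 n) c).map_source hx
  simp only [Function.comp, tangentMapWithin]
  rw [mfderivWithin_of_isOpen (isOpen_extChartAt_target c) hy, ← grad_symm g hf hy,
    (extChartAt (𝓡 n) c).left_inv hx]

/-- The pairing of the vectors of `TM` with the gradient of a smooth function is continuous. -/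
theorem continuous_inner_grad (g : Metric n M) {f : M → ℝ} (hf : ContMDiff (𝓡 n) 𝓘(ℝ, ℝ) ∞ f) :
    Continuous (fun p : TangentBundle (𝓡 n) M => g.inner p.1 p.2 (grad g f p.1)) := by
  -- By symmetry of `g` the pairing is `df(v)`, the fibre component of the tangent map of `f`.
  have h1 := hf.continuous_tangentMap (by simp)
  have h2 : Continuous fun p : TangentBundle 𝓘(ℝ, ℝ) ℝ => (p.2 : ℝ) :=
    (contMDiff_snd_tangentBundle_modelSpace ℝ 𝓘(ℝ, ℝ) (n := 0)).continuous
  refine (h2.comp h1).congr fun p => ?_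
  simp only [Function.comp, tangentMap]
  rw [g.symm, grad_spec]

theorem inner_self_nonneg (g : Metric n M) {x : M} (v : TangentSpace (𝓡 n) x) :
    0 ≤ g.inner x v v := by
  by_cases h : v = 0
  · simp [h]
  · exact (g.pos x v h).le

theorem vnorm_sq (g : Metric n M) {x : M} (v : TangentSpace (𝓡 n) x) :
    vnorm g v ^ 2 = g.inner x v v := Real.sq_sqrt (inner_self_nonneg g v)

theorem vnorm_nonneg (g : Metric n M) {x : M} (v : TangentSpace (𝓡 n) x) : 0 ≤ vnorm g v :=
  Real.sqrt_nonneg _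

/-- Cauchy–Schwarz: the nonnegative quadratic polynomial `t ↦ |v + t w|²` has nonpositive
discriminant. -/
theorem abs_inner_le (g : Metric n M) {x : M} (v w : TangentSpace (𝓡 n) x) :
    |g.inner x v w| ≤ vnorm g v * vnorm g w := by
  have h : ∀ t : ℝ, 0 ≤ g.inner x w w * (t * t) + 2 * g.inner x v w * t + g.inner x v v := by
    intro t
    have := inner_self_nonneg g (v + t • w)
    simp only [map_add, map_smul, add_apply, smul_apply, smul_eq_mul] at this
    rw [g.symm x w v] at this
    linarith
  have hd := discrim_le_zero h
  rw [discrim] at hd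
  rw [vnorm, vnorm, ← Real.sqrt_mul (inner_self_nonneg g v)]
  exact Real.abs_le_sqrt (by nlinarith)

theorem vnorm_smul (g : Metric n M) {x : M} (a : ℝ) (v : TangentSpace (𝓡 n) x) :
    vnorm g (a • v) = |a| * vnorm g v := by
  rw [vnorm, vnorm, ← Real.sqrt_sq_eq_abs, ← Real.sqrt_mul (sq_nonneg a)]
  congr 1
  simp only [map_smul, smul_apply, smul_eq_mul]
  ring

theorem vnorm_add_le (g : Metric n M) {x : M} (v w : TangentSpace (𝓡 n) x) :
    vnorm g (v + w) ≤ vnorm g v + vnorm g w := by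
  refine Real.sqrt_le_iff.2 ⟨add_nonneg (vnorm_nonneg g v) (vnorm_nonneg g w), ?_⟩
  have h := (le_abs_self _).trans (abs_inner_le g v w)
  simp only [map_add, add_apply]
  rw [g.symm x w v, add_sq, vnorm_sq, vnorm_sq]
  linarith

theorem vnorm_sub_sq (g : Metric n M) {x : M} (v w : TangentSpace (𝓡 n) x) :
    vnorm g (v - w) ^ 2 = vnorm g v ^ 2 - 2 * g.inner x v w + vnorm g w ^ 2 := by
  rw [vnorm_sq, vnorm_sq, vnorm_sq]
  simp only [map_sub, sub_apply]
  rw [g.symm x w v]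
  ring

theorem vnorm_zero (g : Metric n M) {x : M} : vnorm g (0 : TangentSpace (𝓡 n) x) = 0 := by
  simp [vnorm]

theorem continuous_vnorm_grad (g : Metric n M) {f : M → ℝ} (hf : ContMDiff (𝓡 n) 𝓘(ℝ, ℝ) ∞ f) :
    Continuous (fun x => vnorm g (grad g f x)) :=
  ((continuous_inner_grad g hf).comp (continuous_grad g hf)).sqrt

theorem grad_eq_of_mfderiv (g : Metric n M) {f : M → ℝ} {x : M} {v : TangentSpace (𝓡 n) x}
    (h : ∀ w, g.inner x v w = mfderiv (𝓡 n) 𝓘(ℝ, ℝ) f x w) : grad g f x = v :=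
  (exists_riesz g x (mfderiv (𝓡 n) 𝓘(ℝ, ℝ) f x)).unique (grad_spec g f x) h

theorem grad_add (g : Metric n M) {f h : M → ℝ} (hf : ContMDiff (𝓡 n) 𝓘(ℝ, ℝ) ∞ f)
    (hh : ContMDiff (𝓡 n) 𝓘(ℝ, ℝ) ∞ h) (x : M) :
    grad g (fun z => f z + h z) x = grad g f x + grad g h x := by
  refine grad_eq_of_mfderiv g fun w => ?_
  have := mfderiv_add (hf.mdifferentiableAt (x := x) (by simp))
    (hh.mdifferentiableAt (x := x) (by simp))
  have e : mfderiv (𝓡 n) 𝓘(ℝ, ℝ) (fun z => f z + h z) x = _ := this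
  rw [e, map_add, add_apply, grad_spec, grad_spec]
  rfl

theorem grad_smul (g : Metric n M) {f : M → ℝ} (hf : ContMDiff (𝓡 n) 𝓘(ℝ, ℝ) ∞ f) (a : ℝ) (x : M) :
    grad g (fun z => a * f z) x = a • grad g f x := by
  refine grad_eq_of_mfderiv g fun w => ?_
  have := const_smul_mfderiv (hf.mdifferentiableAt (x := x) (by simp)) a
  have e : mfderiv (𝓡 n) 𝓘(ℝ, ℝ) (fun z => a * f z) x = _ := this
  rw [e, map_smul, smul_apply, grad_spec]
  rfl

theorem grad_const (g : Metric n M) (a : ℝ) (x : M) : grad g (fun _ => a) x = 0 := by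
  refine grad_eq_of_mfderiv g fun w => ?_
  rw [mfderiv_const, map_zero]
  rfl

theorem grad_sub (g : Metric n M) {f h : M → ℝ} (hf : ContMDiff (𝓡 n) 𝓘(ℝ, ℝ) ∞ f)
    (hh : ContMDiff (𝓡 n) 𝓘(ℝ, ℝ) ∞ h) (x : M) :
    grad g (fun z => f z - h z) x = grad g f x - grad g h x := by
  have h1 : ContMDiff (𝓡 n) 𝓘(ℝ, ℝ) ∞ (fun z => (-1) * h z) := contMDiff_const.mul hh
  have := grad_add g hf h1 x
  rw [grad_smul g hh] at this
  simpa [sub_eq_add_neg] using this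

end Gradient

/-! ### The Riemannian volume does not depend on charts -/

section Volume

variable {n : ℕ} {M : Type*} [TopologicalSpace M]
  [ChartedSpace (EuclideanSpace ℝ (Fin n)) M] [IsManifold (𝓡 n) ∞ M]
  [MeasurableSpace M] [BorelSpace M]

theorem ContinuousOn.measurableSet_inter_preimage {X Y : Type*} [TopologicalSpace X]
    [MeasurableSpace X] [BorelSpace X] [TopologicalSpace Y] [MeasurableSpace Y] [BorelSpace Y]
    {f : X → Y} {s : Set X} (hf : ContinuousOn f s) (hs : MeasurableSet s) {t : Set Y}
    (ht : MeasurableSet t) : MeasurableSet (s ∩ f ⁻¹' t) := by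
  have h1 : Measurable (s.domRestrict f) := (continuousOn_iff_continuous_domRestrict.1 hf).measurable
  have h2 : s ∩ f ⁻¹' t = Subtype.val '' (s.domRestrict f ⁻¹' t) := by
    ext x; constructor
    · rintro ⟨hx, hxt⟩; exact ⟨⟨x, hx⟩, hxt, rfl⟩
    · rintro ⟨⟨x, hx⟩, hxt, rfl⟩; exact ⟨hx, hxt⟩
  rw [h2]
  exact (MeasurableEmbedding.subtype_coe hs).measurableSet_image.2 (h1 ht)

/-- The density `√det(g_ij)` of the volume in the chart centred at `c`. -/
noncomputable def volDensity (g : Metric n M) (c : M) (y : EuclideanSpace ℝ (Fin n)) : ℝ≥0∞ :=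
  ENNReal.ofReal (√(gram g c y).det)

theorem continuousOn_volDensity (g : Metric n M) (c : M) :
    ContinuousOn (volDensity g c) (extChartAt (𝓡 n) c).target :=
  ENNReal.continuous_ofReal.comp_continuousOn (matSmooth_gram g c).det.continuousOn.sqrt

theorem aemeasurable_volDensity (g : Metric n M) (c : M) :
    AEMeasurable (volDensity g c) (volume.restrict (extChartAt (𝓡 n) c).target) :=
  (continuousOn_volDensity g c).aemeasurable (isOpen_extChartAt_target c).measurableSet

theorem lintegral_chartVol (g : Metric n M) (c : M) {h : M → ℝ≥0∞} (hh : Measurable h) :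
    ∫⁻ x, h x ∂(chartVol g c) = ∫⁻ y in (extChartAt (𝓡 n) c).target,
      volDensity g c y * h ((extChartAt (𝓡 n) c).symm y) := by
  have h1 : AEMeasurable (extChartAt (𝓡 n) c).symm
      (volume.restrict (extChartAt (𝓡 n) c).target) :=
    (continuousOn_extChartAt_symm c).aemeasurable (isOpen_extChartAt_target c).measurableSet
  have h2 := h1.mono_ac (withDensity_absolutelyContinuous _ (volDensity g c))
  change ∫⁻ x, h x ∂(Measure.map _ (Measure.withDensity _ (volDensity g c))) = _
  rw [lintegral_map' hh.aemeasurable h2]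
  exact lintegral_withDensity_eq_lintegral_mul₀ (aemeasurable_volDensity g c)
    (hh.comp_aemeasurable h1)

theorem measurableSet_target_inter (c : M) {S : Set M} (hS : MeasurableSet S) :
    MeasurableSet ((extChartAt (𝓡 n) c).target ∩ (extChartAt (𝓡 n) c).symm ⁻¹' S) :=
  ContinuousOn.measurableSet_inter_preimage (continuousOn_extChartAt_symm c)
    (isOpen_extChartAt_target c).measurableSet hS

theorem chartVol_apply (g : Metric n M) (c : M) {S : Set M} (hS : MeasurableSet S) :
    chartVol g c S = ∫⁻ y in (extChartAt (𝓡 n) c).target ∩ (extChartAt (𝓡 n) c).symm ⁻¹' S,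
      volDensity g c y := by
  rw [← lintegral_indicator_one hS, lintegral_chartVol g c (measurable_one.indicator hS),
    ← lintegral_indicator (isOpen_extChartAt_target c).measurableSet,
    ← lintegral_indicator (measurableSet_target_inter c hS)]
  refine lintegral_congr fun y => ?_
  by_cases hy : y ∈ (extChartAt (𝓡 n) c).target <;>
  by_cases hyS : (extChartAt (𝓡 n) c).symm y ∈ S <;> 
    simp only [indicator, mem_inter_iff, mem_preimage, hy, hyS, Pi.one_apply, mul_one, mul_zero,
      and_self, and_true, and_false, if_true, if_false]

theorem det_fderiv_eq_det_jacobian {φ : EuclideanSpace ℝ (Fin n) → EuclideanSpace ℝ (Fin n)}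
    {y : EuclideanSpace ℝ (Fin n)} (hφ : DifferentiableAt ℝ φ y) :
    (fderiv ℝ φ y).det = (jacobian φ y).det := by
  rw [ContinuousLinearMap.det,
    ← LinearMap.det_toMatrix (EuclideanSpace.basisFun (Fin n) ℝ).toBasis]
  congr 1
  ext a i
  rw [LinearMap.toMatrix_apply]
  have := ((EuclideanSpace.proj a : EuclideanSpace ℝ (Fin n) →L[ℝ] ℝ).hasFDerivAt.comp y
      hφ.hasFDerivAt).fderiv
  have h2 := (congrArg (fun L : EuclideanSpace ℝ (Fin n) →L[ℝ] ℝ => L (EuclideanSpace.single i 1))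
      this).symm
  simpa [jacobian, pderiv, Function.comp_def] using h2

/-- The coordinate volumes of two charts agree on the overlap of their domains. -/
theorem chartVol_eq_chartVol (g : Metric n M) (c c' : M) {S : Set M} (hS : MeasurableSet S)
    (h1 : S ⊆ (extChartAt (𝓡 n) c).source) (h2 : S ⊆ (extChartAt (𝓡 n) c').source) :
    chartVol g c S = chartVol g c' S := by
  rw [chartVol_apply g c hS, chartVol_apply g c' hS]
  set T := (extChartAt (𝓡 n) c).target ∩ (extChartAt (𝓡 n) c).symm ⁻¹' S with hT
  have hTm : MeasurableSet T := measurableSet_target_inter c hS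
  have hTd : T ⊆ coordDom c c' := fun y hy => ⟨hy.1, h2 hy.2⟩
  have himg : (extChartAt (𝓡 n) c').target ∩ (extChartAt (𝓡 n) c').symm ⁻¹' S
      = coordChange c c' '' T := by
    ext z
    constructor
    · rintro ⟨hz, hzS⟩
      refine ⟨extChartAt (𝓡 n) c ((extChartAt (𝓡 n) c').symm z),
        ⟨(extChartAt (𝓡 n) c).map_source (h1 hzS), ?_⟩, ?_⟩
      · rw [mem_preimage, (extChartAt (𝓡 n) c).left_inv (h1 hzS)]; exact hzS
      · rw [coordChange, Function.comp, (extChartAt (𝓡 n) c).left_inv (h1 hzS),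
          (extChartAt (𝓡 n) c').right_inv hz]
    · rintro ⟨y, hy, rfl⟩
      refine ⟨coordChange_mem_target (hTd hy), ?_⟩
      rw [mem_preimage, symm_coordChange (hTd hy)]; exact hy.2
  have hd : ∀ y ∈ T, DifferentiableAt ℝ (coordChange (n := n) c c') y := fun y hy =>
    (contDiffAt_coordChange (hTd hy)).differentiableAt (by simp)
  have hinj : InjOn (coordChange (n := n) c c') T := by
    intro y hy z hz hyz
    have := congrArg (extChartAt (𝓡 n) c').symm hyz
    rw [symm_coordChange (hTd hy), symm_coordChange (hTd hz)] at this
    exact (extChartAt (𝓡 n) c).symm.injOn hy.1 hz.1 this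
  rw [himg, lintegral_image_eq_lintegral_abs_det_fderiv_mul volume hTm
    (fun y hy => (hd y hy).hasFDerivAt.hasFDerivWithinAt) hinj]
  refine setLIntegral_congr_fun hTm fun y hy => ?_
  rw [volDensity, volDensity, ← ENNReal.ofReal_mul (abs_nonneg _),
    det_fderiv_eq_det_jacobian (hd y hy)]
  congr 1
  -- Determinants in `G = Jᵀ G' J` give `√det G = |det J| √det G'`, which is the factor in the
  -- change of variables.
  have hGJ : gram g c y = (jacobian (coordChange c c') y).transpose *
      gram g c' (coordChange c c' y) * jacobian (coordChange c c') y := by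
    ext i j
    rw [gram_coordChange g (hTd hy) i j]
    simp only [Matrix.mul_apply, Finset.sum_mul, Matrix.transpose_apply]
    rw [Finset.sum_comm]
    exact Finset.sum_congr rfl fun a _ => Finset.sum_congr rfl fun b _ => by
      simp only [jacobian]; ring
  rw [hGJ, Matrix.det_mul, Matrix.det_mul, Matrix.det_transpose, ← Real.sqrt_sq_eq_abs,
    ← Real.sqrt_mul (sq_nonneg _)]
  congr 1
  ring

variable [CompactSpace M] [Nonempty M]

theorem measurableSet_piece (k : ℕ) : MeasurableSet (piece n M k) :=
  (isOpen_extChartAt_source _).measurableSet.diff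
    (isOpen_iUnion fun _ => isOpen_iUnion fun _ => isOpen_extChartAt_source _).measurableSet

theorem piece_subset_source (k : ℕ) :
    piece n M k ⊆ (extChartAt (𝓡 n) (chartSeq n M k)).source := sdiff_subset

theorem pairwise_disjoint_piece : Pairwise (Function.onFun Disjoint (piece n M)) := by
  have key : ∀ i j, i < j → Disjoint (piece n M i) (piece n M j) := by
    intro i j hij
    refine Set.disjoint_left.2 fun x hi hj => hj.2 ?_
    exact mem_iUnion₂.2 ⟨i, hij, hi.1⟩
  intro i j hij
  rcases lt_or_gt_of_ne hij with h | h
  · exact key i j h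
  · exact (key j i h).symm

theorem iUnion_piece : ⋃ k, piece n M k = univ := by
  refine eq_univ_of_forall fun x => ?_
  have hex : ∃ k, x ∈ (extChartAt (𝓡 n) (chartSeq n M k)).source :=
    Classical.choose_spec (exists_chart_cover n M) x
  classical
  refine mem_iUnion.2 ⟨Nat.find hex, Nat.find_spec hex, fun h => ?_⟩
  obtain ⟨j, hj, hx⟩ := mem_iUnion₂.1 h
  exact Nat.find_min hex hj hx

/-- On an overlap every chart gives the same volume, so the pieces of `S` may all be measured in the
chart at `c` and reassembled; the auxiliary partition disappears. -/
theorem vol_apply_of_subset_source (g : Metric n M) (c : M) {S : Set M} (hS : MeasurableSet S)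
    (h1 : S ⊆ (extChartAt (𝓡 n) c).source) : vol g S = chartVol g c S := by
  rw [vol, Measure.sum_apply _ hS]
  have e : ∀ k, (chartVol g (chartSeq n M k)).restrict (piece n M k) S
      = chartVol g c (S ∩ piece n M k) := by
    intro k
    rw [Measure.restrict_apply hS]
    exact chartVol_eq_chartVol g _ _ (hS.inter (measurableSet_piece k))
      (inter_subset_right.trans (piece_subset_source k)) (inter_subset_left.trans h1)
  simp only [e]
  rw [← measure_iUnion (fun i j hij => (pairwise_disjoint_piece hij).mono inter_subset_right
    inter_subset_right) (fun k => hS.inter (measurableSet_piece k)), ← inter_iUnion, iUnion_piece,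
    inter_univ]

theorem restrict_vol_source (g : Metric n M) (c : M) :
    (vol g).restrict (extChartAt (𝓡 n) c).source = chartVol g c := by
  ext S hS
  have ho : MeasurableSet (extChartAt (𝓡 n) c).source :=
    (isOpen_extChartAt_source (I := 𝓡 n) c).measurableSet
  rw [Measure.restrict_apply hS, vol_apply_of_subset_source g c (hS.inter ho) inter_subset_right,
    chartVol_apply g c (hS.inter ho), chartVol_apply g c hS]
  congr 2
  ext y
  simp only [mem_inter_iff, mem_preimage]
  exact ⟨fun h => ⟨h.1, h.2.1⟩, fun h => ⟨h.1, h.2, (extChartAt (𝓡 n) c).map_target h.1⟩⟩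

theorem measurableSet_symm_image (c : M) {S : Set (EuclideanSpace ℝ (Fin n))}
    (hS : MeasurableSet S) (hSt : S ⊆ (extChartAt (𝓡 n) c).target) :
    MeasurableSet ((extChartAt (𝓡 n) c).symm '' S) := by
  rw [(extChartAt (𝓡 n) c).symm_image_eq_source_inter_preimage hSt]
  exact ContinuousOn.measurableSet_inter_preimage (continuousOn_extChartAt c)
    (isOpen_extChartAt_source c).measurableSet hS

/-- Integration over a part of a chart domain, in coordinates. -/
theorem lintegral_symm_image (g : Metric n M) (c : M) {S : Set (EuclideanSpace ℝ (Fin n))}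
    (hS : MeasurableSet S) (hSt : S ⊆ (extChartAt (𝓡 n) c).target) {h : M → ℝ≥0∞}
    (hh : Measurable h) :
    ∫⁻ x in (extChartAt (𝓡 n) c).symm '' S, h x ∂(vol g)
      = ∫⁻ y in S, volDensity g c y * h ((extChartAt (𝓡 n) c).symm y) := by
  have hm := measurableSet_symm_image c hS hSt
  have hsub : (extChartAt (𝓡 n) c).symm '' S ⊆ (extChartAt (𝓡 n) c).source := by
    rintro _ ⟨y, hy, rfl⟩; exact (extChartAt (𝓡 n) c).map_target (hSt hy)
  have e : (vol g).restrict ((extChartAt (𝓡 n) c).symm '' S)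
      = (chartVol g c).restrict ((extChartAt (𝓡 n) c).symm '' S) := by
    rw [← restrict_vol_source, Measure.restrict_restrict hm, inter_eq_left.2 hsub]
  rw [e, ← lintegral_indicator hm, lintegral_chartVol g c (hh.indicator hm),
    ← lintegral_indicator (isOpen_extChartAt_target c).measurableSet, ← lintegral_indicator hS]
  refine lintegral_congr fun y => ?_
  by_cases hyS : y ∈ S
  · simp only [indicator, hyS, hSt hyS, mem_image_of_mem, if_true]
  · by_cases hy : y ∈ (extChartAt (𝓡 n) c).target
    · have : (extChartAt (𝓡 n) c).symm y ∉ (extChartAt (𝓡 n) c).symm '' S := by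
        rintro ⟨z, hz, hzy⟩
        exact hyS ((extChartAt (𝓡 n) c).symm.injOn (hSt hz) hy hzy ▸ hz)
      simp only [indicator, hyS, hy, this, if_true, if_false, mul_zero]
    · simp only [indicator, hyS, hy, if_false]

end Volume

/-! ### Coordinate balls comparable with Euclidean ones -/

section CoordinateBalls

variable {n : ℕ} {M : Type*} [TopologicalSpace M]
  [ChartedSpace (EuclideanSpace ℝ (Fin n)) M] [IsManifold (𝓡 n) ∞ M]
  [MeasurableSpace M] [BorelSpace M] [CompactSpace M] [Nonempty M]

/-- A closed ball in the chart centred at `p` on which the metric is comparable, up to the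
factor `A`, with the Euclidean one. -/
structure IsCoordBall (g : Metric n M) (p : M) (r : ℝ) (A : NNReal) : Prop where
  pos : 0 < r
  subset : Metric.closedBall (extChartAt (𝓡 n) p p) r ⊆ (extChartAt (𝓡 n) p).target
  lintegral_vol_le : ∀ S ⊆ Metric.closedBall (extChartAt (𝓡 n) p p) r, MeasurableSet S →
    ∀ h : M → ℝ≥0∞, Measurable h → ∫⁻ x in (extChartAt (𝓡 n) p).symm '' S, h x ∂(vol g)
      ≤ A * ∫⁻ y in S, h ((extChartAt (𝓡 n) p).symm y)
  lintegral_le_vol : ∀ S ⊆ Metric.closedBall (extChartAt (𝓡 n) p p) r, MeasurableSet S →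
    ∀ h : M → ℝ≥0∞, Measurable h → ∫⁻ y in S, h ((extChartAt (𝓡 n) p).symm y)
      ≤ A * ∫⁻ x in (extChartAt (𝓡 n) p).symm '' S, h x ∂(vol g)
  norm_fderiv_le : ∀ f : M → ℝ, ContMDiff (𝓡 n) 𝓘(ℝ, ℝ) ∞ f →
    ∀ y ∈ Metric.closedBall (extChartAt (𝓡 n) p p) r,
      ‖fderiv ℝ (f ∘ (extChartAt (𝓡 n) p).symm) y‖
        ≤ A * vnorm g (grad g f ((extChartAt (𝓡 n) p).symm y))

/-- Here `df(w) = g(∇f, dψ w)` and `|dψ w|_g² ≤ (∑|g_ij|) |w|²`; Cauchy–Schwarz for `g` finishes. -/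
theorem norm_fderiv_comp_symm_le (g : Metric n M) {f : M → ℝ}
    (hf : ContMDiff (𝓡 n) 𝓘(ℝ, ℝ) ∞ f) {c : M}
    {y : EuclideanSpace ℝ (Fin n)} (hy : y ∈ (extChartAt (𝓡 n) c).target) :
    ‖fderiv ℝ (f ∘ (extChartAt (𝓡 n) c).symm) y‖
      ≤ √(∑ i, ∑ j, |gram g c y i j|) * vnorm g (grad g f ((extChartAt (𝓡 n) c).symm y)) := by
  refine ContinuousLinearMap.opNorm_le_bound _
    (mul_nonneg (Real.sqrt_nonneg _) (vnorm_nonneg g _)) fun w => ?_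
  rw [fderiv_comp_symm hf hy, ← grad_spec g, Real.norm_eq_abs]
  refine (abs_inner_le g _ _).trans ?_
  have hw : vnorm g (mfderiv 𝓘(ℝ, EuclideanSpace ℝ (Fin n)) (𝓡 n) (extChartAt (𝓡 n) c).symm y w)
      ≤ √(∑ i, ∑ j, |gram g c y i j|) * ‖w‖ := by
    rw [vnorm, inner_mfderiv_symm]
    have hn : ∀ x t : ℝ, 0 ≤ x → 0 ≤ t → √(x * t ^ 2) = √x * t := fun x t hx ht => by
      rw [Real.sqrt_mul hx, Real.sqrt_sq ht]
    refine le_of_le_of_eq ?_ (hn _ _ (Finset.sum_nonneg fun i _ => Finset.sum_nonneg fun j _ =>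
      abs_nonneg _) (norm_nonneg w))
    refine Real.sqrt_le_sqrt ?_
    rw [Finset.sum_mul]
    refine Finset.sum_le_sum fun i _ => ?_
    rw [Finset.sum_mul]
    refine Finset.sum_le_sum fun j _ => ?_
    have hi : |w i| ≤ ‖w‖ := PiLp.norm_apply_le w i
    have hj : |w j| ≤ ‖w‖ := PiLp.norm_apply_le w j
    calc w i * w j * gram g c y i j ≤ |w i * w j * gram g c y i j| := le_abs_self _
      _ = |gram g c y i j| * (|w i| * |w j|) := by rw [abs_mul, abs_mul]; ring
      _ ≤ |gram g c y i j| * ‖w‖ ^ 2 := by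
        rw [sq]; gcongr
  calc _ ≤ vnorm g (grad g f ((extChartAt (𝓡 n) c).symm y)) *
        (√(∑ i, ∑ j, |gram g c y i j|) * ‖w‖) := by
        gcongr
        exact vnorm_nonneg g _
    _ = _ := by ring

theorem exists_isCoordBall (g : Metric n M) (p : M) {s : Set M} (hs : s ∈ 𝓝 p) :
    ∃ (r : ℝ) (A : NNReal), IsCoordBall g p r A ∧
      (extChartAt (𝓡 n) p).symm '' Metric.closedBall (extChartAt (𝓡 n) p p) r ⊆ s := by
  set y0 := extChartAt (𝓡 n) p p with hy0
  have hs' : (extChartAt (𝓡 n) p).symm ⁻¹' s ∈ 𝓝 y0 := by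
    refine (continuousAt_extChartAt_symm p).preimage_mem_nhds ?_
    rwa [extChartAt_to_inv]
  obtain ⟨r, hr, hball⟩ := Metric.nhds_basis_closedBall.mem_iff.1
    (inter_mem (extChartAt_target_mem_nhds (I := 𝓡 n) p) hs')
  have hsub := hball.trans inter_subset_left
  have hcomp : IsCompact (Metric.closedBall y0 r) := isCompact_closedBall _ _
  have hdc : ContinuousOn (fun y => √(gram g p y).det) (Metric.closedBall y0 r) :=
    ((matSmooth_gram g p).det.continuousOn.sqrt).mono hsub
  obtain ⟨A1, hA1⟩ := hcomp.exists_bound_of_continuousOn hdc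
  obtain ⟨A2, hA2⟩ := hcomp.exists_bound_of_continuousOn
    (hdc.inv₀ fun y hy => (Real.sqrt_pos.2 (det_gram_pos g (hsub hy))).ne')
  have hgc : ContinuousOn (fun y => √(∑ i, ∑ j, |gram g p y i j|)) (Metric.closedBall y0 r) :=
    (continuousOn_finsetSum _ fun i _ => continuousOn_finsetSum _ fun j _ =>
      ((contDiffOn_gram g p i j).continuousOn.mono hsub).abs).sqrt
  obtain ⟨A3, hA3⟩ := hcomp.exists_bound_of_continuousOn hgc
  -- `A` dominates, on the compact ball, the density `√det g` (volume against Lebesgue), its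
  -- reciprocal (Lebesgue against volume) and `√∑|g_ij|` (differential against gradient).
  set A : NNReal := Real.toNNReal (max A1 (max A2 A3)) with hA
  have hAge : max A1 (max A2 A3) ≤ A := Real.le_coe_toNNReal _
  have hle1 : ∀ y ∈ Metric.closedBall y0 r, volDensity g p y ≤ A := by
    intro y hy
    refine ENNReal.ofReal_le_of_le_toReal ?_
    exact ((le_abs_self _).trans (hA1 y hy)).trans ((le_max_left _ _).trans hAge)
  have hle2 : ∀ y ∈ Metric.closedBall y0 r, 1 ≤ A * volDensity g p y := by
    intro y hy
    have hpos := Real.sqrt_pos.2 (det_gram_pos g (hsub hy))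
    have h2 : (√(gram g p y).det)⁻¹ ≤ A := ((le_abs_self _).trans (hA2 y hy)).trans
      ((le_max_left _ _).trans ((le_max_right _ _).trans hAge))
    have h3 : 1 ≤ (A : ℝ) * √(gram g p y).det := by
      rwa [inv_le_iff_one_le_mul₀ hpos] at h2
    rw [volDensity, ← ENNReal.ofReal_coe_nnreal, ← ENNReal.ofReal_mul (NNReal.coe_nonneg A),
      ← ENNReal.ofReal_one]
    exact ENNReal.ofReal_le_ofReal h3
  refine ⟨r, A, ⟨hr, hsub, ?_, ?_, ?_⟩, ?_⟩
  · intro S hS hSm h hh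
    rw [lintegral_symm_image g p hSm (hS.trans hsub) hh, ← lintegral_const_mul' _ _ (by simp)]
    refine setLIntegral_mono' hSm fun y hy => ?_
    gcongr
    exact hle1 y (hS hy)
  · intro S hS hSm h hh
    rw [lintegral_symm_image g p hSm (hS.trans hsub) hh, ← lintegral_const_mul' _ _ (by simp)]
    refine setLIntegral_mono' hSm fun y hy => ?_
    rw [← mul_assoc]
    calc h ((extChartAt (𝓡 n) p).symm y) = 1 * h ((extChartAt (𝓡 n) p).symm y) := by rw [one_mul]
      _ ≤ _ := by gcongr; exact hle2 y (hS hy)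
  · intro f hf y hy
    refine (norm_fderiv_comp_symm_le g hf (hsub hy)).trans ?_
    gcongr
    · exact vnorm_nonneg g _
    · exact ((le_abs_self _).trans (hA3 y hy)).trans
        ((le_max_right _ _).trans ((le_max_right _ _).trans hAge))
  · rintro _ ⟨y, hy, rfl⟩
    exact (hball hy).2

namespace IsCoordBall

variable {g : Metric n M} {p : M} {r : ℝ} {A : NNReal}

theorem image_mem_nhds (hb : IsCoordBall g p r A) {ρ : ℝ} (hρ : 0 < ρ) (hρr : ρ ≤ r) :
    (extChartAt (𝓡 n) p).symm '' Metric.ball (extChartAt (𝓡 n) p p) ρ ∈ 𝓝 p := by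
  have hsub : Metric.ball (extChartAt (𝓡 n) p p) ρ ⊆ (extChartAt (𝓡 n) p).target :=
    (Metric.ball_subset_closedBall.trans (Metric.closedBall_subset_closedBall hρr)).trans hb.subset
  rw [(extChartAt (𝓡 n) p).symm_image_eq_source_inter_preimage hsub]
  exact inter_mem (extChartAt_source_mem_nhds p)
    ((continuousAt_extChartAt p).preimage_mem_nhds (Metric.ball_mem_nhds _ hρ))

theorem isOpen_image (hb : IsCoordBall g p r A) {ρ : ℝ} (hρr : ρ ≤ r) :
    IsOpen ((extChartAt (𝓡 n) p).symm '' Metric.ball (extChartAt (𝓡 n) p p) ρ) := by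
  have hsub : Metric.ball (extChartAt (𝓡 n) p p) ρ ⊆ (extChartAt (𝓡 n) p).target :=
    (Metric.ball_subset_closedBall.trans (Metric.closedBall_subset_closedBall hρr)).trans hb.subset
  rw [(extChartAt (𝓡 n) p).symm_image_eq_source_inter_preimage hsub]
  exact (continuousOn_extChartAt p).isOpen_inter_preimage (isOpen_extChartAt_source p)
    Metric.isOpen_ball

theorem vol_image_lt_top (hb : IsCoordBall g p r A) {S : Set (EuclideanSpace ℝ (Fin n))}
    (hS : S ⊆ Metric.closedBall (extChartAt (𝓡 n) p p) r) (hSm : MeasurableSet S) :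
    vol g ((extChartAt (𝓡 n) p).symm '' S) < ⊤ := by
  have h := hb.lintegral_vol_le S hS hSm (fun _ => 1) measurable_const
  rw [lintegral_const, lintegral_const, one_mul, one_mul, Measure.restrict_apply_univ,
    Measure.restrict_apply_univ] at h
  refine h.trans_lt (ENNReal.mul_lt_top (by simp) ?_)
  exact (measure_mono hS).trans_lt measure_closedBall_lt_top

theorem vol_image_pos (hb : IsCoordBall g p r A) {S : Set (EuclideanSpace ℝ (Fin n))}
    (hS : S ⊆ Metric.closedBall (extChartAt (𝓡 n) p p) r) (hSm : MeasurableSet S)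
    (h0 : volume S ≠ 0) : vol g ((extChartAt (𝓡 n) p).symm '' S) ≠ 0 := by
  intro hv
  have h := hb.lintegral_le_vol S hS hSm (fun _ => 1) measurable_const
  simp only [lintegral_const, one_mul, Measure.restrict_apply_univ, hv, mul_zero] at h
  exact h0 (le_antisymm h zero_le)

end IsCoordBall

instance isFiniteMeasure_vol (g : Metric n M) : IsFiniteMeasure (vol g) := by
  have h : ∀ p : M, ∃ U ∈ 𝓝 p, vol g U < ⊤ := by
    intro p
    obtain ⟨r, A, hb, -⟩ := exists_isCoordBall g p univ_mem
    exact ⟨_, hb.image_mem_nhds hb.pos le_rfl,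
      hb.vol_image_lt_top Metric.ball_subset_closedBall measurableSet_ball⟩
  refine ⟨isCompact_univ.measure_lt_top_of_nhdsWithin fun p _ => ?_⟩
  obtain ⟨U, hU, hv⟩ := h p
  exact ⟨U, mem_nhdsWithin_of_mem_nhds hU, hv⟩

instance isOpenPosMeasure_vol (g : Metric n M) : (vol g).IsOpenPosMeasure := by
  refine ⟨fun U hU hne h0 => ?_⟩
  obtain ⟨p, hp⟩ := hne
  obtain ⟨r, A, hb, hsub⟩ := exists_isCoordBall g p (hU.mem_nhds hp)
  refine hb.vol_image_pos Metric.ball_subset_closedBall measurableSet_ball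
    (Metric.measure_ball_pos volume _ hb.pos).ne' ?_
  exact measure_mono_null ((image_mono Metric.ball_subset_closedBall).trans hsub) h0

theorem totalVol_pos (g : Metric n M) : 0 < totalVol g := by
  rw [totalVol, Measure.real]
  exact ENNReal.toReal_pos (isOpen_univ.measure_ne_zero _ univ_nonempty) (measure_ne_top _ _)

end CoordinateBalls

/-! ### Poincaré inequality on convex Euclidean sets -/

section ConvexPoincare

variable {n : ℕ}

/-- Scaling by `t` costs the factor `t⁻ⁿ`, at most `2ⁿ` once `t` stays away from zero. -/
theorem lintegral_comp_add_smul_le {F : EuclideanSpace ℝ (Fin n) → ℝ≥0∞} (hF : Measurable F)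
    (a : EuclideanSpace ℝ (Fin n)) {t : ℝ} (ht : 1 / 2 ≤ t) :
    ∫⁻ y, F (a + t • y) ≤ 2 ^ n * ∫⁻ y, F y := by
  have ht0 : t ≠ 0 := by intro h; subst h; norm_num at ht
  have htp : 0 < t := by linarith
  have h1 : ∫⁻ y, F (a + t • y) = ∫⁻ z, F (a + z) ∂(Measure.map (t • ·) volume) := by
    exact (lintegral_map (f := fun z => F (a + z)) (hF.comp (measurable_const_add a))
      (measurable_const_smul t)).symm
  rw [h1, Measure.map_addHaar_smul volume ht0, lintegral_smul_measure,
    lintegral_add_left_eq_self]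
  simp only [smul_eq_mul, finrank_euclideanSpace, Fintype.card_fin]
  gcongr
  rw [abs_of_pos (by positivity)]
  have h2 : (t ^ n)⁻¹ ≤ 2 ^ n := by
    rw [← inv_pow]
    gcongr
    rw [inv_le_comm₀ htp (by norm_num)]
    simpa using ht
  calc ENNReal.ofReal (t ^ n)⁻¹ ≤ ENNReal.ofReal (2 ^ n) := ENNReal.ofReal_le_ofReal h2
    _ = 2 ^ n := by rw [ENNReal.ofReal_pow (by norm_num)]; norm_num

/-- The fundamental theorem of calculus along the segment, followed by Cauchy–Schwarz in the
parameter `t`. -/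
theorem enorm_sub_sq_le_lintegral {f : EuclideanSpace ℝ (Fin n) → ℝ}
    {U : Set (EuclideanSpace ℝ (Fin n))} (hU : IsOpen U) (hf : ContDiffOn ℝ 1 f U)
    {x y : EuclideanSpace ℝ (Fin n)} (hxy : segment ℝ x y ⊆ U) :
    ‖f y - f x‖ₑ ^ 2 ≤ ‖y - x‖ₑ ^ 2 *
      ∫⁻ t in Icc (0 : ℝ) 1, ‖fderiv ℝ f (x + t • (y - x))‖ₑ ^ 2 := by
  have hmem : ∀ t ∈ Icc (0 : ℝ) 1, x + t • (y - x) ∈ U := fun t ht =>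
    hxy (by rw [segment_eq_image']; exact ⟨t, ht, rfl⟩)
  have hcD : ContinuousOn (fun t : ℝ => fderiv ℝ f (x + t • (y - x))) (Icc 0 1) :=
    (hf.continuousOn_fderiv_of_isOpen hU le_rfl).comp (by fun_prop) hmem
  have hderiv : ∀ t ∈ Icc (0 : ℝ) 1, HasDerivAt (fun t : ℝ => f (x + t • (y - x)))
      (fderiv ℝ f (x + t • (y - x)) (y - x)) t := by
    intro t ht
    have h1 : HasDerivAt (fun t : ℝ => x + t • (y - x)) (y - x) t := by
      simpa using ((hasDerivAt_id t).smul_const (y - x)).const_add x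
    have h2 := ((hf.contDiffAt (hU.mem_nhds (hmem t ht))).differentiableAt
      one_ne_zero).hasFDerivAt
    exact h2.comp_hasDerivAt t h1
  have hc2 : ContinuousOn (fun t : ℝ => fderiv ℝ f (x + t • (y - x)) (y - x)) (Icc 0 1) :=
    hcD.clm_apply continuousOn_const
  have hftc : ∫ t in (0 : ℝ)..1, fderiv ℝ f (x + t • (y - x)) (y - x) = f y - f x := by
    rw [intervalIntegral.integral_eq_sub_of_hasDerivAt
      (f := fun t : ℝ => f (x + t • (y - x)))]
    · simp
    · intro t ht
      rw [uIcc_of_le zero_le_one] at ht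
      exact hderiv t ht
    · exact ContinuousOn.intervalIntegrable (by rwa [uIcc_of_le zero_le_one])
  have h1 : ‖f y - f x‖ₑ ≤ ‖y - x‖ₑ * ∫⁻ t in Icc (0 : ℝ) 1, ‖fderiv ℝ f (x + t • (y - x))‖ₑ := by
    rw [← hftc, intervalIntegral.integral_of_le zero_le_one, ← integral_Icc_eq_integral_Ioc]
    refine (enorm_integral_le_lintegral_enorm _).trans ?_
    rw [← lintegral_const_mul' _ _ (by simp)]
    refine lintegral_mono fun t => ?_
    rw [mul_comm]
    exact ContinuousLinearMap.le_opENorm _ _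
  have hm : AEMeasurable (fun t : ℝ => ‖fderiv ℝ f (x + t • (y - x))‖ₑ)
      (volume.restrict (Icc (0 : ℝ) 1)) := (hcD.aestronglyMeasurable measurableSet_Icc).enorm
  have h2 : (∫⁻ t in Icc (0 : ℝ) 1, ‖fderiv ℝ f (x + t • (y - x))‖ₑ) ^ 2
      ≤ ∫⁻ t in Icc (0 : ℝ) 1, ‖fderiv ℝ f (x + t • (y - x))‖ₑ ^ 2 := by
    have h3 := ENNReal.lintegral_mul_le_Lp_mul_Lq (volume.restrict (Icc (0 : ℝ) 1))
      Real.HolderConjugate.two_two hm (g := fun _ => 1) aemeasurable_const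
    simp only [Pi.mul_apply, mul_one, ENNReal.one_rpow, lintegral_const,
      Measure.restrict_apply_univ, Real.volume_Icc, sub_zero, ENNReal.ofReal_one] at h3
    calc _ ≤ ((∫⁻ t in Icc (0 : ℝ) 1,
          ‖fderiv ℝ f (x + t • (y - x))‖ₑ ^ (2 : ℝ)) ^ (1 / 2 : ℝ)) ^ 2 := by gcongr
      _ = _ := by
        rw [← ENNReal.rpow_natCast, ← ENNReal.rpow_mul]
        norm_num
  calc _ ≤ (‖y - x‖ₑ * ∫⁻ t in Icc (0 : ℝ) 1, ‖fderiv ℝ f (x + t • (y - x))‖ₑ) ^ 2 := by gcongr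
    _ ≤ _ := by rw [mul_pow]; gcongr

/-- The double-integral form of the Poincaré inequality on a convex set. -/
theorem lintegral_lintegral_enorm_sub_sq_le {f : EuclideanSpace ℝ (Fin n) → ℝ}
    {U Ω : Set (EuclideanSpace ℝ (Fin n))} (hU : IsOpen U) (hf : ContDiffOn ℝ 1 f U)
    (hΩ : Convex ℝ Ω) (hΩm : MeasurableSet Ω) (hΩU : Ω ⊆ U) {d : ℝ}
    (hd : ∀ x ∈ Ω, ∀ y ∈ Ω, dist x y ≤ d) :
    ∫⁻ x in Ω, ∫⁻ y in Ω, ‖f y - f x‖ₑ ^ 2 ≤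
      volume Ω * (2 ^ n * ENNReal.ofReal d ^ 2 * ∫⁻ y in Ω, ‖fderiv ℝ f y‖ₑ ^ 2) := by
  -- Extension by zero permits integration over the whole space after substitution. Nothing is lost,
  -- because convexity keeps the segment inside `Ω`.
  set F : EuclideanSpace ℝ (Fin n) → ℝ≥0∞ := Ω.indicator fun y => ‖fderiv ℝ f y‖ₑ ^ 2 with hFdef
  have hF : Measurable F :=
    ((measurable_fderiv ℝ f).enorm.pow_const 2).indicator hΩm
  have hFi : ∫⁻ y, F y = ∫⁻ y in Ω, ‖fderiv ℝ f y‖ₑ ^ 2 := lintegral_indicator hΩm _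
  have h1 : ∀ x ∈ Ω, ∀ y ∈ Ω, ‖f y - f x‖ₑ ^ 2
      ≤ ENNReal.ofReal d ^ 2 * ∫⁻ t in Icc (0 : ℝ) 1, F (x + t • (y - x)) := by
    intro x hx y hy
    refine (enorm_sub_sq_le_lintegral hU hf ((hΩ.segment_subset hx hy).trans hΩU)).trans ?_
    have e1 : ‖y - x‖ₑ ≤ ENNReal.ofReal d := by
      rw [← ofReal_norm, ← dist_eq_norm]; exact ENNReal.ofReal_le_ofReal (hd y hy x hx)
    refine mul_le_mul' (pow_le_pow_left' e1 2) ?_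
    refine setLIntegral_mono' measurableSet_Icc fun t ht => ?_
    have : x + t • (y - x) ∈ Ω := hΩ.segment_subset hx hy (by
      rw [segment_eq_image']; exact ⟨t, ht, rfl⟩)
    exact (indicator_of_mem this (fun y => ‖fderiv ℝ f y‖ₑ ^ 2)).ge
  have hjm : Measurable fun q : (EuclideanSpace ℝ (Fin n) × EuclideanSpace ℝ (Fin n)) × ℝ =>
      F (q.1.1 + q.2 • (q.1.2 - q.1.1)) := hF.comp (by fun_prop)
  calc ∫⁻ x in Ω, ∫⁻ y in Ω, ‖f y - f x‖ₑ ^ 2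
      ≤ ∫⁻ x in Ω, ∫⁻ y in Ω,
          ENNReal.ofReal d ^ 2 * ∫⁻ t in Icc (0 : ℝ) 1, F (x + t • (y - x)) :=
        setLIntegral_mono' hΩm fun x hx => setLIntegral_mono' hΩm fun y hy => h1 x hx y hy
    _ = ENNReal.ofReal d ^ 2 * ∫⁻ x in Ω, ∫⁻ y in Ω,
          ∫⁻ t in Icc (0 : ℝ) 1, F (x + t • (y - x)) := by
        rw [← lintegral_const_mul' _ _ (by simp)]
        refine lintegral_congr fun x => ?_
        rw [← lintegral_const_mul' _ _ (by simp)]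
    _ = ENNReal.ofReal d ^ 2 * ∫⁻ t in Icc (0 : ℝ) 1, ∫⁻ x in Ω, ∫⁻ y in Ω,
          F (x + t • (y - x)) := by
        congr 1
        have e1 : ∀ x, ∫⁻ y in Ω, ∫⁻ t in Icc (0 : ℝ) 1, F (x + t • (y - x))
            = ∫⁻ t in Icc (0 : ℝ) 1, ∫⁻ y in Ω, F (x + t • (y - x)) := fun x =>
          lintegral_lintegral_swap (hF.comp (by fun_prop)).aemeasurable
        simp only [e1]
        refine lintegral_lintegral_swap ?_
        have : Measurable fun q : (EuclideanSpace ℝ (Fin n) × ℝ) × EuclideanSpace ℝ (Fin n) =>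
            F (q.1.1 + q.1.2 • (q.2 - q.1.1)) := hF.comp (by fun_prop)
        exact this.lintegral_prod_right'.aemeasurable
    _ ≤ ENNReal.ofReal d ^ 2 * ∫⁻ t in Icc (0 : ℝ) 1, volume Ω * (2 ^ n * ∫⁻ y, F y) := by
        gcongr with t
        -- The point is `(1-t)x + ty`. The substitution is made in `y` when `t ≥ 1/2` and in `x`
        -- when `1 - t ≥ 1/2`, so the scaling factor never degenerates.
        rcases le_total (1 / 2) t with ht | ht
        · calc ∫⁻ x in Ω, ∫⁻ y in Ω, F (x + t • (y - x))
              ≤ ∫⁻ x in Ω, 2 ^ n * ∫⁻ y, F y := by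
                refine lintegral_mono fun x => ?_
                refine (setLIntegral_le_lintegral Ω _).trans ?_
                refine le_trans (le_of_eq ?_) (lintegral_comp_add_smul_le hF ((1 - t) • x) ht)
                refine lintegral_congr fun y => ?_
                congr 1
                module
            _ = _ := by rw [setLIntegral_const, mul_comm]
        · have hmt : Measurable fun q : EuclideanSpace ℝ (Fin n) × EuclideanSpace ℝ (Fin n) =>
              F (q.1 + t • (q.2 - q.1)) := hF.comp (by fun_prop)
          rw [lintegral_lintegral_swap (f := fun x y => F (x + t • (y - x))) hmt.aemeasurable]
          calc ∫⁻ y in Ω, ∫⁻ x in Ω, F (x + t • (y - x))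
              ≤ ∫⁻ y in Ω, 2 ^ n * ∫⁻ y, F y := by
                refine lintegral_mono fun y => ?_
                refine (setLIntegral_le_lintegral Ω _).trans ?_
                refine le_trans (le_of_eq ?_) (lintegral_comp_add_smul_le hF (t • y)
                  (t := 1 - t) (by linarith))
                refine lintegral_congr fun x => ?_
                congr 1
                module
            _ = _ := by rw [setLIntegral_const, mul_comm]
    _ = _ := by
        rw [setLIntegral_const, Real.volume_Icc, hFi]
        simp only [sub_zero, ENNReal.ofReal_one, mul_one]
        ring

/-- The Poincaré inequality on a bounded convex set. -/
theorem exists_lintegral_enorm_sub_sq_le {f : EuclideanSpace ℝ (Fin n) → ℝ}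
    {U Ω : Set (EuclideanSpace ℝ (Fin n))} (hU : IsOpen U) (hf : ContDiffOn ℝ 1 f U)
    (hΩ : Convex ℝ Ω) (hΩm : MeasurableSet Ω) (hΩU : Ω ⊆ U) (hΩf : volume Ω ≠ ⊤) {d : ℝ}
    (hd : ∀ x ∈ Ω, ∀ y ∈ Ω, dist x y ≤ d) :
    ∃ c : ℝ, ∫⁻ y in Ω, ‖f y - c‖ₑ ^ 2 ≤
      2 ^ n * ENNReal.ofReal d ^ 2 * ∫⁻ y in Ω, ‖fderiv ℝ f y‖ₑ ^ 2 := by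
  by_cases h0 : volume Ω = 0
  · refine ⟨0, ?_⟩
    rw [setLIntegral_measure_zero _ _ h0]
    exact zero_le
  -- The constant can be taken to be a value `f x`: for some `x ∈ Ω` the inner integral is at most
  -- its average over `Ω`.
  by_contra! hcon
  have h := lintegral_lintegral_enorm_sub_sq_le hU hf hΩ hΩm hΩU hd
  set K := 2 ^ n * ENNReal.ofReal d ^ 2 * ∫⁻ y in Ω, ‖fderiv ℝ f y‖ₑ ^ 2 with hK
  have hKtop : K ≠ ⊤ := ((hcon 0).trans_le le_top).ne
  have hm : AEMeasurable (fun x => ∫⁻ y in Ω, ‖f y - f x‖ₑ ^ 2) (volume.restrict Ω) := by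
    have hfm : AEMeasurable f (volume.restrict Ω) :=
      (hf.continuousOn.mono hΩU).aemeasurable hΩm
    have : AEMeasurable (fun q : EuclideanSpace ℝ (Fin n) × EuclideanSpace ℝ (Fin n) =>
        ‖f q.2 - f q.1‖ₑ ^ 2) ((volume.restrict Ω).prod (volume.restrict Ω)) :=
      ((hfm.comp_snd).sub (hfm.comp_fst)).enorm.pow_const 2
    exact this.lintegral_prod_right'
  obtain ⟨x, hx, hle⟩ := exists_le_setLAverage (f := fun x => ∫⁻ y in Ω, ‖f y - f x‖ₑ ^ 2)
    h0 hΩf hm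
  refine absurd (hle.trans ?_) (not_le.2 (hcon (f x)))
  rw [setLAverage_eq]
  exact ENNReal.div_le_of_le_mul (by rwa [mul_comm])

end ConvexPoincare

/-! ### Subdivision of a ball into small cubes -/

section Cells

variable {n : ℕ}

/-- The half-open cube of side `s` with index `k`. -/
def cubeCell (s : ℝ) (k : Fin n → ℤ) : Set (EuclideanSpace ℝ (Fin n)) :=
  {y | ∀ i, ⌊y i / s⌋ = k i}

theorem cubeCell_eq (s : ℝ) (k : Fin n → ℤ) :
    cubeCell s k = ⋂ i, {y | (k i : ℝ) ≤ y i / s ∧ y i / s < k i + 1} := by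
  ext y
  simp [cubeCell, Int.floor_eq_iff]

theorem convex_cubeCell (s : ℝ) (k : Fin n → ℤ) : Convex ℝ (cubeCell s k) := by
  rw [cubeCell_eq]
  refine convex_iInter fun i => ?_
  have hl : IsLinearMap ℝ fun y : EuclideanSpace ℝ (Fin n) => y i / s :=
    ⟨fun x y => by simp [add_div], fun c x => by simp [mul_div_assoc]⟩
  exact (convex_halfSpace_ge hl _).inter (convex_halfSpace_lt hl _)

theorem measurableSet_cubeCell (s : ℝ) (k : Fin n → ℤ) : MeasurableSet (cubeCell s k) := by
  rw [cubeCell_eq]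
  refine MeasurableSet.iInter fun i => ?_
  have hm : Measurable fun y : EuclideanSpace ℝ (Fin n) => y i / s := by fun_prop
  exact (measurableSet_le measurable_const hm).inter (measurableSet_lt hm measurable_const)

theorem dist_le_of_mem_cubeCell {s : ℝ} (hs : 0 < s) {k : Fin n → ℤ}
    {x y : EuclideanSpace ℝ (Fin n)} (hx : x ∈ cubeCell s k) (hy : y ∈ cubeCell s k) :
    dist x y ≤ √n * s := by
  rw [EuclideanSpace.dist_eq]
  have : ∀ i, dist (x i) (y i) ^ 2 ≤ s ^ 2 := by
    intro i
    rw [cubeCell_eq, mem_iInter] at hx hy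
    obtain ⟨h1, h2⟩ := hx i
    obtain ⟨h3, h4⟩ := hy i
    rw [le_div_iff₀ hs] at h1 h3
    rw [div_lt_iff₀ hs] at h2 h4
    rw [Real.dist_eq, sq_le_sq, abs_abs, abs_of_pos hs, abs_le]
    constructor <;> nlinarith
  calc √(∑ i, dist (x i) (y i) ^ 2) ≤ √(∑ _i : Fin n, s ^ 2) :=
        Real.sqrt_le_sqrt (Finset.sum_le_sum fun i _ => this i)
    _ = √n * s := by
        rw [Finset.sum_const, Finset.card_univ, Fintype.card_fin, nsmul_eq_mul,
          Real.sqrt_mul (by positivity), Real.sqrt_sq hs.le]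

theorem disjoint_cubeCell (s : ℝ) :
    Pairwise (Function.onFun Disjoint (cubeCell (n := n) s)) := by
  intro k l hkl
  refine Set.disjoint_left.2 fun y hk hl => hkl ?_
  ext i
  rw [← hk i, ← hl i]

/-- A ball is covered by finitely many cells. -/
theorem exists_finset_cover_cubeCell {s : ℝ} (hs : 0 < s) (y0 : EuclideanSpace ℝ (Fin n)) (r : ℝ) :
    ∃ T : Finset (Fin n → ℤ), Metric.ball y0 r ⊆ ⋃ k ∈ T, cubeCell s k := by
  have hfin : (Set.pi univ fun i => Icc ⌊(y0 i - r) / s⌋ ⌊(y0 i + r) / s⌋).Finite :=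
    Set.Finite.pi fun i => finite_Icc _ _
  refine ⟨hfin.toFinset, fun y hy => ?_⟩
  refine mem_iUnion₂.2 ⟨fun i => ⌊y i / s⌋, ?_, fun i => rfl⟩
  rw [Finite.mem_toFinset]
  intro i _
  have h1 : |y i - y0 i| ≤ r := by
    have := PiLp.norm_apply_le (y - y0) i
    rw [← dist_eq_norm] at this
    exact this.trans (Metric.mem_ball.1 hy).le
  rw [abs_le] at h1
  constructor <;> refine Int.floor_le_floor ?_ <;> gcongr <;> linarith

end Cells

/-! ### Local averages control the L² norm up to a small Dirichlet term -/

section Rellich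

variable {n : ℕ} {M : Type*} [TopologicalSpace M]
  [ChartedSpace (EuclideanSpace ℝ (Fin n)) M] [IsManifold (𝓡 n) ∞ M]
  [MeasurableSpace M] [BorelSpace M] [CompactSpace M] [Nonempty M]

/-- The Dirichlet integral `∫ |∇f|²` as an extended nonnegative number. -/
noncomputable def dirichlet (g : Metric n M) (f : M → ℝ) : ℝ≥0∞ :=
  ∫⁻ x, ‖vnorm g (grad g f x)‖ₑ ^ 2 ∂(vol g)

/-- The squared `L²` distance on `W` from `f` to the constants. -/
noncomputable def osc (g : Metric n M) (W : Set M) (f : M → ℝ) : ℝ≥0∞ :=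
  ⨅ c : ℝ, ∫⁻ x in W, ‖f x - c‖ₑ ^ 2 ∂(vol g)

/-- The Euclidean Poincaré inequality carried to `M`. The power `A⁴` collects one factor for each
change of measure and `A²` for the squared gradient. -/
theorem IsCoordBall.exists_lintegral_le {g : Metric n M} {p : M} {r : ℝ} {A : NNReal}
    (hb : IsCoordBall g p r A) {Ω : Set (EuclideanSpace ℝ (Fin n))} (hΩ : Convex ℝ Ω)
    (hΩm : MeasurableSet Ω) (hΩs : Ω ⊆ Metric.closedBall (extChartAt (𝓡 n) p p) r) {d : ℝ}
    (hd : ∀ x ∈ Ω, ∀ y ∈ Ω, dist x y ≤ d) {f : M → ℝ} (hf : ContMDiff (𝓡 n) 𝓘(ℝ, ℝ) ∞ f) :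
    ∃ c : ℝ, ∫⁻ x in (extChartAt (𝓡 n) p).symm '' Ω, ‖f x - c‖ₑ ^ 2 ∂(vol g)
      ≤ (2 ^ n * A ^ 4 * ENNReal.ofReal d ^ 2) *
        ∫⁻ x in (extChartAt (𝓡 n) p).symm '' Ω, ‖vnorm g (grad g f x)‖ₑ ^ 2 ∂(vol g) := by
  obtain ⟨c, hc⟩ := exists_lintegral_enorm_sub_sq_le (isOpen_extChartAt_target (I := 𝓡 n) p)
    ((contDiffOn_comp_symm hf p).of_le (by simp)) hΩ hΩm (hΩs.trans hb.subset)
    ((measure_mono hΩs).trans_lt measure_closedBall_lt_top).ne hd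
  refine ⟨c, ?_⟩
  have h1 := hb.lintegral_vol_le Ω hΩs hΩm (fun x => ‖f x - c‖ₑ ^ 2)
    ((hf.continuous.measurable.sub_const c).enorm.pow_const 2)
  have h2 := hb.lintegral_le_vol Ω hΩs hΩm (fun x => ‖vnorm g (grad g f x)‖ₑ ^ 2)
    ((continuous_vnorm_grad g hf).measurable.enorm.pow_const 2)
  have h3 : ∫⁻ y in Ω, ‖fderiv ℝ (f ∘ (extChartAt (𝓡 n) p).symm) y‖ₑ ^ 2
      ≤ (A : ℝ≥0∞) ^ 2 *
        ∫⁻ y in Ω, ‖vnorm g (grad g f ((extChartAt (𝓡 n) p).symm y))‖ₑ ^ 2 := by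
    rw [← lintegral_const_mul' _ _ (by simp)]
    refine setLIntegral_mono' hΩm fun y hy => ?_
    rw [← mul_pow]
    gcongr
    have := hb.norm_fderiv_le f hf y (hΩs hy)
    rw [← ofReal_norm, ← ofReal_norm, Real.norm_of_nonneg (vnorm_nonneg g _),
      ← ENNReal.ofReal_coe_nnreal, ← ENNReal.ofReal_mul (NNReal.coe_nonneg A)]
    exact ENNReal.ofReal_le_ofReal this
  calc _ ≤ _ := h1
    _ ≤ A * (2 ^ n * ENNReal.ofReal d ^ 2 *
        ∫⁻ y in Ω, ‖fderiv ℝ (f ∘ (extChartAt (𝓡 n) p).symm) y‖ₑ ^ 2) := by gcongr; exact hc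
    _ ≤ A * (2 ^ n * ENNReal.ofReal d ^ 2 * ((A : ℝ≥0∞) ^ 2 *
        (A * ∫⁻ x in (extChartAt (𝓡 n) p).symm '' Ω, ‖vnorm g (grad g f x)‖ₑ ^ 2 ∂(vol g)))) := by
        gcongr
        exact h3.trans (by gcongr)
    _ = _ := by ring

/-- Near every point, smooth functions are approximated in `L²` by step functions. -/
theorem IsCoordBall.exists_osc_le {g : Metric n M} {p : M} {r : ℝ} {A : NNReal}
    (hb : IsCoordBall g p r A) {ε : ℝ} (hε : 0 < ε) :
    ∃ F : Finset (Set M), (∀ W ∈ F, MeasurableSet W) ∧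
      (extChartAt (𝓡 n) p).symm '' Metric.ball (extChartAt (𝓡 n) p p) r ⊆ ⋃ W ∈ F, W ∧
      ∀ f : M → ℝ, ContMDiff (𝓡 n) 𝓘(ℝ, ℝ) ∞ f →
        ∑ W ∈ F, osc g W f ≤ ENNReal.ofReal ε * dirichlet g f := by
  classical
  -- Cells of side `s` have diameter at most `√n s`, so this expression is their Poincaré constant;
  -- it tends to zero with `s`.
  obtain ⟨s, hs, hsε⟩ : ∃ s : ℝ, 0 < s ∧ 2 ^ n * (A : ℝ) ^ 4 * (√n * s) ^ 2 ≤ ε := by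
    have hcont : ContinuousAt (fun s : ℝ => 2 ^ n * (A : ℝ) ^ 4 * (√n * s) ^ 2) 0 := by fun_prop
    have h1 : ∀ᶠ s in 𝓝 (0 : ℝ), 2 ^ n * (A : ℝ) ^ 4 * (√n * s) ^ 2 < ε :=
      hcont.eventually_lt continuousAt_const (by simpa using hε)
    obtain ⟨s, hs1, hs2⟩ := ((h1.filter_mono nhdsWithin_le_nhds).and
      (self_mem_nhdsWithin (a := (0 : ℝ)) (s := Ioi 0))).exists
    exact ⟨s, hs2, hs1.le⟩
  set B := Metric.ball (extChartAt (𝓡 n) p p) r with hB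
  obtain ⟨T, hT⟩ := exists_finset_cover_cubeCell hs (extChartAt (𝓡 n) p p) r
  set V : (Fin n → ℤ) → Set M := fun k => (extChartAt (𝓡 n) p).symm '' (B ∩ cubeCell s k) with hV
  have hsub : ∀ k, B ∩ cubeCell s k ⊆ Metric.closedBall (extChartAt (𝓡 n) p p) r := fun k =>
    inter_subset_left.trans Metric.ball_subset_closedBall
  have hm : ∀ k, MeasurableSet (B ∩ cubeCell s k) := fun k =>
    measurableSet_ball.inter (measurableSet_cubeCell s k)
  have hVm : ∀ k, MeasurableSet (V k) := fun k =>
    measurableSet_symm_image p (hm k) ((hsub k).trans hb.subset)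
  have hVd : Pairwise (Function.onFun Disjoint V) := by
    intro k l hkl
    refine Set.disjoint_left.2 ?_
    rintro _ ⟨y, hy, rfl⟩ ⟨z, hz, hzy⟩
    have := (extChartAt (𝓡 n) p).symm.injOn (hb.subset (hsub l hz)) (hb.subset (hsub k hy)) hzy
    subst this
    exact Set.disjoint_left.1 (disjoint_cubeCell s hkl) hy.2 hz.2
  refine ⟨T.image V, ?_, ?_, fun f hf => ?_⟩
  · intro W hW
    obtain ⟨k, -, rfl⟩ := Finset.mem_image.1 hW
    exact hVm k
  · rintro _ ⟨y, hy, rfl⟩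
    obtain ⟨k, hk, hyk⟩ := mem_iUnion₂.1 (hT hy)
    exact mem_iUnion₂.2 ⟨V k, Finset.mem_image_of_mem V hk, y, ⟨hy, hyk⟩, rfl⟩
  -- Distinct indices may give the same empty set, hence only `≤`. Disjointness of the cells then
  -- makes their Dirichlet integrals add up to at most the global one.
  · calc ∑ W ∈ T.image V, osc g W f ≤ ∑ k ∈ T, osc g (V k) f :=
          Finset.sum_image_le_of_nonneg (fun _ _ => zero_le)
      _ ≤ ∑ k ∈ T, ENNReal.ofReal ε * ∫⁻ x in V k, ‖vnorm g (grad g f x)‖ₑ ^ 2 ∂(vol g) := by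
          refine Finset.sum_le_sum fun k _ => ?_
          obtain ⟨c, hc⟩ := hb.exists_lintegral_le
            ((convex_ball _ _).inter (convex_cubeCell s k)) (hm k) (hsub k) (d := √n * s)
            (fun x hx y hy => dist_le_of_mem_cubeCell hs hx.2 hy.2) hf
          refine (iInf_le _ c).trans (hc.trans ?_)
          gcongr
          rw [← ENNReal.ofReal_pow (by positivity), ← ENNReal.ofReal_coe_nnreal,
            ← ENNReal.ofReal_pow (by positivity), show (2 : ℝ≥0∞) ^ n = ENNReal.ofReal (2 ^ n) by
              rw [ENNReal.ofReal_pow (by norm_num)]; norm_num,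
            ← ENNReal.ofReal_mul (by positivity), ← ENNReal.ofReal_mul (by positivity)]
          exact ENNReal.ofReal_le_ofReal hsε
      _ = ENNReal.ofReal ε * ∫⁻ x in ⋃ k ∈ T, V k, ‖vnorm g (grad g f x)‖ₑ ^ 2 ∂(vol g) := by
          rw [← Finset.mul_sum, lintegral_biUnion_finset (fun k _ l _ hkl => hVd hkl)
            (fun k _ => hVm k)]
      _ ≤ _ := by
          gcongr
          exact setLIntegral_le_lintegral _ _

/-- Compactness glues the local statements. Quantifying over all `ε` lets a union spend `ε/2` on
each part, and overlaps do no harm because every bound is against the global Dirichlet integral. -/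
theorem exists_osc_le (g : Metric n M) {ε : ℝ} (hε : 0 < ε) :
    ∃ F : Finset (Set M), (∀ W ∈ F, MeasurableSet W) ∧ univ ⊆ ⋃ W ∈ F, W ∧
      ∀ f : M → ℝ, ContMDiff (𝓡 n) 𝓘(ℝ, ℝ) ∞ f →
        ∑ W ∈ F, osc g W f ≤ ENNReal.ofReal ε * dirichlet g f := by
  classical
  refine isCompact_univ.induction_on (p := fun V : Set M => ∀ ε : ℝ, 0 < ε →
    ∃ F : Finset (Set M), (∀ W ∈ F, MeasurableSet W) ∧ V ⊆ ⋃ W ∈ F, W ∧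
      ∀ f : M → ℝ, ContMDiff (𝓡 n) 𝓘(ℝ, ℝ) ∞ f →
        ∑ W ∈ F, osc g W f ≤ ENNReal.ofReal ε * dirichlet g f) ?_ ?_ ?_ ?_ ε hε
  · intro ε _
    exact ⟨∅, by simp, by simp, by simp⟩
  · intro s t hst ht ε hε
    obtain ⟨F, h1, h2, h3⟩ := ht ε hε
    exact ⟨F, h1, hst.trans h2, h3⟩
  · intro s t hs ht ε hε
    obtain ⟨F, h1, h2, h3⟩ := hs (ε / 2) (half_pos hε)
    obtain ⟨F', h1', h2', h3'⟩ := ht (ε / 2) (half_pos hε)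
    refine ⟨F ∪ F', fun W hW => (Finset.mem_union.1 hW).elim (h1 W) (h1' W), ?_, fun f hf => ?_⟩
    · rw [Finset.set_biUnion_union]
      exact union_subset_union h2 h2'
    · calc ∑ W ∈ F ∪ F', osc g W f ≤ ∑ W ∈ F, osc g W f + ∑ W ∈ F', osc g W f := by
            rw [← Finset.sum_union_inter]
            exact le_self_add
        _ ≤ ENNReal.ofReal (ε / 2) * dirichlet g f + ENNReal.ofReal (ε / 2) * dirichlet g f :=
            add_le_add (h3 f hf) (h3' f hf)
        _ = _ := by
            rw [← add_mul, ← ENNReal.ofReal_add (half_pos hε).le (half_pos hε).le, add_halves]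
  · intro p _
    obtain ⟨r, A, hb, -⟩ := exists_isCoordBall g p univ_mem
    exact ⟨_, mem_nhdsWithin_of_mem_nhds (hb.image_mem_nhds hb.pos le_rfl),
      fun ε hε => hb.exists_osc_le hε⟩

theorem integrable_of_continuous (g : Metric n M) {f : M → ℝ} (hf : Continuous f) :
    Integrable f (vol g) := by
  obtain ⟨C, hC⟩ := isCompact_univ.exists_bound_of_continuousOn hf.continuousOn
  exact Integrable.of_bound hf.measurable.aestronglyMeasurable C
    (Eventually.of_forall fun x => hC x (mem_univ x))

theorem lintegral_enorm_sq (g : Metric n M) {f : M → ℝ} (hf : Continuous f) (W : Set M) :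
    ∫⁻ x in W, ‖f x‖ₑ ^ 2 ∂(vol g) = ENNReal.ofReal (∫ x in W, f x ^ 2 ∂(vol g)) := by
  rw [ofReal_integral_eq_lintegral_ofReal (integrable_of_continuous g
    (f := fun x => f x ^ 2) (hf.pow 2)).integrableOn
    (Eventually.of_forall fun x => sq_nonneg _)]
  refine lintegral_congr fun x => ?_
  rw [← ofReal_norm, ← ENNReal.ofReal_pow (norm_nonneg _), Real.norm_eq_abs, sq_abs]

theorem dirichlet_eq (g : Metric n M) {f : M → ℝ} (hf : ContMDiff (𝓡 n) 𝓘(ℝ, ℝ) ∞ f) :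
    dirichlet g f = ENNReal.ofReal (∫ x, vnorm g (grad g f x) ^ 2 ∂(vol g)) := by
  have := lintegral_enorm_sq g (continuous_vnorm_grad g hf) univ
  rwa [Measure.restrict_univ] at this

theorem setIntegral_sub_const_sq (g : Metric n M) {f : M → ℝ} (hf : Continuous f) (W : Set M)
    (c : ℝ) : ∫ x in W, (f x - c) ^ 2 ∂(vol g) = ∫ x in W, f x ^ 2 ∂(vol g)
      - 2 * c * ∫ x in W, f x ∂(vol g) + (vol g).real W * c ^ 2 := by
  have i1 : IntegrableOn (fun x => f x ^ 2) W (vol g) :=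
    (integrable_of_continuous g (hf.pow 2)).integrableOn
  have i2 : IntegrableOn (fun x => 2 * c * f x) W (vol g) :=
    (integrable_of_continuous g (continuous_const.mul hf)).integrableOn
  have i3 : IntegrableOn (fun _ : M => c ^ 2) W (vol g) :=
    (integrable_of_continuous g continuous_const).integrableOn
  have : ∀ x, (f x - c) ^ 2 = f x ^ 2 - 2 * c * f x + c ^ 2 := fun x => by ring
  simp only [this]
  have i4 : Integrable (fun x => f x ^ 2 - 2 * c * f x) ((vol g).restrict W) := i1.sub i2
  rw [integral_add i4 i3, integral_sub i1 i2, integral_const_mul, setIntegral_const,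
    smul_eq_mul]

/-- The variance of `f` on `W` is nonnegative. When `W` is null the quotient is zero by convention.
-/
theorem sq_setIntegral_div_le (g : Metric n M) {f : M → ℝ} (hf : Continuous f) (W : Set M) :
    (∫ x in W, f x ∂(vol g)) ^ 2 / (vol g).real W ≤ ∫ x in W, f x ^ 2 ∂(vol g) := by
  rcases eq_or_lt_of_le (measureReal_nonneg (μ := vol g) (s := W)) with h0 | h0
  · rw [← h0, div_zero]
    exact integral_nonneg fun x => sq_nonneg _
  · have h := setIntegral_sub_const_sq g hf W ((∫ x in W, f x ∂(vol g)) / (vol g).real W)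
    have h1 : 0 ≤ ∫ x in W, (f x - (∫ x in W, f x ∂(vol g)) / (vol g).real W) ^ 2 ∂(vol g) :=
      integral_nonneg fun x => sq_nonneg _
    rw [h] at h1
    set I := ∫ x in W, f x ∂(vol g)
    set v := (vol g).real W
    have : 2 * (I / v) * I - v * (I / v) ^ 2 = I ^ 2 / v := by field_simp; ring
    linarith

/-- With `I = ∫_W f` and `v = vol W > 0`, one has `∫_W (f-c)² = ∫_W f² - I²/v + (I - vc)²/v` for
every `c`; dropping the last square and taking the infimum over `c` gives the bound. -/
theorem setIntegral_sq_le_osc (g : Metric n M) {f : M → ℝ} (hf : Continuous f) {W : Set M} :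
    ENNReal.ofReal (∫ x in W, f x ^ 2 ∂(vol g)) ≤
      ENNReal.ofReal ((∫ x in W, f x ∂(vol g)) ^ 2 / (vol g).real W) + osc g W f := by
  rw [osc, ENNReal.add_iInf]
  refine le_iInf fun c => ?_
  rw [lintegral_enorm_sq g (f := fun x => f x - c) (hf.sub continuous_const),
    ← ENNReal.ofReal_add (div_nonneg (sq_nonneg _) measureReal_nonneg)
      (integral_nonneg fun x => sq_nonneg _)]
  refine ENNReal.ofReal_le_ofReal ?_
  rw [setIntegral_sub_const_sq g hf W c]
  rcases eq_or_lt_of_le (measureReal_nonneg (μ := vol g) (s := W)) with h0 | h0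
  · have hW : vol g W = 0 := by
      rw [Measure.real, eq_comm, ENNReal.toReal_eq_zero_iff] at h0
      exact h0.resolve_right (measure_ne_top _ _)
    rw [setIntegral_measure_zero _ hW, setIntegral_measure_zero _ hW, ← h0]
    simp
  · set I := ∫ x in W, f x ∂(vol g)
    set v := (vol g).real W
    have : I ^ 2 / v - 2 * c * I + v * c ^ 2 = (I - v * c) ^ 2 / v := by field_simp; ring
    have h2 : 0 ≤ (I - v * c) ^ 2 / v := by positivity
    linarith

/-- The compactness inequality behind Rellich's theorem. -/
theorem exists_integral_sq_le (g : Metric n M) {ε : ℝ} (hε : 0 < ε) :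
    ∃ F : Finset (Set M), (∀ W ∈ F, MeasurableSet W) ∧
      ∀ f : M → ℝ, ContMDiff (𝓡 n) 𝓘(ℝ, ℝ) ∞ f →
        ∫ x, f x ^ 2 ∂(vol g) ≤ ε * ∫ x, vnorm g (grad g f x) ^ 2 ∂(vol g)
          + ∑ W ∈ F, (∫ x in W, f x ∂(vol g)) ^ 2 / (vol g).real W := by
  obtain ⟨F, h1, h2, h3⟩ := exists_osc_le g hε
  refine ⟨F, h1, fun f hf => ?_⟩
  have hD : 0 ≤ ∫ x, vnorm g (grad g f x) ^ 2 ∂(vol g) := integral_nonneg fun x => sq_nonneg _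
  have hS : 0 ≤ ∑ W ∈ F, (∫ x in W, f x ∂(vol g)) ^ 2 / (vol g).real W :=
    Finset.sum_nonneg fun W _ => div_nonneg (sq_nonneg _) measureReal_nonneg
  rw [← ENNReal.ofReal_le_ofReal_iff (add_nonneg (mul_nonneg hε.le hD) hS)]
  calc ENNReal.ofReal (∫ x, f x ^ 2 ∂(vol g))
      = ∫⁻ x in univ, ‖f x‖ₑ ^ 2 ∂(vol g) := by
        rw [lintegral_enorm_sq g hf.continuous, Measure.restrict_univ]
    _ ≤ ∫⁻ x in ⋃ W ∈ F, W, ‖f x‖ₑ ^ 2 ∂(vol g) := lintegral_mono_set h2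
    _ ≤ ∑ W ∈ F, ∫⁻ x in W, ‖f x‖ₑ ^ 2 ∂(vol g) := by
        clear h1 h2 h3 hS
        classical
        induction F using Finset.induction_on with
        | empty => simp
        | insert W F hW ih =>
          rw [Finset.sum_insert hW, Finset.set_biUnion_insert]
          exact (lintegral_union_le _ _ _).trans (add_le_add le_rfl ih)
    _ ≤ ∑ W ∈ F, (ENNReal.ofReal ((∫ x in W, f x ∂(vol g)) ^ 2 / (vol g).real W)
          + osc g W f) := by
        refine Finset.sum_le_sum fun W _ => ?_
        rw [lintegral_enorm_sq g hf.continuous]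
        exact setIntegral_sq_le_osc g hf.continuous
    _ ≤ ENNReal.ofReal (∑ W ∈ F, (∫ x in W, f x ∂(vol g)) ^ 2 / (vol g).real W)
          + ENNReal.ofReal ε * dirichlet g f := by
        rw [Finset.sum_add_distrib, ENNReal.ofReal_sum_of_nonneg
          (fun W _ => div_nonneg (sq_nonneg _) measureReal_nonneg)]
        gcongr
        exact h3 f hf
    _ = _ := by
        rw [dirichlet_eq g hf, ← ENNReal.ofReal_mul hε.le,
          ← ENNReal.ofReal_add hS (mul_nonneg hε.le hD), add_comm]

end Rellich

/-! ### Poincaré inequality on a connected closed manifold -/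

section Poincare

variable {n : ℕ} {M : Type*} [TopologicalSpace M]
  [ChartedSpace (EuclideanSpace ℝ (Fin n)) M] [IsManifold (𝓡 n) ∞ M]
  [MeasurableSpace M] [BorelSpace M] [CompactSpace M] [Nonempty M]

/-- A Poincaré inequality on `V`, with the gradient integrated over all of `M`. -/
def HasPoincare (g : Metric n M) (V : Set M) : Prop :=
  ∃ C : NNReal, ∀ f : M → ℝ, ContMDiff (𝓡 n) 𝓘(ℝ, ℝ) ∞ f →
    ∃ c : ℝ, ∫⁻ x in V, ‖f x - c‖ₑ ^ 2 ∂(vol g) ≤ C * dirichlet g f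

theorem exists_open_hasPoincare (g : Metric n M) (p : M) :
    ∃ V : Set M, IsOpen V ∧ p ∈ V ∧ HasPoincare g V := by
  obtain ⟨r, A, hb, -⟩ := exists_isCoordBall g p univ_mem
  refine ⟨_, hb.isOpen_image le_rfl, mem_of_mem_nhds (hb.image_mem_nhds hb.pos le_rfl),
    2 ^ n * A ^ 4 * Real.toNNReal (2 * r) ^ 2, fun f hf => ?_⟩
  obtain ⟨c, hc⟩ := hb.exists_lintegral_le (convex_ball _ _) measurableSet_ball
    Metric.ball_subset_closedBall (d := 2 * r) (fun x hx y hy => by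
      have := dist_triangle_right x y (extChartAt (𝓡 n) p p)
      rw [Metric.mem_ball] at hx hy
      linarith) hf
  refine ⟨c, hc.trans ?_⟩
  push_cast
  gcongr
  · exact le_rfl
  · exact setLIntegral_le_lintegral _ _

theorem enorm_sub_sq_le (a b c : ℝ) : ‖a - c‖ₑ ^ 2 ≤ 2 * ‖a - b‖ₑ ^ 2 + 2 * ‖b - c‖ₑ ^ 2 := by
  have h : ∀ t : ℝ, ‖t‖ₑ ^ 2 = ENNReal.ofReal (t ^ 2) := fun t => by
    rw [← ofReal_norm, ← ENNReal.ofReal_pow (norm_nonneg _), Real.norm_eq_abs, sq_abs]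
  rw [h, h, h, show (2 : ℝ≥0∞) = ENNReal.ofReal 2 by norm_num,
    ← ENNReal.ofReal_mul (by norm_num), ← ENNReal.ofReal_mul (by norm_num),
    ← ENNReal.ofReal_add (by positivity) (by positivity)]
  exact ENNReal.ofReal_le_ofReal (by nlinarith [sq_nonneg (a - b - (b - c))])

/-- The constants `c` and `c'` belonging to `V` and `W` are compared on the overlap, which is open
and nonempty and so has positive volume. Replacing `c'` by `c` on all of `W` costs the ratio `vol W
/ vol (V ∩ W)`. -/
theorem HasPoincare.union {g : Metric n M} {V W : Set M} (hV : HasPoincare g V)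
    (hW : HasPoincare g W) (hVo : IsOpen V) (hWo : IsOpen W) (hne : (V ∩ W).Nonempty) :
    HasPoincare g (V ∪ W) := by
  obtain ⟨C, hC⟩ := hV
  obtain ⟨C', hC'⟩ := hW
  have hv0 : vol g (V ∩ W) ≠ 0 := (hVo.inter hWo).measure_ne_zero _ hne
  have hvt : vol g (V ∩ W) ≠ ⊤ := measure_ne_top _ _
  obtain ⟨m, hm⟩ : ∃ m : NNReal, (m : ℝ≥0∞) = vol g W / vol g (V ∩ W) :=
    ⟨_, ENNReal.coe_toNNReal (ENNReal.div_ne_top (measure_ne_top _ _) hv0)⟩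
  refine ⟨C + (2 * C' + 2 * (m * (2 * C + 2 * C'))), fun f hf => ?_⟩
  obtain ⟨c, hc⟩ := hC f hf
  obtain ⟨c', hc'⟩ := hC' f hf
  refine ⟨c, ?_⟩
  set D := dirichlet g f
  have hmeas : ∀ c : ℝ, Measurable fun x => ‖f x - c‖ₑ ^ 2 := fun c =>
    (hf.continuous.measurable.sub_const c).enorm.pow_const 2
  have h1 : ‖c' - c‖ₑ ^ 2 * vol g (V ∩ W) ≤ (2 * C + 2 * C') * D := by
    calc ‖c' - c‖ₑ ^ 2 * vol g (V ∩ W) = ∫⁻ x in V ∩ W, ‖c' - c‖ₑ ^ 2 ∂(vol g) := by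
          rw [setLIntegral_const]
      _ ≤ ∫⁻ x in V ∩ W, (2 * ‖f x - c'‖ₑ ^ 2 + 2 * ‖f x - c‖ₑ ^ 2) ∂(vol g) := by
          refine lintegral_mono fun x => ?_
          have := enorm_sub_sq_le c' (f x) c
          rwa [← enorm_neg (c' - f x), neg_sub] at this
      _ = 2 * ∫⁻ x in V ∩ W, ‖f x - c'‖ₑ ^ 2 ∂(vol g)
          + 2 * ∫⁻ x in V ∩ W, ‖f x - c‖ₑ ^ 2 ∂(vol g) := by
          rw [lintegral_add_left ((hmeas c').const_mul 2), lintegral_const_mul 2 (hmeas c'),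
            lintegral_const_mul 2 (hmeas c)]
      _ ≤ 2 * (C' * D) + 2 * (C * D) := by
          gcongr
          · exact (lintegral_mono_set inter_subset_right).trans hc'
          · exact (lintegral_mono_set inter_subset_left).trans hc
      _ = _ := by ring
  have h2 : ‖c' - c‖ₑ ^ 2 * vol g W ≤ m * ((2 * C + 2 * C') * D) := by
    have : vol g W = m * vol g (V ∩ W) := by rw [hm, ENNReal.div_mul_cancel hv0 hvt]
    rw [this]
    calc _ = m * (‖c' - c‖ₑ ^ 2 * vol g (V ∩ W)) := by ring
      _ ≤ _ := by gcongr
  calc ∫⁻ x in V ∪ W, ‖f x - c‖ₑ ^ 2 ∂(vol g)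
      ≤ ∫⁻ x in V, ‖f x - c‖ₑ ^ 2 ∂(vol g) + ∫⁻ x in W, ‖f x - c‖ₑ ^ 2 ∂(vol g) :=
        lintegral_union_le _ _ _
    _ ≤ C * D + ∫⁻ x in W, (2 * ‖f x - c'‖ₑ ^ 2 + 2 * ‖c' - c‖ₑ ^ 2) ∂(vol g) := by
        gcongr with x
        exact enorm_sub_sq_le _ _ _
    _ = C * D + (2 * ∫⁻ x in W, ‖f x - c'‖ₑ ^ 2 ∂(vol g) + 2 * (‖c' - c‖ₑ ^ 2 * vol g W)) := by
        rw [lintegral_add_left ((hmeas c').const_mul 2), lintegral_const_mul 2 (hmeas c'),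
          setLIntegral_const, mul_assoc]
    _ ≤ C * D + (2 * (C' * D) + 2 * (m * ((2 * C + 2 * C') * D))) := by gcongr
    _ = _ := by push_cast; ring

/-- The Poincaré inequality on a connected closed manifold. -/
theorem hasPoincare_univ [ConnectedSpace M] (g : Metric n M) : HasPoincare g (univ : Set M) := by
  obtain ⟨p⟩ := ‹Nonempty M›
  -- `S` is open by construction, and closed because a Poincaré neighbourhood of a limit point meets
  -- one of the sets `V` and can be glued to it.
  set S : Set M := {q | ∃ V : Set M, IsOpen V ∧ p ∈ V ∧ q ∈ V ∧ HasPoincare g V} with hS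
  have hSo : IsOpen S := by
    refine isOpen_iff_mem_nhds.2 fun q hq => ?_
    obtain ⟨V, hVo, hp, hq, hV⟩ := hq
    exact mem_of_superset (hVo.mem_nhds hq) fun z hz => ⟨V, hVo, hp, hz, hV⟩
  have hSc : IsClosed S := by
    refine isClosed_of_closure_subset fun q hq => ?_
    obtain ⟨W, hWo, hqW, hW⟩ := exists_open_hasPoincare g q
    obtain ⟨z, hzW, V, hVo, hp, hz, hV⟩ := mem_closure_iff.1 hq W hWo hqW
    exact ⟨V ∪ W, hVo.union hWo, Or.inl hp, Or.inr hqW, hV.union hW hVo hWo ⟨z, hz, hzW⟩⟩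
  have hSu : S = univ := by
    refine IsClopen.eq_univ ⟨hSc, hSo⟩ ⟨p, ?_⟩
    obtain ⟨W, hWo, hqW, hW⟩ := exists_open_hasPoincare g p
    exact ⟨W, hWo, hqW, hqW, hW⟩
  -- Keeping `p` in every set guarantees a nonempty overlap each time two of them are joined.
  obtain ⟨V, hV, hsub, -⟩ : ∃ V : Set M, (IsOpen V ∧ p ∈ V ∧ HasPoincare g V) ∧ univ ⊆ V ∧ True := by
    obtain ⟨V0, hV0o, hpV0, hV0⟩ := exists_open_hasPoincare g p
    refine isCompact_univ.induction_on
      (p := fun s : Set M => ∃ V : Set M, (IsOpen V ∧ p ∈ V ∧ HasPoincare g V) ∧ s ⊆ V ∧ True)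
      ⟨V0, ⟨hV0o, hpV0, hV0⟩, empty_subset _, trivial⟩ ?_ ?_ ?_
    · rintro s t hst ⟨V, hV, ht, -⟩
      exact ⟨V, hV, hst.trans ht, trivial⟩
    · rintro s t ⟨V, hV, hs, -⟩ ⟨W, hW, ht, -⟩
      exact ⟨V ∪ W, ⟨hV.1.union hW.1, Or.inl hV.2.1,
        hV.2.2.union hW.2.2 hV.1 hW.1 ⟨p, hV.2.1, hW.2.1⟩⟩, union_subset_union hs ht, trivial⟩
    · intro q _
      obtain ⟨V, hVo, hp, hq, hV⟩ : q ∈ S := hSu ▸ mem_univ q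
      exact ⟨V, mem_nhdsWithin_of_mem_nhds (hVo.mem_nhds hq), V, ⟨hVo, hp, hV⟩, Subset.rfl, trivial⟩
  rw [univ_subset_iff] at hsub
  exact hsub ▸ hV.2.2

end Poincare

/-! ### Rellich compactness for sequences -/

section RellichSequence

variable {n : ℕ} {M : Type*} [TopologicalSpace M]
  [ChartedSpace (EuclideanSpace ℝ (Fin n)) M] [IsManifold (𝓡 n) ∞ M]
  [MeasurableSpace M] [BorelSpace M] [CompactSpace M] [Nonempty M]

theorem memLp_of_continuous (g : Metric n M) {f : M → ℝ} (hf : Continuous f) (p : ℝ≥0∞) :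
    MemLp f p (vol g) := by
  obtain ⟨C, hC⟩ := isCompact_univ.exists_bound_of_continuousOn hf.continuousOn
  exact MemLp.of_bound hf.measurable.aestronglyMeasurable C
    (Eventually.of_forall fun x => hC x (mem_univ x))

theorem eLpNorm_two_sq (g : Metric n M) (f : M → ℝ) :
    eLpNorm f 2 (vol g) ^ 2 = ∫⁻ x, ‖f x‖ₑ ^ 2 ∂(vol g) := by
  have := eLpNorm_nnreal_pow_eq_lintegral (f := f) (μ := vol g) (p := 2) two_ne_zero
  simpa using this

theorem eLpNorm_two_eq (g : Metric n M) {f : M → ℝ} (hf : Continuous f) :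
    eLpNorm f 2 (vol g) = ENNReal.ofReal (√(∫ x, f x ^ 2 ∂(vol g))) := by
  have h1 : eLpNorm f 2 (vol g) ^ 2 = ENNReal.ofReal (√(∫ x, f x ^ 2 ∂(vol g))) ^ 2 := by
    rw [eLpNorm_two_sq, ← ENNReal.ofReal_pow (Real.sqrt_nonneg _),
      Real.sq_sqrt (integral_nonneg fun x => sq_nonneg _)]
    have := lintegral_enorm_sq g hf univ
    rwa [Measure.restrict_univ] at this
  exact (ENNReal.pow_right_strictMono two_ne_zero).injective h1

theorem vnorm_sub_sq_le (g : Metric n M) {x : M} (v w : TangentSpace (𝓡 n) x) :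
    vnorm g (v - w) ^ 2 ≤ 2 * vnorm g v ^ 2 + 2 * vnorm g w ^ 2 := by
  have h := vnorm_sub_sq g v w
  have h1 := neg_le_of_abs_le (abs_inner_le g v w)
  nlinarith [sq_nonneg (vnorm g v - vnorm g w)]

/-- **Rellich's theorem**: a sequence of smooth functions bounded in `W^{1,2}` has a subsequence
converging in `L²`. -/
theorem exists_subseq_tendsto_L2 (g : Metric n M) {f : ℕ → M → ℝ}
    (hf : ∀ k, ContMDiff (𝓡 n) 𝓘(ℝ, ℝ) ∞ (f k)) {K : ℝ}
    (h1 : ∀ k, ∫ x, f k x ^ 2 ∂(vol g) ≤ K)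
    (h2 : ∀ k, ∫ x, vnorm g (grad g (f k) x) ^ 2 ∂(vol g) ≤ K) :
    ∃ φ : ℕ → ℕ, StrictMono φ ∧ ∃ u : M → ℝ, MemLp u 2 (vol g) ∧
      Tendsto (fun k => eLpNorm (fun x => f (φ k) x - u x) 2 (vol g)) atTop (𝓝 0) := by
  have hK : 0 ≤ K := (integral_nonneg fun x => sq_nonneg _).trans (h1 0)
  have hmem : ∀ k, MemLp (f k) 2 (vol g) := fun k => memLp_of_continuous g (hf k).continuous 2
  set z : ℕ → Lp ℝ 2 (vol g) := fun k => (hmem k).toLp (f k) with hz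
  have hdist : ∀ k l, dist (z k) (z l) = √(∫ x, (f k x - f l x) ^ 2 ∂(vol g)) := by
    intro k l
    rw [dist_eq_norm, ← MemLp.toLp_sub, Lp.norm_toLp]
    have : eLpNorm (f k - f l) 2 (vol g)
        = ENNReal.ofReal (√(∫ x, (f k x - f l x) ^ 2 ∂(vol g))) :=
      eLpNorm_two_eq g ((hf k).continuous.sub (hf l).continuous)
    rw [this, ENNReal.toReal_ofReal (Real.sqrt_nonneg _)]
  -- Up to a small multiple of the Dirichlet integral, the `L²` distance is read off from finitely
  -- many local averages; these form a bounded set in a finite-dimensional space, which has a finite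
  -- net.
  have htb : TotallyBounded (range z) := by
    refine Metric.totallyBounded_iff.2 fun ε hε => ?_
    -- A difference of two members has Dirichlet integral at most `4K`, so this choice contributes
    -- at most `ε²/2`; `K + 1` avoids division by zero.
    obtain ⟨F, hF, hineq⟩ := exists_integral_sq_le g (ε := ε ^ 2 / (8 * (K + 1))) (by positivity)
    set Φ : ℕ → F → ℝ := fun k W => (∫ x in (W : Set M), f k x ∂(vol g)) / √((vol g).real W)
      with hΦ
    -- `N` is the mesh of the net in the sup norm; a sum of squares over `F` then stays below
    -- `F.card * N²`, the other half of `ε²`.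
    obtain ⟨N, hN0, hN⟩ : ∃ N : ℝ, 0 < N ∧ (F.card : ℝ) * N ^ 2 < ε ^ 2 / 2 := by
      have hcont : ContinuousAt (fun s : ℝ => (F.card : ℝ) * s ^ 2) 0 := by fun_prop
      have h1 : ∀ᶠ s in 𝓝 (0 : ℝ), (F.card : ℝ) * s ^ 2 < ε ^ 2 / 2 :=
        hcont.eventually_lt continuousAt_const (by simpa using by positivity)
      obtain ⟨s, hs1, hs2⟩ := ((h1.filter_mono nhdsWithin_le_nhds).and
        (self_mem_nhdsWithin (a := (0 : ℝ)) (s := Ioi 0))).exists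
      exact ⟨s, hs2, hs1⟩
    have hΦb : Bornology.IsBounded (range Φ) := by
      refine (Metric.isBounded_iff_subset_closedBall 0).2 ⟨√K, ?_⟩
      rintro _ ⟨k, rfl⟩
      rw [mem_closedBall_zero_iff, pi_norm_le_iff_of_nonneg (Real.sqrt_nonneg _)]
      intro W
      rw [Real.norm_eq_abs]
      refine Real.abs_le_sqrt ?_
      rw [hΦ, div_pow, Real.sq_sqrt measureReal_nonneg]
      refine (sq_setIntegral_div_le g (hf k).continuous W).trans (le_trans ?_ (h1 k))
      exact setIntegral_le_integral (integrable_of_continuous g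
        ((hf k).continuous.pow 2)) (Eventually.of_forall fun x => sq_nonneg _)
    obtain ⟨t, ht, htf, hcov⟩ := totallyBounded_iff_subset.1
      (hΦb.isCompact_closure.totallyBounded.subset subset_closure) _
      (Metric.dist_mem_uniformity hN0)
    choose! κ hκ using fun y (hy : y ∈ t) => ht hy
    refine ⟨(fun y => z (κ y)) '' t, htf.image _, ?_⟩
    rintro _ ⟨k, rfl⟩
    obtain ⟨y, hy, hky⟩ := mem_iUnion₂.1 (hcov (mem_range_self k))
    refine mem_iUnion₂.2 ⟨z (κ y), mem_image_of_mem _ hy, ?_⟩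
    set l := κ y with hl
    rw [← hκ y hy, ← hl] at hky
    change dist (Φ k) (Φ l) < N at hky
    rw [Metric.mem_ball, hdist, Real.sqrt_lt' hε]
    have hfk : ContMDiff (𝓡 n) 𝓘(ℝ, ℝ) ∞ (fun x => f k x - f l x) := (hf k).sub (hf l)
    have hD : ∫ x, vnorm g (grad g (fun x => f k x - f l x) x) ^ 2 ∂(vol g) ≤ 4 * K := by
      have i1 := integrable_of_continuous g ((continuous_vnorm_grad g (hf k)).pow 2)
      have i2 := integrable_of_continuous g ((continuous_vnorm_grad g (hf l)).pow 2)
      calc _ ≤ ∫ x, (2 * vnorm g (grad g (f k) x) ^ 2 + 2 * vnorm g (grad g (f l) x) ^ 2)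
            ∂(vol g) := by
            refine integral_mono (integrable_of_continuous g
              ((continuous_vnorm_grad g hfk).pow 2)) ((i1.const_mul 2).add (i2.const_mul 2))
              fun x => ?_
            simp only [grad_sub g (hf k) (hf l)]
            exact vnorm_sub_sq_le g _ _
        _ = 2 * ∫ x, vnorm g (grad g (f k) x) ^ 2 ∂(vol g)
            + 2 * ∫ x, vnorm g (grad g (f l) x) ^ 2 ∂(vol g) := by
            rw [← integral_const_mul, ← integral_const_mul]
            exact integral_add (i1.const_mul 2) (i2.const_mul 2)
        _ ≤ 4 * K := by linarith [h2 k, h2 l]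
    have hsum : ∑ W ∈ F, (∫ x in W, (f k x - f l x) ∂(vol g)) ^ 2 / (vol g).real W
        ≤ F.card * N ^ 2 := by
      rw [← nsmul_eq_mul]
      refine Finset.sum_le_card_nsmul _ _ _ fun W hW => ?_
      have e : (∫ x in W, (f k x - f l x) ∂(vol g)) ^ 2 / (vol g).real W
          = (Φ k ⟨W, hW⟩ - Φ l ⟨W, hW⟩) ^ 2 := by
        simp only [hΦ]
        rw [integral_sub (integrable_of_continuous g (hf k).continuous).integrableOn
          (integrable_of_continuous g (hf l).continuous).integrableOn, ← sub_div, div_pow,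
          Real.sq_sqrt measureReal_nonneg]
      rw [e, sq_le_sq, abs_of_pos hN0, ← Real.dist_eq]
      exact (dist_le_pi_dist _ _ _).trans hky.le
    have h5 : ε ^ 2 / (8 * (K + 1)) * (4 * K) ≤ ε ^ 2 / 2 := by
      rw [div_mul_eq_mul_div, div_le_div_iff₀ (by positivity) (by norm_num)]
      nlinarith [sq_nonneg ε]
    calc _ ≤ _ := hineq _ hfk
      _ ≤ ε ^ 2 / (8 * (K + 1)) * (4 * K) + F.card * N ^ 2 := by gcongr
      _ < ε ^ 2 := by linarith
  have hcomp : IsCompact (closure (range z)) := htb.closure.isCompact_of_isClosed isClosed_closure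
  obtain ⟨a, -, φ, hφ, hlim⟩ := hcomp.tendsto_subseq (x := z)
    (fun k => subset_closure (mem_range_self k))
  refine ⟨φ, hφ, a, Lp.memLp a, ?_⟩
  have := (Lp.tendsto_Lp_iff_tendsto_eLpNorm' (fun k => z (φ k)) a).1 hlim
  refine this.congr fun k => ?_
  refine eLpNorm_congr_ae ?_
  filter_upwards [(hmem (φ k)).coeFn_toLp] with x hx
  simp only [Pi.sub_apply, hz, hx]

end RellichSequence

/-! ### Sobolev inequality with a zeroth-order term -/

section Sobolev

variable {n : ℕ} {M : Type*} [TopologicalSpace M]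
  [ChartedSpace (EuclideanSpace ℝ (Fin n)) M] [IsManifold (𝓡 n) ∞ M]
  [MeasurableSpace M] [BorelSpace M] [CompactSpace M] [Nonempty M]

theorem sobolevExp_pos (hn : 3 ≤ n) : 0 < 2 * (n : ℝ) / (n - 2) := by
  have : (3 : ℝ) ≤ n := by exact_mod_cast hn
  exact div_pos (by linarith) (by linarith)

/-- Outside the chart target the composite with the inverse chart carries no information, but there
the bump vanishes on a neighbourhood of each point. -/
theorem contDiff_bump_mul {c : M} {y0 : EuclideanSpace ℝ (Fin n)} (χ : ContDiffBump y0)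
    (hχ : Metric.closedBall y0 χ.rOut ⊆ (extChartAt (𝓡 n) c).target) {f : M → ℝ}
    (hf : ContMDiff (𝓡 n) 𝓘(ℝ, ℝ) ∞ f) :
    ContDiff ℝ 1 (fun y => χ y * f ((extChartAt (𝓡 n) c).symm y)) := by
  refine contDiff_iff_contDiffAt.2 fun y => ?_
  by_cases hy : y ∈ Metric.closedBall y0 χ.rOut
  · refine χ.contDiff.contDiffAt.mul ?_
    exact (((contDiffOn_comp_symm hf c).contDiffAt
      ((isOpen_extChartAt_target c).mem_nhds (hχ hy))).of_le (by simp))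
  · refine (contDiffAt_const (c := (0 : ℝ))).congr_of_eventuallyEq ?_
    filter_upwards [Metric.isClosed_closedBall.isOpen_compl.mem_nhds hy] with z hz
    rw [χ.zero_of_le_dist (by
      simp only [mem_compl_iff, Metric.mem_closedBall, not_le] at hz; exact hz.le), zero_mul]

theorem ofReal_sq_le_of_sq_le {t a b L : ℝ} (ht : 0 ≤ t) (ha : 0 ≤ a) (hb : 0 ≤ b) (hL : 0 ≤ L)
    (h : t ^ 2 ≤ 2 * a ^ 2 + 2 * L ^ 2 * b ^ 2) :
    ENNReal.ofReal t ^ 2 ≤ 2 * ENNReal.ofReal a ^ 2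
      + 2 * ENNReal.ofReal L ^ 2 * ENNReal.ofReal b ^ 2 := by
  rw [← ENNReal.ofReal_pow ht, ← ENNReal.ofReal_pow ha, ← ENNReal.ofReal_pow hb,
    ← ENNReal.ofReal_pow hL]
  refine (ENNReal.ofReal_le_ofReal h).trans (le_of_eq ?_)
  rw [ENNReal.ofReal_add (by positivity) (by positivity), ENNReal.ofReal_mul (by positivity),
    ENNReal.ofReal_mul (by positivity), ENNReal.ofReal_mul (by positivity), ENNReal.ofReal_ofNat]

theorem enorm_fderiv_bump_mul_sq_le {c : M} {y0 : EuclideanSpace ℝ (Fin n)} (χ : ContDiffBump y0)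
    (hχ : Metric.closedBall y0 χ.rOut ⊆ (extChartAt (𝓡 n) c).target) {L : NNReal}
    (hL : ∀ y, ‖fderiv ℝ χ y‖ ≤ L) {f : M → ℝ}
    (hf : ContMDiff (𝓡 n) 𝓘(ℝ, ℝ) ∞ f) (y : EuclideanSpace ℝ (Fin n)) :
    ‖fderiv ℝ (fun y => χ y * f ((extChartAt (𝓡 n) c).symm y)) y‖ₑ ^ 2 ≤
      (Metric.closedBall y0 χ.rOut).indicator (fun y =>
        2 * ‖fderiv ℝ (f ∘ (extChartAt (𝓡 n) c).symm) y‖ₑ ^ 2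
          + 2 * (L : ℝ≥0∞) ^ 2 * ‖f ((extChartAt (𝓡 n) c).symm y)‖ₑ ^ 2) y := by
  by_cases hy : y ∈ Metric.closedBall y0 χ.rOut
  · rw [indicator_of_mem hy]
    have hd : DifferentiableAt ℝ (f ∘ (extChartAt (𝓡 n) c).symm) y :=
      ((contDiffOn_comp_symm hf c).contDiffAt
        ((isOpen_extChartAt_target c).mem_nhds (hχ hy))).differentiableAt (by simp)
    have hdχ : DifferentiableAt ℝ χ y := (χ.contDiff (n := 1)).contDiffAt.differentiableAt one_ne_zero
    have e : fderiv ℝ (fun y => χ y * f ((extChartAt (𝓡 n) c).symm y)) y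
        = χ y • fderiv ℝ (f ∘ (extChartAt (𝓡 n) c).symm) y
          + f ((extChartAt (𝓡 n) c).symm y) • fderiv ℝ χ y := fderiv_fun_mul hdχ hd
    set a := ‖fderiv ℝ (f ∘ (extChartAt (𝓡 n) c).symm) y‖
    set b := ‖f ((extChartAt (𝓡 n) c).symm y)‖
    have h1 : ‖fderiv ℝ (fun y => χ y * f ((extChartAt (𝓡 n) c).symm y)) y‖ ≤ a + L * b := by
      rw [e]
      refine (norm_add_le _ _).trans ?_
      rw [norm_smul, norm_smul, mul_comm (L : ℝ)]
      gcongr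
      · rw [Real.norm_of_nonneg χ.nonneg]
        exact mul_le_of_le_one_left (norm_nonneg _) χ.le_one
      · exact hL y
    have h2 : ‖fderiv ℝ (fun y => χ y * f ((extChartAt (𝓡 n) c).symm y)) y‖ ^ 2
        ≤ 2 * a ^ 2 + 2 * (L : ℝ) ^ 2 * b ^ 2 := by
      calc _ ≤ (a + L * b) ^ 2 := by gcongr
        _ ≤ _ := by nlinarith [sq_nonneg (a - L * b)]
    rw [← ofReal_norm, ← ofReal_norm, ← ofReal_norm, ← ENNReal.ofReal_coe_nnreal]
    exact ofReal_sq_le_of_sq_le (norm_nonneg _) (norm_nonneg _) (norm_nonneg _) L.2 h2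
  · rw [indicator_of_notMem hy]
    have : (fun y => χ y * f ((extChartAt (𝓡 n) c).symm y)) =ᶠ[𝓝 y] fun _ => 0 := by
      filter_upwards [Metric.isClosed_closedBall.isOpen_compl.mem_nhds hy] with z hz
      rw [χ.zero_of_le_dist (by
        simp only [mem_compl_iff, Metric.mem_closedBall, not_le] at hz; exact hz.le), zero_mul]
    rw [this.fderiv_eq, fderiv_const_apply]
    have h0 : ‖(0 : EuclideanSpace ℝ (Fin n) →L[ℝ] ℝ)‖ₑ = 0 := by
      rw [← ofReal_norm, norm_zero, ENNReal.ofReal_zero]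
    exact (by rw [h0, zero_pow two_ne_zero] : ‖(0 : EuclideanSpace ℝ (Fin n) →L[ℝ] ℝ)‖ₑ ^ 2 = 0).le

/-- The Gagliardo-Nirenberg-Sobolev inequality in integral form. -/
theorem exists_lintegral_rpow_le_fderiv (hn : 3 ≤ n) : ∃ C : NNReal,
    ∀ h : EuclideanSpace ℝ (Fin n) → ℝ, ContDiff ℝ 1 h → HasCompactSupport h →
      ∫⁻ y, ‖h y‖ₑ ^ (2 * (n : ℝ) / (n - 2)) ≤
        C * (∫⁻ y, ‖fderiv ℝ h y‖ₑ ^ 2) ^ (2 * (n : ℝ) / (n - 2) / 2) := by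
  have h3 : (3 : ℝ) ≤ n := by exact_mod_cast hn
  have hq := sobolevExp_pos hn
  set q := 2 * (n : ℝ) / (n - 2) with hqdef
  set C := SNormLESNormFDerivOfEqConst ℝ (volume : Measure (EuclideanSpace ℝ (Fin n)))
    ((2 : NNReal) : ℝ)
  refine ⟨C ^ q, fun h hh hc => ?_⟩
  have key := eLpNorm_le_eLpNorm_fderiv_of_eq (F := ℝ)
    (volume : Measure (EuclideanSpace ℝ (Fin n))) hh hc (p := 2) (p' := q.toNNReal)
    (by norm_num) (by simp; omega) (by
      rw [Real.coe_toNNReal _ hq.le, finrank_euclideanSpace, Fintype.card_fin, hqdef]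
      have : (n : ℝ) - 2 ≠ 0 := by linarith
      have : (n : ℝ) ≠ 0 := by linarith
      push_cast
      field_simp)
  have e1 : ∫⁻ y, ‖h y‖ₑ ^ q = eLpNorm h q.toNNReal volume ^ q := by
    have := eLpNorm_nnreal_pow_eq_lintegral (f := h)
      (μ := (volume : Measure (EuclideanSpace ℝ (Fin n)))) (p := q.toNNReal)
      (by simpa using hq)
    rw [Real.coe_toNNReal _ hq.le] at this
    exact this.symm
  have e2 : eLpNorm (fderiv ℝ h) ((2 : NNReal) : ℝ≥0∞) volume ^ q
      = (∫⁻ y, ‖fderiv ℝ h y‖ₑ ^ 2) ^ (q / 2) := by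
    have := eLpNorm_nnreal_pow_eq_lintegral (f := fderiv ℝ h)
      (μ := (volume : Measure (EuclideanSpace ℝ (Fin n)))) (p := 2) two_ne_zero
    simp only [NNReal.coe_ofNat, ENNReal.rpow_ofNat] at this
    rw [← this, ← ENNReal.rpow_natCast, ← ENNReal.rpow_mul]
    congr 1
    push_cast; ring
  rw [e1, ENNReal.coe_rpow_of_nonneg _ hq.le]
  calc _ ≤ _ := ENNReal.rpow_le_rpow key hq.le
    _ = _ := by rw [ENNReal.mul_rpow_of_nonneg _ _ hq.le, e2]

/-- The function is cut off in the chart by a bump equal to one on the half ball, and the Euclidean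
inequality is applied; differentiating the bump creates the term `∫ f²`. -/
theorem IsCoordBall.exists_lintegral_rpow_le (hn : 3 ≤ n) {g : Metric n M} {p : M} {r : ℝ}
    {A : NNReal} (hb : IsCoordBall g p r A) :
    ∃ K : NNReal, ∀ f : M → ℝ, ContMDiff (𝓡 n) 𝓘(ℝ, ℝ) ∞ f →
      ∫⁻ x in (extChartAt (𝓡 n) p).symm '' Metric.ball (extChartAt (𝓡 n) p p) (r / 2),
        ‖f x‖ₑ ^ (2 * (n : ℝ) / (n - 2)) ∂(vol g)
        ≤ K * (dirichlet g f + ∫⁻ x, ‖f x‖ₑ ^ 2 ∂(vol g)) ^ (2 * (n : ℝ) / (n - 2) / 2) := by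
  have hq := sobolevExp_pos hn
  set q := 2 * (n : ℝ) / (n - 2) with hqdef
  set y0 := extChartAt (𝓡 n) p p with hy0
  have hr := hb.pos
  let χ : ContDiffBump y0 := ⟨r / 2, r, by linarith, by linarith⟩
  have hχs : Metric.closedBall y0 χ.rOut ⊆ (extChartAt (𝓡 n) p).target := hb.subset
  obtain ⟨L, hL⟩ : ∃ L : NNReal, ∀ y, ‖fderiv ℝ χ y‖ ≤ L := by
    obtain ⟨L, hL⟩ := (χ.hasCompactSupport.fderiv ℝ).exists_bound_of_continuous
      ((χ.contDiff (n := 1)).continuous_fderiv one_ne_zero)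
    exact ⟨L.toNNReal, fun y => (hL y).trans (Real.le_coe_toNNReal L)⟩
  obtain ⟨C, hC⟩ := exists_lintegral_rpow_le_fderiv hn
  -- From `|∇(χf)|² ≤ 2|∇f|² + 2L²f²` in coordinates: the gradient comparison gives `A²`, and each
  -- passage to the Riemannian volume one more `A`.
  set K1 : NNReal := 2 * A ^ 3 + 2 * L ^ 2 * A with hK1
  refine ⟨A * (C * K1 ^ (q / 2)), fun f hf => ?_⟩
  set h := fun y => χ y * f ((extChartAt (𝓡 n) p).symm y) with hh
  have hhc : HasCompactSupport h := χ.hasCompactSupport.mul_right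
  have hfm : Measurable fun x => ‖f x‖ₑ ^ q := hf.continuous.measurable.enorm.pow_const q
  have hsub : Metric.ball y0 (r / 2) ⊆ Metric.closedBall y0 r :=
    Metric.ball_subset_closedBall.trans (Metric.closedBall_subset_closedBall (by linarith))
  have s1 := hb.lintegral_vol_le _ hsub measurableSet_ball _ hfm
  have s2 : ∫⁻ y in Metric.ball y0 (r / 2), ‖f ((extChartAt (𝓡 n) p).symm y)‖ₑ ^ q
      ≤ ∫⁻ y, ‖h y‖ₑ ^ q := by
    refine le_trans (le_of_eq ?_) (setLIntegral_le_lintegral (Metric.ball y0 (r / 2)) _)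
    refine setLIntegral_congr_fun measurableSet_ball fun y hy => ?_
    simp only [hh]
    rw [χ.one_of_mem_closedBall (Metric.ball_subset_closedBall hy), one_mul]
  have s3 : ∫⁻ y, ‖fderiv ℝ h y‖ₑ ^ 2 ≤ K1 * (dirichlet g f + ∫⁻ x, ‖f x‖ₑ ^ 2 ∂(vol g)) := by
    have m1 : Measurable fun x => ‖vnorm g (grad g f x)‖ₑ ^ 2 :=
      (continuous_vnorm_grad g hf).measurable.enorm.pow_const 2
    have m2 : Measurable fun x => ‖f x‖ₑ ^ 2 := hf.continuous.measurable.enorm.pow_const 2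
    have l1 := hb.lintegral_le_vol _ Subset.rfl Metric.isClosed_closedBall.measurableSet _ m1
    have l2 := hb.lintegral_le_vol _ Subset.rfl Metric.isClosed_closedBall.measurableSet _ m2
    calc ∫⁻ y, ‖fderiv ℝ h y‖ₑ ^ 2 ≤ _ :=
          lintegral_mono fun y => enorm_fderiv_bump_mul_sq_le χ hχs hL hf y
      _ = ∫⁻ y in Metric.closedBall y0 r, (2 * ‖fderiv ℝ (f ∘ (extChartAt (𝓡 n) p).symm) y‖ₑ ^ 2
          + 2 * (L : ℝ≥0∞) ^ 2 * ‖f ((extChartAt (𝓡 n) p).symm y)‖ₑ ^ 2) :=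
          lintegral_indicator Metric.isClosed_closedBall.measurableSet _
      _ ≤ ∫⁻ y in Metric.closedBall y0 r,
          (2 * (A : ℝ≥0∞) ^ 2 * ‖vnorm g (grad g f ((extChartAt (𝓡 n) p).symm y))‖ₑ ^ 2
          + 2 * (L : ℝ≥0∞) ^ 2 * ‖f ((extChartAt (𝓡 n) p).symm y)‖ₑ ^ 2) := by
          refine setLIntegral_mono' Metric.isClosed_closedBall.measurableSet fun y hy => ?_
          have h1 : ‖fderiv ℝ (f ∘ (extChartAt (𝓡 n) p).symm) y‖ₑ
              ≤ A * ‖vnorm g (grad g f ((extChartAt (𝓡 n) p).symm y))‖ₑ := by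
            have := hb.norm_fderiv_le f hf y hy
            rw [← ofReal_norm, ← ofReal_norm, Real.norm_of_nonneg (vnorm_nonneg g _),
              ← ENNReal.ofReal_coe_nnreal, ← ENNReal.ofReal_mul (NNReal.coe_nonneg A)]
            exact ENNReal.ofReal_le_ofReal this
          refine add_le_add ?_ le_rfl
          rw [mul_assoc 2 ((A : ℝ≥0∞) ^ 2), ← mul_pow]
          exact mul_le_mul_right (pow_le_pow_left' h1 2) 2
      _ ≤ 2 * (A : ℝ≥0∞) ^ 2 *
            (∫⁻ y in Metric.closedBall y0 r,
              ‖vnorm g (grad g f ((extChartAt (𝓡 n) p).symm y))‖ₑ ^ 2)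
          + 2 * (L : ℝ≥0∞) ^ 2 *
            ∫⁻ y in Metric.closedBall y0 r, ‖f ((extChartAt (𝓡 n) p).symm y)‖ₑ ^ 2 := by
          rw [← lintegral_const_mul' _ _ (by finiteness), ← lintegral_const_mul' _ _ (by finiteness)]
          refine le_of_eq (lintegral_add_right' _ ?_)
          refine AEMeasurable.const_mul (AEMeasurable.pow_const (AEMeasurable.enorm ?_) 2) _
          exact (hf.continuous.comp_continuousOn ((continuousOn_extChartAt_symm p).mono
            hb.subset)).aemeasurable Metric.isClosed_closedBall.measurableSet
      _ ≤ 2 * (A : ℝ≥0∞) ^ 2 * (A * dirichlet g f)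
          + 2 * (L : ℝ≥0∞) ^ 2 * (A * ∫⁻ x, ‖f x‖ₑ ^ 2 ∂(vol g)) := by
          gcongr
          · exact l1.trans (mul_le_mul_right (setLIntegral_le_lintegral _ _) _)
          · exact l2.trans (mul_le_mul_right (setLIntegral_le_lintegral _ _) _)
      _ = 2 * (A : ℝ≥0∞) ^ 3 * dirichlet g f
          + 2 * (L : ℝ≥0∞) ^ 2 * A * ∫⁻ x, ‖f x‖ₑ ^ 2 ∂(vol g) := by ring
      _ ≤ _ := by
          rw [hK1]
          push_cast
          rw [mul_add]
          gcongr
          · exact le_self_add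
          · exact le_add_self
  calc _ ≤ _ := s1
    _ ≤ A * (C * (∫⁻ y, ‖fderiv ℝ h y‖ₑ ^ 2) ^ (q / 2)) := by
        gcongr
        exact s2.trans (hC h (contDiff_bump_mul χ hχs hf) hhc)
    _ ≤ A * (C * (K1 * (dirichlet g f + ∫⁻ x, ‖f x‖ₑ ^ 2 ∂(vol g))) ^ (q / 2)) := by gcongr
    _ = _ := by
        rw [ENNReal.mul_rpow_of_nonneg _ _ (by positivity)]
        push_cast
        rw [ENNReal.coe_rpow_of_nonneg _ (by positivity)]
        ring

/-- The Sobolev inequality with a zeroth-order term, in integral form. -/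
theorem exists_lintegral_rpow_le (hn : 3 ≤ n) (g : Metric n M) :
    ∃ K : NNReal, ∀ f : M → ℝ, ContMDiff (𝓡 n) 𝓘(ℝ, ℝ) ∞ f →
      ∫⁻ x, ‖f x‖ₑ ^ (2 * (n : ℝ) / (n - 2)) ∂(vol g)
        ≤ K * (dirichlet g f + ∫⁻ x, ‖f x‖ₑ ^ 2 ∂(vol g)) ^ (2 * (n : ℝ) / (n - 2) / 2) := by
  have := isCompact_univ.induction_on (p := fun s : Set M => ∃ K : NNReal,
    ∀ f : M → ℝ, ContMDiff (𝓡 n) 𝓘(ℝ, ℝ) ∞ f →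
      ∫⁻ x in s, ‖f x‖ₑ ^ (2 * (n : ℝ) / (n - 2)) ∂(vol g)
        ≤ K * (dirichlet g f + ∫⁻ x, ‖f x‖ₑ ^ 2 ∂(vol g)) ^ (2 * (n : ℝ) / (n - 2) / 2))
    ⟨0, by simp⟩ ?_ ?_ ?_
  · simpa only [Measure.restrict_univ] using this
  · rintro s t hst ⟨K, hK⟩
    exact ⟨K, fun f hf => (lintegral_mono_set hst).trans (hK f hf)⟩
  · rintro s t ⟨K, hK⟩ ⟨K', hK'⟩
    refine ⟨K + K', fun f hf => (lintegral_union_le _ _ _).trans ?_⟩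
    push_cast
    rw [add_mul]
    exact add_le_add (hK f hf) (hK' f hf)
  · intro p _
    obtain ⟨r, A, hb, -⟩ := exists_isCoordBall g p univ_mem
    exact ⟨_, mem_nhdsWithin_of_mem_nhds (hb.image_mem_nhds (half_pos hb.pos)
      (by linarith [hb.pos])), hb.exists_lintegral_rpow_le hn⟩

end Sobolev

/-! ### The modified Sobolev constant is attained and positive -/

section SobolevConstant

variable {n : ℕ} {M : Type*} [TopologicalSpace M]
  [ChartedSpace (EuclideanSpace ℝ (Fin n)) M] [IsManifold (𝓡 n) ∞ M]
  [MeasurableSpace M] [BorelSpace M] [CompactSpace M] [Nonempty M]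

theorem aestronglyMeasurable_inner_grad (g : Metric n M) {f : M → ℝ}
    (hf : ContMDiff (𝓡 n) 𝓘(ℝ, ℝ) ∞ f) {X : ∀ x : M, TangentSpace (𝓡 n) x}
    (hX : AEStronglyMeasurable (fun x => (⟨x, X x⟩ : TangentBundle (𝓡 n) M)) (vol g)) :
    AEStronglyMeasurable (fun x => g.inner x (X x) (grad g f x)) (vol g) :=
  (continuous_inner_grad g hf).comp_aestronglyMeasurable hX

/-- Expanding `|∇f - X|²` leaves `|∇f|²`, `g(X, ∇f)` and `|X|²`, each of known measurability. -/
theorem aestronglyMeasurable_vnorm_grad_sub (g : Metric n M) {f : M → ℝ}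
    (hf : ContMDiff (𝓡 n) 𝓘(ℝ, ℝ) ∞ f) {X : ∀ x : M, TangentSpace (𝓡 n) x}
    (hX : AEStronglyMeasurable (fun x => (⟨x, X x⟩ : TangentBundle (𝓡 n) M)) (vol g))
    (hX2 : AEStronglyMeasurable (fun x => vnorm g (X x)) (vol g)) :
    AEStronglyMeasurable (fun x => vnorm g (grad g f x - X x)) (vol g) := by
  have h : AEStronglyMeasurable (fun x => √(vnorm g (grad g f x) ^ 2
      - 2 * g.inner x (X x) (grad g f x) + vnorm g (X x) ^ 2)) (vol g) :=
    Real.continuous_sqrt.comp_aestronglyMeasurable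
      ((((continuous_vnorm_grad g hf).aestronglyMeasurable.pow 2).sub
        ((aestronglyMeasurable_inner_grad g hf hX).const_mul 2)).add (hX2.pow 2))
  refine h.congr (Eventually.of_forall fun x => ?_)
  beta_reduce
  rw [g.symm x (X x), ← vnorm_sub_sq, Real.sqrt_sq (vnorm_nonneg g _)]

/-- Second countability makes continuous vector fields strongly measurable, and is also used to
metrize the bundle, which makes almost everywhere limits of measurable fields measurable. -/
theorem secondCountableTopology_tangentBundle :
    SecondCountableTopology (TangentBundle (𝓡 n) M) := by
  have : SecondCountableTopology (ModelProd (EuclideanSpace ℝ (Fin n)) (EuclideanSpace ℝ (Fin n))) :=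
    inferInstanceAs (SecondCountableTopology (EuclideanSpace ℝ (Fin n) × EuclideanSpace ℝ (Fin n)))
  refine ChartedSpace.secondCountable_of_countable_cover
    (ModelProd (EuclideanSpace ℝ (Fin n)) (EuclideanSpace ℝ (Fin n)))
    (s := range fun k => (⟨chartSeq n M k, 0⟩ : TangentBundle (𝓡 n) M)) ?_ (countable_range _)
  refine eq_univ_of_forall fun p => ?_
  obtain ⟨k, hk⟩ := Classical.choose_spec (exists_chart_cover n M) p.1
  simp only [mem_range, iUnion_exists, iUnion_iUnion_eq', mem_iUnion]
  refine ⟨k, ?_⟩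
  rw [TangentBundle.mem_chart_source_iff, ← extChartAt_source (𝓡 n)]
  exact hk

/-- Two points whose neighbourhoods always meet have the same base point, since `M` is Hausdorff;
they then lie in one trivialization, whose target is Hausdorff. -/
theorem t2Space_tangentBundle [T2Space M] : T2Space (TangentBundle (𝓡 n) M) := by
  refine t2_iff_nhds.2 fun {p q} hpq => ?_
  have h1 : Tendsto (fun v : TangentBundle (𝓡 n) M => v.1) (𝓝 p ⊓ 𝓝 q) (𝓝 p.1) :=
    ((FiberBundle.continuous_proj _ _).tendsto p).mono_left inf_le_left
  have h2 : Tendsto (fun v : TangentBundle (𝓡 n) M => v.1) (𝓝 p ⊓ 𝓝 q) (𝓝 q.1) :=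
    ((FiberBundle.continuous_proj _ _).tendsto q).mono_left inf_le_right
  have hx := tendsto_nhds_unique h1 h2
  set e := trivializationAt (EuclideanSpace ℝ (Fin n)) (TangentSpace (𝓡 n) : M → Type _) p.1
  have hp : p ∈ e.source :=
    e.mem_source.2 (FiberBundle.mem_baseSet_trivializationAt' p.1)
  have hq : q ∈ e.source :=
    e.mem_source.2 (hx ▸ FiberBundle.mem_baseSet_trivializationAt' p.1)
  exact e.injOn hp hq (tendsto_nhds_unique
    ((e.continuousAt hp).tendsto.mono_left inf_le_left)
    ((e.continuousAt hq).tendsto.mono_left inf_le_right))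

theorem metrizableSpace_tangentBundle [T2Space M] :
    TopologicalSpace.MetrizableSpace (TangentBundle (𝓡 n) M) := by
  have : LocallyCompactSpace
      (ModelProd (EuclideanSpace ℝ (Fin n)) (EuclideanSpace ℝ (Fin n))) :=
    inferInstanceAs (LocallyCompactSpace (EuclideanSpace ℝ (Fin n) × EuclideanSpace ℝ (Fin n)))
  have := ChartedSpace.locallyCompactSpace
    (ModelProd (EuclideanSpace ℝ (Fin n)) (EuclideanSpace ℝ (Fin n))) (TangentBundle (𝓡 n) M)
  have := t2Space_tangentBundle (n := n) (M := M)
  have := secondCountableTopology_tangentBundle (n := n) (M := M)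
  exact TopologicalSpace.metrizableSpace_of_t3_secondCountable _

theorem aestronglyMeasurable_grad [T2Space M] (g : Metric n M) {f : M → ℝ}
    (hf : ContMDiff (𝓡 n) 𝓘(ℝ, ℝ) ∞ f) :
    AEStronglyMeasurable (fun x => (⟨x, grad g f x⟩ : TangentBundle (𝓡 n) M)) (vol g) := by
  have := secondCountableTopology_tangentBundle (n := n) (M := M)
  have := metrizableSpace_tangentBundle (n := n) (M := M)
  exact (continuous_grad g hf).aestronglyMeasurable

theorem isW12_grad [T2Space M] (g : Metric n M) {f : M → ℝ} (hf : ContMDiff (𝓡 n) 𝓘(ℝ, ℝ) ∞ f) :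
    IsW12 g f (grad g f) where
  memLp := memLp_of_continuous g hf.continuous 2
  aestronglyMeasurable := aestronglyMeasurable_grad g hf
  memLp_grad := memLp_of_continuous g (continuous_vnorm_grad g hf) 2
  approx := ⟨fun _ => f, fun _ => hf, by simp, by simp [vnorm_zero]⟩

theorem exists_eLpNorm_le (hn : 3 ≤ n) (g : Metric n M) :
    ∃ K : NNReal, ∀ f : M → ℝ, ContMDiff (𝓡 n) 𝓘(ℝ, ℝ) ∞ f →
      eLpNorm f (ENNReal.ofReal (2 * n / (n - 2))) (vol g) ≤
        K * (eLpNorm (fun x => vnorm g (grad g f x)) 2 (vol g) + eLpNorm f 2 (vol g)) := by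
  have hq := sobolevExp_pos hn
  obtain ⟨K, hK⟩ := exists_lintegral_rpow_le hn g
  set q := 2 * (n : ℝ) / (n - 2)
  refine ⟨K ^ (1 / q), fun f hf => ?_⟩
  have e1 : ∫⁻ x, ‖f x‖ₑ ^ q ∂(vol g) = eLpNorm f (ENNReal.ofReal q) (vol g) ^ q := by
    have := eLpNorm_nnreal_pow_eq_lintegral (f := f) (μ := vol g) (p := q.toNNReal)
      (by simpa using hq)
    rw [Real.coe_toNNReal _ hq.le] at this
    exact this.symm
  have h := hK f hf
  rw [e1, dirichlet, ← eLpNorm_two_sq, ← eLpNorm_two_sq] at h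
  refine (ENNReal.rpow_le_rpow_iff hq).1 (h.trans ?_)
  rw [ENNReal.mul_rpow_of_nonneg _ _ hq.le, ENNReal.coe_rpow_of_nonneg _ (by positivity),
    ← ENNReal.rpow_mul, one_div, inv_mul_cancel₀ hq.ne', ENNReal.rpow_one]
  refine mul_le_mul_right ?_ _
  set a := eLpNorm (fun x => vnorm g (grad g f x)) 2 (vol g)
  set b := eLpNorm f 2 (vol g)
  calc (a ^ 2 + b ^ 2) ^ (q / 2) ≤ ((a + b) ^ 2) ^ (q / 2) := by
        refine ENNReal.rpow_le_rpow ?_ (by positivity)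
        rw [show (a + b) ^ 2 = a ^ 2 + b ^ 2 + 2 * a * b by ring]
        exact le_self_add
    _ = (a + b) ^ q := by
        rw [← ENNReal.rpow_natCast, ← ENNReal.rpow_mul]
        congr 1
        push_cast; ring

/-- The average of a function over `M`. -/
noncomputable def average (g : Metric n M) (f : M → ℝ) : ℝ := (∫ x, f x ∂(vol g)) / totalVol g

/-- Among all constants the mean is closest in `L²`; this replaces the unspecified constant of the
Poincaré inequality. -/
theorem eLpNorm_sub_average_le (g : Metric n M) {f : M → ℝ} (hf : Continuous f) (c : ℝ) :
    eLpNorm (fun x => f x - average g f) 2 (vol g) ≤ eLpNorm (fun x => f x - c) 2 (vol g) := by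
  rw [eLpNorm_two_eq g (f := fun x => f x - average g f) (hf.sub continuous_const),
    eLpNorm_two_eq g (f := fun x => f x - c) (hf.sub continuous_const)]
  refine ENNReal.ofReal_le_ofReal (Real.sqrt_le_sqrt ?_)
  have h1 := setIntegral_sub_const_sq g hf univ c
  have h2 := setIntegral_sub_const_sq g hf univ (average g f)
  have hV := totalVol_pos g
  rw [Measure.restrict_univ] at h1 h2
  rw [h1, h2]
  have e : ∫ x, f x ∂(vol g) = totalVol g * average g f := by
    rw [average]; field_simp
  rw [e]
  change _ - _ + totalVol g * _ ≤ _ - _ + totalVol g * _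
  nlinarith [mul_nonneg hV.le (sq_nonneg (average g f - c))]

/-- By Cauchy–Schwarz the mean is at most `V^(-1/2)‖f‖₂`, and a constant has `L^q` norm `V^(1/q)`
times its size; `1/q - 1/2 = -1/n` is the exponent in the definition of the Sobolev constant. -/
theorem eLpNorm_average_le (hn : 3 ≤ n) (g : Metric n M) {f : M → ℝ} (hf : Continuous f) :
    eLpNorm (fun _ : M => average g f) (ENNReal.ofReal (2 * n / (n - 2))) (vol g) ≤
      ENNReal.ofReal (totalVol g ^ (-(1 / (n : ℝ)))) * eLpNorm f 2 (vol g) := by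
  have hq := sobolevExp_pos hn
  have h3 : (3 : ℝ) ≤ n := by exact_mod_cast hn
  have hV := totalVol_pos g
  set q := 2 * (n : ℝ) / (n - 2) with hqd
  have : (vol g) ≠ 0 := by
    intro h
    rw [totalVol, h] at hV
    simp at hV
  rw [eLpNorm_const _ (by simpa using hq) this, ENNReal.toReal_ofReal hq.le,
    eLpNorm_two_eq g hf, ← ENNReal.ofReal_mul (by positivity), ← ofReal_norm,
    show (vol g) univ = ENNReal.ofReal (totalVol g) from
      (ENNReal.ofReal_toReal (measure_ne_top _ _)).symm,
    ENNReal.ofReal_rpow_of_pos hV, ← ENNReal.ofReal_mul (norm_nonneg _)]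
  refine ENNReal.ofReal_le_ofReal ?_
  have h := sq_setIntegral_div_le g hf univ
  rw [Measure.restrict_univ] at h
  change (∫ x, f x ∂(vol g)) ^ 2 / totalVol g ≤ _ at h
  have h2 : ‖average g f‖ ≤ totalVol g ^ (-(1 / 2) : ℝ) * √(∫ x, f x ^ 2 ∂(vol g)) := by
    rw [Real.rpow_neg hV.le, ← Real.sqrt_eq_rpow, average, Real.norm_eq_abs, abs_div,
      abs_of_pos hV, ← div_eq_inv_mul, div_le_div_iff₀ hV (Real.sqrt_pos.2 hV)]
    rw [div_le_iff₀ hV] at h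
    calc |∫ x, f x ∂(vol g)| * √(totalVol g)
        ≤ √((∫ x, f x ^ 2 ∂(vol g)) * totalVol g) * √(totalVol g) := by
          refine mul_le_mul_of_nonneg_right ?_ (Real.sqrt_nonneg _)
          exact Real.abs_le_sqrt h
      _ = _ := by
          rw [Real.sqrt_mul (integral_nonneg fun x => sq_nonneg _), mul_assoc,
            Real.mul_self_sqrt hV.le]
  calc _ ≤ totalVol g ^ (-(1 / 2) : ℝ) * √(∫ x, f x ^ 2 ∂(vol g)) * totalVol g ^ (1 / q) := by
        gcongr
    _ = (totalVol g ^ (-(1 / 2) : ℝ) * totalVol g ^ (1 / q)) * √(∫ x, f x ^ 2 ∂(vol g)) := by ring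
    _ = _ := by
        rw [← Real.rpow_add hV]
        congr 2
        rw [hqd]
        have : (n : ℝ) - 2 ≠ 0 := by linarith
        field_simp
        ring

/-- Split `f` into its mean and `f - mean`. The first part uses up precisely the allowed
zeroth-order term; for the second, Poincaré absorbs the `L²` norm into the gradient. -/
theorem exists_sobolev_smooth (hn : 3 ≤ n) [ConnectedSpace M] (g : Metric n M) :
    ∃ C : NNReal, ∀ f : M → ℝ, ContMDiff (𝓡 n) 𝓘(ℝ, ℝ) ∞ f →
      eLpNorm f (ENNReal.ofReal (2 * n / (n - 2))) (vol g) ≤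
        C * eLpNorm (fun x => vnorm g (grad g f x)) 2 (vol g)
          + ENNReal.ofReal (totalVol g ^ (-(1 / (n : ℝ)))) * eLpNorm f 2 (vol g) := by
  obtain ⟨K, hK⟩ := exists_eLpNorm_le hn g
  obtain ⟨C, hC⟩ := hasPoincare_univ g
  have h3 : (3 : ℝ) ≤ n := by exact_mod_cast hn
  refine ⟨K * (1 + NNReal.sqrt C), fun f hf => ?_⟩
  obtain ⟨c, hc⟩ := hC f hf
  rw [Measure.restrict_univ, ← eLpNorm_two_sq g (fun x => f x - c), dirichlet,
    ← eLpNorm_two_sq] at hc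
  have hc' : eLpNorm (fun x => f x - average g f) 2 (vol g)
      ≤ NNReal.sqrt C * eLpNorm (fun x => vnorm g (grad g f x)) 2 (vol g) := by
    refine (eLpNorm_sub_average_le g hf.continuous c).trans ?_
    refine (ENNReal.pow_le_pow_left_iff two_ne_zero).1 ?_
    rw [mul_pow, ← ENNReal.coe_pow, NNReal.sq_sqrt]
    exact hc
  have hs : ContMDiff (𝓡 n) 𝓘(ℝ, ℝ) ∞ (fun x => f x - average g f) := hf.sub contMDiff_const
  have hgr : ∀ x, grad g (fun x => f x - average g f) x = grad g f x := fun x => by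
    rw [grad_sub g hf contMDiff_const, grad_const, sub_zero]
  have h1 := hK _ hs
  simp only [hgr] at h1
  have hq1 : 1 ≤ ENNReal.ofReal (2 * (n : ℝ) / (n - 2)) := by
    rw [ENNReal.one_le_ofReal, le_div_iff₀ (by linarith)]
    linarith
  calc eLpNorm f (ENNReal.ofReal (2 * n / (n - 2))) (vol g)
      = eLpNorm ((fun x => f x - average g f) + fun _ : M => average g f)
          (ENNReal.ofReal (2 * n / (n - 2))) (vol g) := by
        congr 1
        ext x
        simp
    _ ≤ _ := eLpNorm_add_le hs.continuous.aestronglyMeasurable aestronglyMeasurable_const hq1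
    _ ≤ _ := by
        refine add_le_add (h1.trans ?_) (eLpNorm_average_le hn g hf.continuous)
        push_cast
        rw [mul_assoc, add_mul, one_mul]
        exact mul_le_mul_right (add_le_add le_rfl hc') _

/-- Density: Fatou's lemma for the left side along an almost everywhere convergent subsequence, and
`L²` convergence for the right side. -/
theorem IsW12.eLpNorm_le {g : Metric n M} {u : M → ℝ} {X : ∀ x : M, TangentSpace (𝓡 n) x}
    (h : IsW12 g u X) {q A B : ℝ≥0∞} (hA : A ≠ ⊤) (hB : B ≠ ⊤)
    (hs : ∀ f : M → ℝ, ContMDiff (𝓡 n) 𝓘(ℝ, ℝ) ∞ f → eLpNorm f q (vol g) ≤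
      A * eLpNorm (fun x => vnorm g (grad g f x)) 2 (vol g) + B * eLpNorm f 2 (vol g)) :
    eLpNorm u q (vol g) ≤
      A * eLpNorm (fun x => vnorm g (X x)) 2 (vol g) + B * eLpNorm u 2 (vol g) := by
  obtain ⟨f, hf, h1, h2⟩ := h.approx
  have hm : TendstoInMeasure (vol g) f atTop u :=
    tendstoInMeasure_of_tendsto_eLpNorm two_ne_zero
      (fun k => (hf k).continuous.aestronglyMeasurable) h.memLp.aestronglyMeasurable h1
  obtain ⟨ns, hns, hae⟩ := hm.exists_seq_tendsto_ae
  have hL := Lp.eLpNorm_lim_le_liminf_eLpNorm (p := q) (f := fun k => f (ns k))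
    (fun k => (hf (ns k)).continuous.aestronglyMeasurable) u hae
  have hb : ∀ k, eLpNorm (f k) q (vol g) ≤
      A * (eLpNorm (fun x => vnorm g (grad g (f k) x - X x)) 2 (vol g)
        + eLpNorm (fun x => vnorm g (X x)) 2 (vol g))
      + B * (eLpNorm (fun x => f k x - u x) 2 (vol g) + eLpNorm u 2 (vol g)) := by
    intro k
    refine (hs _ (hf k)).trans (add_le_add (mul_le_mul_right ?_ _) (mul_le_mul_right ?_ _))
    · refine le_trans (eLpNorm_mono_real fun x => ?_)
        (eLpNorm_add_le (aestronglyMeasurable_vnorm_grad_sub g (hf k) h.aestronglyMeasurable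
          h.memLp_grad.aestronglyMeasurable) h.memLp_grad.aestronglyMeasurable one_le_two)
      rw [Real.norm_of_nonneg (vnorm_nonneg g _)]
      have := vnorm_add_le g (grad g (f k) x - X x) (X x)
      rwa [sub_add_cancel] at this
    · have := eLpNorm_add_le (p := 2) (f := fun x => f k x - u x) (g := u)
        ((hf k).continuous.aestronglyMeasurable.sub h.memLp.aestronglyMeasurable)
        h.memLp.aestronglyMeasurable one_le_two
      refine le_trans (le_of_eq ?_) this
      congr 1
      ext x
      simp
  have ht : Tendsto (fun k => A * (eLpNorm (fun x => vnorm g (grad g (f k) x - X x)) 2 (vol g)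
        + eLpNorm (fun x => vnorm g (X x)) 2 (vol g))
      + B * (eLpNorm (fun x => f k x - u x) 2 (vol g) + eLpNorm u 2 (vol g))) atTop
      (𝓝 (A * (0 + eLpNorm (fun x => vnorm g (X x)) 2 (vol g)) + B * (0 + eLpNorm u 2 (vol g)))) :=
    (ENNReal.Tendsto.const_mul (h2.add tendsto_const_nhds) (Or.inr hA)).add
      (ENNReal.Tendsto.const_mul (h1.add tendsto_const_nhds) (Or.inr hB))
  rw [zero_add, zero_add] at ht
  refine hL.trans ?_
  rw [← (ht.comp hns.tendsto_atTop).liminf_eq]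
  exact liminf_le_liminf (Eventually.of_forall fun k => hb (ns k))

theorem sobolevConst_nonneg (g : Metric n M) : 0 ≤ sobolevConst g :=
  Real.sInf_nonneg fun _ h => h.1

/-- The infimum is itself admissible: the set of admissible constants is nonempty and the inequality
is closed in `C`. -/
theorem IsW12.sobolev (hn : 3 ≤ n) [ConnectedSpace M] {g : Metric n M} {u : M → ℝ}
    {X : ∀ x : M, TangentSpace (𝓡 n) x} (h : IsW12 g u X) :
    eLpNorm u (ENNReal.ofReal (2 * n / (n - 2))) (vol g) ≤
      ENNReal.ofReal (sobolevConst g) * eLpNorm (fun x => vnorm g (X x)) 2 (vol g)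
        + ENNReal.ofReal (totalVol g ^ (-(1 / (n : ℝ)))) * eLpNorm u 2 (vol g) := by
  obtain ⟨C, hC⟩ := exists_sobolev_smooth hn g
  obtain ⟨c, -, hc, hcS⟩ := exists_seq_tendsto_sInf (S := {C : ℝ | 0 ≤ C ∧ ∀ (u : M → ℝ)
    (X : ∀ x : M, TangentSpace (𝓡 n) x), IsW12 g u X →
    eLpNorm u (ENNReal.ofReal (2 * n / (n - 2))) (vol g) ≤
      ENNReal.ofReal C * eLpNorm (fun x => vnorm g (X x)) 2 (vol g)
        + ENNReal.ofReal (totalVol g ^ (-(1 / (n : ℝ)))) * eLpNorm u 2 (vol g)})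
    ⟨C, C.2, fun u X h => h.eLpNorm_le ENNReal.ofReal_ne_top ENNReal.ofReal_ne_top
      (by simpa using hC)⟩ ⟨0, fun _ h => h.1⟩
  refine ge_of_tendsto' (x := atTop) (f := fun k => ENNReal.ofReal (c k) *
    eLpNorm (fun x => vnorm g (X x)) 2 (vol g)
      + ENNReal.ofReal (totalVol g ^ (-(1 / (n : ℝ)))) * eLpNorm u 2 (vol g)) ?_
    fun k => (hcS k).2 u X h
  exact (ENNReal.Tendsto.mul_const ((ENNReal.continuous_ofReal.tendsto _).comp hc)
    (Or.inr h.memLp_grad.eLpNorm_ne_top)).add tendsto_const_nhds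

/-- A one-point manifold would have a chart whose open target is a singleton of a
positive-dimensional Euclidean space. -/
theorem nontrivial_of_dim (hn : 3 ≤ n) : Nontrivial M := by
  by_contra h
  rw [not_nontrivial_iff_subsingleton] at h
  obtain ⟨p⟩ := ‹Nonempty M›
  have : Nontrivial (EuclideanSpace ℝ (Fin n)) := by
    have : Nonempty (Fin n) := ⟨⟨0, by omega⟩⟩
    infer_instance
  have h1 := isOpen_extChartAt_target (I := 𝓡 n) p
  have h2 : (extChartAt (𝓡 n) p).target = {extChartAt (𝓡 n) p p} := by
    ext y
    refine ⟨fun hy => ?_, fun hy => ?_⟩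
    · rw [mem_singleton_iff, ← (extChartAt (𝓡 n) p).right_inv hy]
      congr 1
      exact Subsingleton.elim _ _
    · rw [hy]; exact mem_extChartAt_target p
  rw [h2] at h1
  exact not_isOpen_singleton _ h1

/-- There are nonzero smooth functions vanishing on a nonempty open set. -/
theorem exists_smooth_vanishing [T2Space M] (hn : 3 ≤ n) : ∃ (f : M → ℝ) (U : Set M),
    ContMDiff (𝓡 n) 𝓘(ℝ, ℝ) ∞ f ∧ (∃ x, f x ≠ 0) ∧ IsOpen U ∧ U.Nonempty ∧ ∀ x ∈ U, f x = 0 := by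
  obtain ⟨p, q, hpq⟩ := (nontrivial_of_dim (M := M) hn).exists_pair_ne
  obtain ⟨U, W, hU, hW, hp, hq, hd⟩ := t2_separation hpq
  obtain ⟨f, -, hf⟩ := (SmoothBumpFunction.nhds_basis_tsupport (I := 𝓡 n) p).mem_iff.1
    (hU.mem_nhds hp)
  refine ⟨f, W, f.contMDiff, ⟨p, by rw [f.eq_one]; exact one_ne_zero⟩, hW, ⟨q, hq⟩, fun x hx => ?_⟩
  by_contra h
  exact disjoint_left.1 hd (hf (subset_closure h)) hx

/-- With constant zero, every `f` would satisfy `‖f‖_q ≤ V^(-1/n)‖f‖₂`. If `f` vanishes on an open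
set, Hölder's inequality on the complement, whose volume is strictly below `V`, makes the right side
strictly smaller than `‖f‖_q`. -/
theorem sobolevConst_pos (hn : 3 ≤ n) [T2Space M] [ConnectedSpace M] (g : Metric n M) :
    0 < sobolevConst g := by
  refine (sobolevConst_nonneg g).lt_of_ne fun h0 => ?_
  obtain ⟨f, U, hf, ⟨x0, hx0⟩, hU, hUne, hfU⟩ := exists_smooth_vanishing (M := M) hn
  have h := (isW12_grad g hf).sobolev hn
  have hq := sobolevExp_pos hn
  have h3 : (3 : ℝ) ≤ n := by exact_mod_cast hn
  set q := 2 * (n : ℝ) / (n - 2) with hqd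
  rw [← h0, ENNReal.ofReal_zero, zero_mul, zero_add] at h
  have hV := totalVol_pos g
  have hsup : Function.support f ⊆ Uᶜ := fun x hx hxU => hx (hfU x hxU)
  have hH := eLpNorm_le_eLpNorm_mul_rpow_measure_univ (p := 2) (q := ENNReal.ofReal q)
    (μ := (vol g).restrict Uᶜ) (f := f) (by
      rw [← ENNReal.ofReal_ofNat]
      refine ENNReal.ofReal_le_ofReal ?_
      rw [hqd, le_div_iff₀ (by linarith)]
      linarith) hf.continuous.aestronglyMeasurable
  rw [eLpNorm_restrict_eq_of_support_subset hsup, eLpNorm_restrict_eq_of_support_subset hsup,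
    Measure.restrict_apply_univ, ENNReal.toReal_ofReal hq.le,
    show 1 / (2 : ℝ≥0∞).toReal - 1 / q = 1 / (n : ℝ) by
      rw [hqd, ENNReal.toReal_ofNat]
      have : (n : ℝ) - 2 ≠ 0 := by linarith
      field_simp
      ring] at hH
  set N := eLpNorm f (ENNReal.ofReal q) (vol g)
  have hN : N ≠ ⊤ := (memLp_of_continuous g hf.continuous _).eLpNorm_ne_top
  have hN0 : N ≠ 0 := by
    intro hz
    rw [eLpNorm_eq_zero_iff hf.continuous.aestronglyMeasurable (by simpa using hq)] at hz
    have := (hf.continuous.ae_eq_iff_eq (vol g) continuous_zero).1 hz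
    exact hx0 (congrFun this x0)
  have hUc : (vol g).real Uᶜ < totalVol g := by
    have e : (vol g).real U + (vol g).real Uᶜ = totalVol g := measureReal_add_measureReal_compl hU.measurableSet
    have : 0 < (vol g).real U :=
      ENNReal.toReal_pos (hU.measure_pos _ hUne).ne' (measure_ne_top _ _)
    linarith
  have hlt : ENNReal.ofReal (totalVol g ^ (-(1 / (n : ℝ)))) * (vol g) Uᶜ ^ (1 / (n : ℝ)) < 1 := by
    have e : (vol g) Uᶜ = ENNReal.ofReal ((vol g).real Uᶜ) :=
      (ENNReal.ofReal_toReal (measure_ne_top _ _)).symm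
    rw [e, ENNReal.ofReal_rpow_of_nonneg measureReal_nonneg (by positivity),
      ← ENNReal.ofReal_mul (by positivity), ENNReal.ofReal_lt_one, Real.rpow_neg hV.le,
      inv_mul_lt_one₀ (by positivity)]
    exact Real.rpow_lt_rpow measureReal_nonneg hUc (by positivity)
  have : N < N := by
    calc N ≤ ENNReal.ofReal (totalVol g ^ (-(1 / (n : ℝ)))) * eLpNorm f 2 (vol g) := h
      _ ≤ ENNReal.ofReal (totalVol g ^ (-(1 / (n : ℝ)))) * (N * (vol g) Uᶜ ^ (1 / (n : ℝ))) := by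
          gcongr
      _ = N * (ENNReal.ofReal (totalVol g ^ (-(1 / (n : ℝ)))) * (vol g) Uᶜ ^ (1 / (n : ℝ))) := by
          ring
      _ < N * 1 := (ENNReal.mul_lt_mul_iff_right hN0 hN).2 hlt
      _ = N := mul_one N
  exact lt_irrefl _ this

end SobolevConstant

/-! ### Continuity of quadratic integrals under W^{1,2} convergence -/

section Limits

variable {n : ℕ} {M : Type*} [TopologicalSpace M]
  [ChartedSpace (EuclideanSpace ℝ (Fin n)) M] [IsManifold (𝓡 n) ∞ M]
  [MeasurableSpace M] [BorelSpace M] [CompactSpace M] [Nonempty M]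

/-- The common pattern for quadratic expressions: their difference is at most `w(v + Cw)` with `w →
0` in `L²`, so Cauchy–Schwarz gives `L¹` convergence. -/
theorem tendsto_integral_of_le_mul {α : Type*} [MeasurableSpace α] {μ : Measure α}
    {a w : ℕ → α → ℝ} {b v : α → ℝ} {C : ℝ} (ha : ∀ k, Integrable (a k) μ) (hb : Integrable b μ)
    (hw : ∀ k, AEStronglyMeasurable (w k) μ) (hv : MemLp v 2 μ)
    (h : ∀ k x, |a k x - b x| ≤ w k x * (v x + C * w k x))
    (ht : Tendsto (fun k => eLpNorm (w k) 2 μ) atTop (𝓝 0)) :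
    Tendsto (fun k => ∫ x, a k x ∂μ) atTop (𝓝 (∫ x, b x ∂μ)) := by
  refine tendsto_integral_of_L1' b hb.1 (Eventually.of_forall ha) ?_
  have h1 : ∀ k, eLpNorm (a k - b) 1 μ
      ≤ eLpNorm (w k) 2 μ * (eLpNorm v 2 μ + ‖C‖ₑ * eLpNorm (w k) 2 μ) := by
    intro k
    calc eLpNorm (a k - b) 1 μ ≤ eLpNorm (w k • (v + C • w k)) 1 μ :=
          eLpNorm_mono_real fun x => h k x
      _ ≤ eLpNorm (w k) 2 μ * eLpNorm (v + C • w k) 2 μ :=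
          eLpNorm_smul_le_mul_eLpNorm (hv.1.add ((hw k).const_smul C)) (hw k)
      _ ≤ _ := by
          refine mul_le_mul_right ((eLpNorm_add_le hv.1 ((hw k).const_smul C) one_le_two).trans ?_) _
          rw [eLpNorm_const_smul]
  refine tendsto_of_tendsto_of_tendsto_of_le_of_le tendsto_const_nhds ?_ (fun k => zero_le) h1
  have h2 : Tendsto (fun k => eLpNorm (w k) 2 μ * (eLpNorm v 2 μ + ‖C‖ₑ * eLpNorm (w k) 2 μ)) atTop
      (𝓝 (0 * (eLpNorm v 2 μ + ‖C‖ₑ * 0))) := by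
    refine ENNReal.Tendsto.mul ht (Or.inr ?_) (tendsto_const_nhds.add
      (ENNReal.Tendsto.const_mul ht (Or.inr enorm_ne_top))) (Or.inr ENNReal.zero_ne_top)
    rw [mul_zero, add_zero]
    exact hv.eLpNorm_ne_top
  rwa [zero_mul] at h2

theorem memLp_scalarCurv_mul (g : Metric n M) {u : M → ℝ} (hu : MemLp u 2 (vol g)) :
    MemLp (fun x => scalarCurv g x / 4 * u x) 2 (vol g) := by
  obtain ⟨K, hK, hR⟩ := exists_bound_scalarCurv g
  refine (hu.const_mul (K / 4)).mono
    (((continuous_scalarCurv g).div_const 4).aestronglyMeasurable.mul hu.1)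
    (Eventually.of_forall fun x => ?_)
  rw [norm_mul, norm_mul, Real.norm_eq_abs, Real.norm_eq_abs (K / 4), abs_div, abs_div,
    abs_of_nonneg hK]
  gcongr
  exact hR x

/-- The bilinear form of the operator `-Δ + R/4`. -/
noncomputable def weakForm (g : Metric n M) (u : M → ℝ) (X : ∀ x : M, TangentSpace (𝓡 n) x)
    (v : M → ℝ) (Y : ∀ x : M, TangentSpace (𝓡 n) x) : ℝ :=
  ∫ x, (g.inner x (X x) (Y x) + scalarCurv g x / 4 * u x * v x) ∂(vol g)

theorem weakForm_self (g : Metric n M) (u : M → ℝ) (X : ∀ x : M, TangentSpace (𝓡 n) x) :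
    weakForm g u X u X = energy g u X := by
  refine integral_congr_ae (Eventually.of_forall fun x => ?_)
  beta_reduce
  rw [vnorm_sq]
  ring

theorem weakForm_comm (g : Metric n M) (u : M → ℝ) (X : ∀ x : M, TangentSpace (𝓡 n) x)
    (v : M → ℝ) (Y : ∀ x : M, TangentSpace (𝓡 n) x) :
    weakForm g u X v Y = weakForm g v Y u X := by
  simp only [weakForm]
  refine integral_congr_ae (Eventually.of_forall fun x => ?_)
  beta_reduce
  rw [g.symm x (X x)]
  ring

theorem integrable_inner (g : Metric n M) {X Y : ∀ x : M, TangentSpace (𝓡 n) x}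
    (hX : MemLp (fun x => vnorm g (X x)) 2 (vol g)) (hY : MemLp (fun x => vnorm g (Y x)) 2 (vol g))
    (hm : AEStronglyMeasurable (fun x => g.inner x (X x) (Y x)) (vol g)) :
    Integrable (fun x => g.inner x (X x) (Y x)) (vol g) := by
  refine (hX.integrable_mul hY).mono' hm (Eventually.of_forall fun x => ?_)
  exact abs_inner_le g (X x) (Y x)

theorem integrable_scalarCurv_mul (g : Metric n M) {u v : M → ℝ} (hu : MemLp u 2 (vol g))
    (hv : MemLp v 2 (vol g)) : Integrable (fun x => scalarCurv g x / 4 * u x * v x) (vol g) :=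
  (memLp_scalarCurv_mul g hu).integrable_mul hv

theorem memLp_vnorm_grad (g : Metric n M) {f : M → ℝ} (hf : ContMDiff (𝓡 n) 𝓘(ℝ, ℝ) ∞ f) :
    MemLp (fun x => vnorm g (grad g f x)) 2 (vol g) :=
  memLp_of_continuous g (continuous_vnorm_grad g hf) 2

theorem tendsto_integral_mul (g : Metric n M) {f : ℕ → M → ℝ} {u v : M → ℝ}
    (hf : ∀ k, Continuous (f k)) (hu : MemLp u 2 (vol g)) (hv : MemLp v 2 (vol g))
    (ht : Tendsto (fun k => eLpNorm (fun x => f k x - u x) 2 (vol g)) atTop (𝓝 0)) :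
    Tendsto (fun k => ∫ x, f k x * v x ∂(vol g)) atTop (𝓝 (∫ x, u x * v x ∂(vol g))) := by
  refine tendsto_integral_of_le_mul (C := 0) (w := fun k x => |f k x - u x|) (v := fun x => |v x|)
    (fun k => (memLp_of_continuous g (hf k) 2).integrable_mul hv) (hu.integrable_mul hv)
    (fun k => ((hf k).aestronglyMeasurable.sub hu.1).norm) hv.norm (fun k x => ?_) ?_
  · rw [zero_mul, add_zero, ← abs_mul, sub_mul]
  · refine ht.congr fun k => ?_
    exact (eLpNorm_norm _).symm

theorem tendsto_integral_sq (g : Metric n M) {f : ℕ → M → ℝ} {u : M → ℝ}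
    (hf : ∀ k, Continuous (f k)) (hu : MemLp u 2 (vol g))
    (ht : Tendsto (fun k => eLpNorm (fun x => f k x - u x) 2 (vol g)) atTop (𝓝 0)) :
    Tendsto (fun k => ∫ x, f k x ^ 2 ∂(vol g)) atTop (𝓝 (∫ x, u x ^ 2 ∂(vol g))) := by
  refine tendsto_integral_of_le_mul (C := 1) (w := fun k x => |f k x - u x|)
    (v := fun x => 2 * |u x|)
    (fun k => integrable_of_continuous g ((hf k).pow 2)) hu.integrable_sq
    (fun k => ((hf k).aestronglyMeasurable.sub hu.1).norm) (hu.norm.const_mul 2) (fun k x => ?_) ?_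
  · rw [show f k x ^ 2 - u x ^ 2 = (f k x - u x) * (2 * u x + (f k x - u x)) by ring, abs_mul,
      one_mul]
    gcongr
    refine (abs_add_le _ _).trans ?_
    rw [abs_mul, abs_two]
  · refine ht.congr fun k => ?_
    exact (eLpNorm_norm _).symm

/-- Measurability of the pairing of `X` and `Y` is a separate hypothesis, because the two uses
supply it differently: once `Y` is a smooth gradient, once `Y = X`. -/
theorem tendsto_weakForm (g : Metric n M) {f : ℕ → M → ℝ} {u v : M → ℝ}
    {X Y : ∀ x : M, TangentSpace (𝓡 n) x}
    (hf : ∀ k, ContMDiff (𝓡 n) 𝓘(ℝ, ℝ) ∞ (f k)) (hu : MemLp u 2 (vol g))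
    (hXs : AEStronglyMeasurable (fun x => (⟨x, X x⟩ : TangentBundle (𝓡 n) M)) (vol g))
    (hX : MemLp (fun x => vnorm g (X x)) 2 (vol g)) (hv : MemLp v 2 (vol g))
    (hYs : AEStronglyMeasurable (fun x => (⟨x, Y x⟩ : TangentBundle (𝓡 n) M)) (vol g))
    (hY : MemLp (fun x => vnorm g (Y x)) 2 (vol g))
    (hXY : AEStronglyMeasurable (fun x => g.inner x (X x) (Y x)) (vol g))
    (h1 : Tendsto (fun k => eLpNorm (fun x => f k x - u x) 2 (vol g)) atTop (𝓝 0))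
    (h2 : Tendsto (fun k => eLpNorm (fun x => vnorm g (grad g (f k) x - X x)) 2 (vol g))
      atTop (𝓝 0)) :
    Tendsto (fun k => weakForm g (f k) (grad g (f k)) v Y) atTop (𝓝 (weakForm g u X v Y)) := by
  have hm : ∀ k, AEStronglyMeasurable (fun x => g.inner x (grad g (f k) x) (Y x)) (vol g) :=
    fun k => (aestronglyMeasurable_inner_grad g (hf k) hYs).congr
      (Eventually.of_forall fun x => g.symm x _ _)
  have hfL : ∀ k, MemLp (f k) 2 (vol g) := fun k => memLp_of_continuous g (hf k).continuous 2
  have t1 : Tendsto (fun k => ∫ x, g.inner x (grad g (f k) x) (Y x) ∂(vol g)) atTop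
      (𝓝 (∫ x, g.inner x (X x) (Y x) ∂(vol g))) := by
    refine tendsto_integral_of_le_mul (C := 0) (w := fun k x => vnorm g (grad g (f k) x - X x))
      (v := fun x => vnorm g (Y x)) (fun k => integrable_inner g (memLp_vnorm_grad g (hf k)) hY (hm k))
      (integrable_inner g hX hY hXY)
      (fun k => aestronglyMeasurable_vnorm_grad_sub g (hf k) hXs hX.1) hY (fun k x => ?_) h2
    rw [zero_mul, add_zero]
    have e : g.inner x (grad g (f k) x) (Y x) - g.inner x (X x) (Y x)
        = g.inner x (grad g (f k) x - X x) (Y x) := by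
      rw [map_sub]; rfl
    rw [e]
    exact abs_inner_le g _ _
  have t2 := tendsto_integral_mul g (fun k => (hf k).continuous) hu (memLp_scalarCurv_mul g hv) h1
  refine ((t1.add t2).congr fun k => ?_).trans (le_of_eq ?_)
  · rw [weakForm, integral_add (integrable_inner g (memLp_vnorm_grad g (hf k)) hY (hm k))
      (integrable_scalarCurv_mul g (hfL k) hv)]
    congr 1
    exact integral_congr_ae (Eventually.of_forall fun x => by ring)
  · rw [weakForm, integral_add (integrable_inner g hX hY hXY) (integrable_scalarCurv_mul g hu hv)]
    congr 2
    exact integral_congr_ae (Eventually.of_forall fun x => by ring)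

theorem aestronglyMeasurable_inner_self (g : Metric n M) {X : ∀ x : M, TangentSpace (𝓡 n) x}
    (hX : MemLp (fun x => vnorm g (X x)) 2 (vol g)) :
    AEStronglyMeasurable (fun x => g.inner x (X x) (X x)) (vol g) :=
  (hX.1.pow 2).congr (Eventually.of_forall fun x => vnorm_sq g (X x))

theorem integral_vnorm_sq_tendsto (g : Metric n M) {f : ℕ → M → ℝ}
    {X : ∀ x : M, TangentSpace (𝓡 n) x}
    (hf : ∀ k, ContMDiff (𝓡 n) 𝓘(ℝ, ℝ) ∞ (f k))
    (hXs : AEStronglyMeasurable (fun x => (⟨x, X x⟩ : TangentBundle (𝓡 n) M)) (vol g))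
    (hX : MemLp (fun x => vnorm g (X x)) 2 (vol g))
    (h2 : Tendsto (fun k => eLpNorm (fun x => vnorm g (grad g (f k) x - X x)) 2 (vol g))
      atTop (𝓝 0)) :
    Tendsto (fun k => ∫ x, vnorm g (grad g (f k) x) ^ 2 ∂(vol g)) atTop
      (𝓝 (∫ x, vnorm g (X x) ^ 2 ∂(vol g))) := by
  refine tendsto_integral_of_le_mul (C := 1) (w := fun k x => vnorm g (grad g (f k) x - X x))
    (v := fun x => 2 * vnorm g (X x)) (fun k => (memLp_vnorm_grad g (hf k)).integrable_sq)
    hX.integrable_sq (fun k => aestronglyMeasurable_vnorm_grad_sub g (hf k) hXs hX.1)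
    (hX.const_mul 2) (fun k x => ?_) h2
  set v := grad g (f k) x
  set w := X x
  have h3 := vnorm_sub_sq g v w
  have h4 : |g.inner x (v - w) w| ≤ _ := abs_inner_le g (v - w) w
  have e : g.inner x (v - w) w = g.inner x v w - vnorm g w ^ 2 := by
    rw [map_sub, vnorm_sq]; rfl
  rw [e] at h4
  have h5 := abs_le.1 h4
  have h6 := sq_nonneg (vnorm g (v - w))
  rw [abs_le]
  constructor <;> nlinarith

theorem tendsto_energy (g : Metric n M) {f : ℕ → M → ℝ} {u : M → ℝ}
    {X : ∀ x : M, TangentSpace (𝓡 n) x}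
    (hf : ∀ k, ContMDiff (𝓡 n) 𝓘(ℝ, ℝ) ∞ (f k)) (hu : MemLp u 2 (vol g))
    (hXs : AEStronglyMeasurable (fun x => (⟨x, X x⟩ : TangentBundle (𝓡 n) M)) (vol g))
    (hX : MemLp (fun x => vnorm g (X x)) 2 (vol g))
    (h1 : Tendsto (fun k => eLpNorm (fun x => f k x - u x) 2 (vol g)) atTop (𝓝 0))
    (h2 : Tendsto (fun k => eLpNorm (fun x => vnorm g (grad g (f k) x - X x)) 2 (vol g))
      atTop (𝓝 0)) :
    Tendsto (fun k => energy g (f k) (grad g (f k))) atTop (𝓝 (energy g u X)) := by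
  obtain ⟨K, hK, hR⟩ := exists_bound_scalarCurv g
  have hfL : ∀ k, MemLp (f k) 2 (vol g) := fun k => memLp_of_continuous g (hf k).continuous 2
  have i : ∀ {w : M → ℝ}, MemLp w 2 (vol g) →
      Integrable (fun x => scalarCurv g x / 4 * w x ^ 2) (vol g) := fun hw =>
    (integrable_scalarCurv_mul g hw hw).congr (Eventually.of_forall fun x => by ring)
  have t1 := integral_vnorm_sq_tendsto g hf hXs hX h2
  have t2 : Tendsto (fun k => ∫ x, scalarCurv g x / 4 * f k x ^ 2 ∂(vol g)) atTop
      (𝓝 (∫ x, scalarCurv g x / 4 * u x ^ 2 ∂(vol g))) := by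
    refine tendsto_integral_of_le_mul (C := K / 4) (w := fun k x => |f k x - u x|)
      (v := fun x => K / 4 * (2 * |u x|)) (fun k => i (hfL k)) (i hu)
      (fun k => ((hf k).continuous.aestronglyMeasurable.sub hu.1).norm)
      ((hu.norm.const_mul 2).const_mul (K / 4)) (fun k x => ?_) ?_
    · rw [show scalarCurv g x / 4 * f k x ^ 2 - scalarCurv g x / 4 * u x ^ 2
        = scalarCurv g x / 4 * ((f k x - u x) * (2 * u x + (f k x - u x))) by ring, abs_mul, abs_mul,
        ← mul_add, mul_left_comm, abs_div, abs_of_pos (four_pos : (0 : ℝ) < 4)]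
      gcongr
      · exact hR x
      · refine (abs_add_le _ _).trans ?_
        rw [abs_mul, abs_two]
    · refine h1.congr fun k => ?_
      exact (eLpNorm_norm _).symm
  refine ((t1.add t2).congr fun k => ?_).trans (le_of_eq ?_)
  · exact (integral_add (memLp_vnorm_grad g (hf k)).integrable_sq (i (hfL k))).symm
  · rw [energy, integral_add hX.integrable_sq (i hu)]

end Limits

/-! ### Completeness of gradient fields in L² -/

section Completeness

variable {n : ℕ} {M : Type*} [TopologicalSpace M]
  [ChartedSpace (EuclideanSpace ℝ (Fin n)) M] [IsManifold (𝓡 n) ∞ M]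

/-- The open unit ball of `g` is bounded for the model norm; rescaling `v` to length `1/2` places it
safely inside. -/
theorem exists_norm_le_vnorm (g : Metric n M) (x : M) :
    ∃ C : ℝ, ∀ v : TangentSpace (𝓡 n) x, ‖(show EuclideanSpace ℝ (Fin n) from v)‖ ≤ C * vnorm g v := by
  have h : Bornology.IsVonNBounded ℝ {v : EuclideanSpace ℝ (Fin n) | g.inner x v v < 1} :=
    g.isVonNBounded x
  obtain ⟨r, hr⟩ := (NormedSpace.isVonNBounded_iff' ℝ).1 h
  refine ⟨2 * r, fun v => ?_⟩
  by_cases hv : v = 0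
  · subst hv
    rw [vnorm_zero, mul_zero]
    exact (norm_zero (E := EuclideanSpace ℝ (Fin n))).le
  · have hp : 0 < vnorm g v := Real.sqrt_pos.2 (g.pos x v hv)
    have h1 : vnorm g ((1 / (2 * vnorm g v)) • v) = 1 / 2 := by
      rw [vnorm_smul, abs_of_pos (by positivity)]
      field_simp
    have h2 := hr ((1 / (2 * vnorm g v)) • v) (by
      change g.inner x ((1 / (2 * vnorm g v)) • v) ((1 / (2 * vnorm g v)) • v) < 1
      rw [← vnorm_sq, h1]
      norm_num)
    have h3 : ‖(1 / (2 * vnorm g v)) • (show EuclideanSpace ℝ (Fin n) from v)‖ ≤ r := h2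
    rw [norm_smul, Real.norm_of_nonneg (by positivity), div_mul_eq_mul_div, one_mul,
      div_le_iff₀ (by positivity)] at h3
    linarith

theorem continuous_vnorm (g : Metric n M) (x : M) :
    Continuous fun v : TangentSpace (𝓡 n) x => vnorm g v := by
  let B : EuclideanSpace ℝ (Fin n) →L[ℝ] EuclideanSpace ℝ (Fin n) →L[ℝ] ℝ := g.inner x
  have : Continuous fun v : EuclideanSpace ℝ (Fin n) => √(B v v) :=
    (B.continuous.clm_apply continuous_id).sqrt
  exact this

theorem exists_tendsto_of_tsum_ne_top (g : Metric n M) {x : M} {V : ℕ → TangentSpace (𝓡 n) x}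
    (h : ∑' k, ‖vnorm g (V (k + 1) - V k)‖ₑ ≠ ⊤) : ∃ L, Tendsto V atTop (𝓝 L) := by
  obtain ⟨C, hC⟩ := exists_norm_le_vnorm g x
  let W : ℕ → EuclideanSpace ℝ (Fin n) := V
  have hs : Summable fun k => vnorm g (V (k + 1) - V k) := by
    refine (ENNReal.summable_toReal h).congr fun k => ?_
    rw [toReal_enorm, Real.norm_of_nonneg (vnorm_nonneg g _)]
  have hd : Summable fun k => dist (W k) (W k.succ) := by
    refine Summable.of_nonneg_of_le (fun _ => dist_nonneg) (fun k => ?_) (hs.mul_left C)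
    rw [dist_comm, dist_eq_norm]
    exact hC (V (k + 1) - V k)
  obtain ⟨L, hL⟩ := cauchySeq_tendsto_of_complete (cauchySeq_of_summable_dist hd)
  exact ⟨L, hL⟩

variable [MeasurableSpace M] [BorelSpace M] [CompactSpace M] [Nonempty M]

/-- `L²`-completeness of gradient fields. -/
theorem exists_isW12_of_cauchy [T2Space M] (g : Metric n M) {f : ℕ → M → ℝ} {u : M → ℝ}
    (hf : ∀ k, ContMDiff (𝓡 n) 𝓘(ℝ, ℝ) ∞ (f k)) (hu : MemLp u 2 (vol g))
    (h1 : Tendsto (fun k => eLpNorm (fun x => f k x - u x) 2 (vol g)) atTop (𝓝 0))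
    (hC : ∀ ε : ℝ≥0∞, 0 < ε → ∃ N, ∀ i, N ≤ i → ∀ j, N ≤ j →
      eLpNorm (fun x => vnorm g (grad g (f i) x - grad g (f j) x)) 2 (vol g) ≤ ε) :
    ∃ (X : ∀ x : M, TangentSpace (𝓡 n) x) (ψ : ℕ → ℕ), StrictMono ψ ∧ IsW12 g u X ∧
      Tendsto (fun k => eLpNorm (fun x => vnorm g (grad g (f (ψ k)) x - X x)) 2 (vol g))
        atTop (𝓝 0) := by
  have hsub : ∀ i j, Continuous fun x => vnorm g (grad g (f i) x - grad g (f j) x) := by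
    intro i j
    refine (continuous_vnorm_grad g ((hf i).sub (hf j))).congr fun x => ?_
    congr 1
    exact grad_sub g (hf i) (hf j) x
  -- As in the Riesz–Fischer theorem, a subsequence with geometric speed has summable increments,
  -- hence converges almost everywhere, each fibre being complete.
  obtain ⟨ψ, hψ, hψC⟩ := extraction_forall_of_eventually'
    (P := fun k N => ∀ i, N ≤ i → ∀ j, N ≤ j →
      eLpNorm (fun x => vnorm g (grad g (f i) x - grad g (f j) x)) 2 (vol g) ≤ (2⁻¹ : ℝ≥0∞) ^ k)
    (fun k => by
      obtain ⟨N, hN⟩ := hC ((2⁻¹ : ℝ≥0∞) ^ k) (ENNReal.pow_pos (by simp) k)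
      exact ⟨N, fun m hm i hi j hj => hN i (hm.trans hi) j (hm.trans hj)⟩)
  have hsum : ∀ᵐ x ∂(vol g), ∑' k, ‖vnorm g (grad g (f (ψ (k + 1))) x - grad g (f (ψ k)) x)‖ₑ ≠ ⊤ := by
    have hfin : ∫⁻ x, ∑' k, ‖vnorm g (grad g (f (ψ (k + 1))) x - grad g (f (ψ k)) x)‖ₑ ∂(vol g)
        ≠ ⊤ := by
      rw [lintegral_tsum fun k => (hsub _ _).measurable.enorm.aemeasurable]
      have hk : ∀ k, ∫⁻ x, ‖vnorm g (grad g (f (ψ (k + 1))) x - grad g (f (ψ k)) x)‖ₑ ∂(vol g)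
          ≤ (2⁻¹ : ℝ≥0∞) ^ k *
            (vol g) univ ^ (1 / (1 : ℝ≥0∞).toReal - 1 / (2 : ℝ≥0∞).toReal) := by
        intro k
        rw [← eLpNorm_one_eq_lintegral_enorm]
        refine (eLpNorm_le_eLpNorm_mul_rpow_measure_univ one_le_two
          (hsub _ _).aestronglyMeasurable).trans (mul_le_mul_left ?_ _)
        exact hψC k _ (hψ.monotone k.le_succ) _ le_rfl
      refine ((ENNReal.tsum_le_tsum hk).trans_lt ?_).ne
      rw [ENNReal.tsum_mul_right, ENNReal.tsum_geometric]
      refine ENNReal.mul_lt_top (by simp) ?_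
      exact ENNReal.rpow_lt_top_of_nonneg (by norm_num) (measure_ne_top _ _)
    filter_upwards [ae_lt_top (Measurable.tsum fun k => (hsub _ _).measurable.enorm) hfin]
      with x hx using hx.ne
  -- The implication leaves the limit field unconstrained on the null set where the series diverges.
  have hex : ∀ x, ∃ L : TangentSpace (𝓡 n) x,
      ∑' k, ‖vnorm g (grad g (f (ψ (k + 1))) x - grad g (f (ψ k)) x)‖ₑ ≠ ⊤ →
        Tendsto (fun k => grad g (f (ψ k)) x) atTop (𝓝 L) := by
    intro x
    by_cases h : ∑' k, ‖vnorm g (grad g (f (ψ (k + 1))) x - grad g (f (ψ k)) x)‖ₑ = ⊤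
    · exact ⟨0, fun h' => absurd h h'⟩
    · obtain ⟨L, hL⟩ := exists_tendsto_of_tsum_ne_top g (V := fun k => grad g (f (ψ k)) x) h
      exact ⟨L, fun _ => hL⟩
  choose X hX using hex
  have hae : ∀ᵐ x ∂(vol g), Tendsto (fun k => grad g (f (ψ k)) x) atTop (𝓝 (X x)) := by
    filter_upwards [hsum] with x hx using hX x hx
  have hXm : AEStronglyMeasurable (fun x => (⟨x, X x⟩ : TangentBundle (𝓡 n) M)) (vol g) := by
    have := metrizableSpace_tangentBundle (n := n) (M := M)
    refine aestronglyMeasurable_of_tendsto_ae atTop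
      (fun k => aestronglyMeasurable_grad g (hf (ψ k))) ?_
    filter_upwards [hae] with x hx
    exact ((FiberBundle.continuous_totalSpaceMk (EuclideanSpace ℝ (Fin n))
      (TangentSpace (𝓡 n) : M → Type _) x).tendsto (X x)).comp hx
  have hvae : ∀ᵐ x ∂(vol g),
      Tendsto (fun k => vnorm g (grad g (f (ψ k)) x)) atTop (𝓝 (vnorm g (X x))) := by
    filter_upwards [hae] with x hx using ((continuous_vnorm g x).tendsto (X x)).comp hx
  have hvm : AEStronglyMeasurable (fun x => vnorm g (X x)) (vol g) :=
    aestronglyMeasurable_of_tendsto_ae atTop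
      (fun k => (continuous_vnorm_grad g (hf (ψ k))).aestronglyMeasurable) hvae
  -- Fatou's lemma in the second index of the Cauchy estimate.
  have hlim : ∀ k, eLpNorm (fun x => vnorm g (grad g (f (ψ k)) x - X x)) 2 (vol g)
      ≤ (2⁻¹ : ℝ≥0∞) ^ k := by
    intro k
    refine (Lp.eLpNorm_lim_le_liminf_eLpNorm (p := 2)
      (f := fun j x => vnorm g (grad g (f (ψ k)) x - grad g (f (ψ j)) x))
      (fun j => (hsub _ _).aestronglyMeasurable) _ ?_).trans ?_
    · filter_upwards [hae] with x hx
      exact ((continuous_vnorm g x).tendsto _).comp (tendsto_const_nhds.sub hx)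
    · refine liminf_le_of_frequently_le' (Eventually.frequently ?_)
      filter_upwards [eventually_ge_atTop k] with j hj
      exact hψC k _ le_rfl _ (hψ.monotone hj)
  have ht : Tendsto (fun k => eLpNorm (fun x => vnorm g (grad g (f (ψ k)) x - X x)) 2 (vol g))
      atTop (𝓝 0) :=
    tendsto_of_tendsto_of_tendsto_of_le_of_le tendsto_const_nhds
      (ENNReal.tendsto_pow_atTop_nhds_zero_of_lt_one (by simp)) (fun _ => zero_le) hlim
  refine ⟨X, ψ, hψ, ⟨hu, hXm, ⟨hvm, ?_⟩, fun k => f (ψ k), fun k => hf _,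
    h1.comp hψ.tendsto_atTop, ht⟩, ht⟩
  have hm0 := aestronglyMeasurable_vnorm_grad_sub g (hf (ψ 0)) hXm hvm
  have h0 := memLp_vnorm_grad g (hf (ψ 0))
  refine lt_of_le_of_lt (eLpNorm_mono_real (g := fun x => vnorm g (grad g (f (ψ 0)) x - X x)
    + vnorm g (grad g (f (ψ 0)) x)) fun x => ?_)
    ((eLpNorm_add_le hm0 h0.1 one_le_two).trans_lt
      (ENNReal.add_lt_top.2 ⟨(hlim 0).trans_lt (by simp), h0.2⟩))
  rw [Real.norm_of_nonneg (vnorm_nonneg g _)]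
  have h3 := vnorm_add_le g ((-1 : ℝ) • (grad g (f (ψ 0)) x - X x)) (grad g (f (ψ 0)) x)
  rw [vnorm_smul, abs_neg, abs_one, one_mul] at h3
  have e : (-1 : ℝ) • (grad g (f (ψ 0)) x - X x) + grad g (f (ψ 0)) x = X x := by module
  rwa [e] at h3

end Completeness

/-! ### Variational characterization of the first eigenvalue -/

section FirstEigenvalue

variable {n : ℕ} {M : Type*} [TopologicalSpace M]
  [ChartedSpace (EuclideanSpace ℝ (Fin n)) M] [IsManifold (𝓡 n) ∞ M]
  [MeasurableSpace M] [BorelSpace M] [CompactSpace M] [Nonempty M]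

/-- The bottom of the spectrum of `-Δ + R/4`, tested on smooth functions. -/
noncomputable def bottom (g : Metric n M) : ℝ :=
  sSup {c : ℝ | ∀ f : M → ℝ, ContMDiff (𝓡 n) 𝓘(ℝ, ℝ) ∞ f →
    c * ∫ x, f x ^ 2 ∂(vol g) ≤ energy g f (grad g f)}

theorem integral_add_mul_add_mul {α : Type*} [MeasurableSpace α] {μ : Measure α} {a b c : α → ℝ}
    (ha : Integrable a μ) (hb : Integrable b μ) (hc : Integrable c μ) (s t : ℝ) :
    ∫ x, (a x + s * b x + t * c x) ∂μ
      = ∫ x, a x ∂μ + s * ∫ x, b x ∂μ + t * ∫ x, c x ∂μ := by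
  rw [← integral_const_mul, ← integral_const_mul, ← integral_add ha (hb.const_mul s)]
  exact integral_add (ha.add (hb.const_mul s)) (hc.const_mul t)

theorem continuous_energy_integrand (g : Metric n M) {f : M → ℝ}
    (hf : ContMDiff (𝓡 n) 𝓘(ℝ, ℝ) ∞ f) :
    Continuous fun x => vnorm g (grad g f x) ^ 2 + scalarCurv g x / 4 * f x ^ 2 :=
  ((continuous_vnorm_grad g hf).pow 2).add
    (((continuous_scalarCurv g).div_const 4).mul (hf.continuous.pow 2))

/-- The scalar curvature term is a bounded perturbation of the Dirichlet energy. -/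
theorem exists_abs_energy_sub_le (g : Metric n M) : ∃ K : ℝ, 0 ≤ K ∧ ∀ f : M → ℝ,
    ContMDiff (𝓡 n) 𝓘(ℝ, ℝ) ∞ f →
      |energy g f (grad g f) - ∫ x, vnorm g (grad g f x) ^ 2 ∂(vol g)|
        ≤ K * ∫ x, f x ^ 2 ∂(vol g) := by
  obtain ⟨K, hK, hR⟩ := exists_bound_scalarCurv g
  refine ⟨K / 4, by positivity, fun f hf => ?_⟩
  have i1 : Integrable (fun x => vnorm g (grad g f x) ^ 2) (vol g) :=
    integrable_of_continuous g ((continuous_vnorm_grad g hf).pow 2)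
  have i2 : Integrable (fun x => scalarCurv g x / 4 * f x ^ 2) (vol g) :=
    integrable_of_continuous g (((continuous_scalarCurv g).div_const 4).mul (hf.continuous.pow 2))
  rw [energy, integral_add i1 i2, add_sub_cancel_left, ← integral_const_mul]
  refine (abs_integral_le_integral_abs).trans (integral_mono i2.abs
    ((integrable_of_continuous g (hf.continuous.pow 2)).const_mul _) fun x => ?_)
  beta_reduce
  rw [abs_mul, abs_of_nonneg (sq_nonneg (f x)), abs_div, abs_of_pos (four_pos : (0 : ℝ) < 4)]
  gcongr
  exact hR x

theorem integral_vnorm_sq_nonneg (g : Metric n M) (X : ∀ x : M, TangentSpace (𝓡 n) x) :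
    0 ≤ ∫ x, vnorm g (X x) ^ 2 ∂(vol g) :=
  integral_nonneg fun _ => sq_nonneg _

theorem integral_sq_nonneg (g : Metric n M) (f : M → ℝ) : 0 ≤ ∫ x, f x ^ 2 ∂(vol g) :=
  integral_nonneg fun _ => sq_nonneg _

theorem bottom_set_nonempty (g : Metric n M) : {c : ℝ | ∀ f : M → ℝ,
    ContMDiff (𝓡 n) 𝓘(ℝ, ℝ) ∞ f →
      c * ∫ x, f x ^ 2 ∂(vol g) ≤ energy g f (grad g f)}.Nonempty := by
  obtain ⟨K, hK, h⟩ := exists_abs_energy_sub_le g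
  refine ⟨-K, fun f hf => ?_⟩
  have h1 := (abs_le.1 (h f hf)).1
  have h2 := integral_vnorm_sq_nonneg g (grad g f)
  linarith

/-- For fixed `f` the condition is an upper bound on `c`, so it passes to the supremum; if `∫ f² =
0`, the value of `c` is immaterial. -/
theorem bottom_mul_le (g : Metric n M) {f : M → ℝ} (hf : ContMDiff (𝓡 n) 𝓘(ℝ, ℝ) ∞ f) :
    bottom g * ∫ x, f x ^ 2 ∂(vol g) ≤ energy g f (grad g f) := by
  rcases (integral_sq_nonneg g f).eq_or_lt with h0 | h0
  · obtain ⟨c, hc⟩ := bottom_set_nonempty g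
    have := hc f hf
    rw [← h0, mul_zero] at this ⊢
    exact this
  · rw [← le_div_iff₀ h0]
    exact csSup_le (bottom_set_nonempty g) fun c hc => (le_div_iff₀ h0).2 (hc f hf)

theorem bottom_set_bddAbove (g : Metric n M) : BddAbove {c : ℝ | ∀ f : M → ℝ,
    ContMDiff (𝓡 n) 𝓘(ℝ, ℝ) ∞ f →
      c * ∫ x, f x ^ 2 ∂(vol g) ≤ energy g f (grad g f)} := by
  refine ⟨energy g (fun _ : M => 1) (grad g fun _ => 1) / totalVol g, fun c hc => ?_⟩
  rw [le_div_iff₀ (totalVol_pos g)]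
  have := hc (fun _ => 1) contMDiff_const
  simpa [totalVol] using this

theorem energy_const_mul (g : Metric n M) {f : M → ℝ} (hf : ContMDiff (𝓡 n) 𝓘(ℝ, ℝ) ∞ f) (a : ℝ) :
    energy g (fun x => a * f x) (grad g fun x => a * f x) = a ^ 2 * energy g f (grad g f) := by
  rw [energy, energy, ← integral_const_mul]
  refine integral_congr_ae (Eventually.of_forall fun x => ?_)
  beta_reduce
  rw [grad_smul g hf, vnorm_smul, mul_pow, sq_abs]
  ring

/-- A normalised near-minimiser, obtained by homogeneity from a function violating the inequality
with a larger constant. -/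
theorem exists_energy_lt (g : Metric n M) {ε : ℝ} (hε : 0 < ε) : ∃ f : M → ℝ,
    ContMDiff (𝓡 n) 𝓘(ℝ, ℝ) ∞ f ∧ ∫ x, f x ^ 2 ∂(vol g) = 1 ∧
      energy g f (grad g f) < bottom g + ε := by
  have h : bottom g + ε ∉ {c : ℝ | ∀ f : M → ℝ, ContMDiff (𝓡 n) 𝓘(ℝ, ℝ) ∞ f →
      c * ∫ x, f x ^ 2 ∂(vol g) ≤ energy g f (grad g f)} := fun h =>
    absurd (le_csSup (bottom_set_bddAbove g) h) (by simpa [bottom] using hε)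
  simp only [mem_ofPred_eq, not_forall, not_le] at h
  obtain ⟨f, hf, h⟩ := h
  have hN : 0 < ∫ x, f x ^ 2 ∂(vol g) := by
    refine (integral_sq_nonneg g f).lt_of_ne fun h0 => ?_
    have := bottom_mul_le g hf
    rw [← h0, mul_zero] at this h
    linarith
  set N := ∫ x, f x ^ 2 ∂(vol g)
  refine ⟨fun x => (√N)⁻¹ * f x, contMDiff_const.mul hf, ?_, ?_⟩
  · simp only [mul_pow]
    rw [integral_const_mul, inv_pow, Real.sq_sqrt hN.le]
    exact inv_mul_cancel₀ hN.ne'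
  · rw [energy_const_mul g hf, inv_pow, Real.sq_sqrt hN.le, inv_mul_lt_iff₀ hN, mul_comm N]
    exact h

theorem vnorm_add_smul_sq (g : Metric n M) {x : M} (v w : TangentSpace (𝓡 n) x) (t : ℝ) :
    vnorm g (v + t • w) ^ 2 = vnorm g v ^ 2 + 2 * t * g.inner x v w + t ^ 2 * vnorm g w ^ 2 := by
  rw [vnorm_sq, vnorm_sq, vnorm_sq]
  simp only [map_add, map_smul, add_apply, smul_apply, smul_eq_mul]
  rw [g.symm x w v]
  ring

theorem energy_add_smul (g : Metric n M) {f h : M → ℝ} (hf : ContMDiff (𝓡 n) 𝓘(ℝ, ℝ) ∞ f)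
    (hh : ContMDiff (𝓡 n) 𝓘(ℝ, ℝ) ∞ h) (t : ℝ) :
    energy g (fun x => f x + t * h x) (grad g fun x => f x + t * h x)
      = energy g f (grad g f) + 2 * t * weakForm g f (grad g f) h (grad g h)
        + t ^ 2 * energy g h (grad g h) := by
  have i1 := integrable_of_continuous g (continuous_energy_integrand g hf)
  have i2 := integrable_of_continuous g (continuous_energy_integrand g hh)
  have i3 : Integrable (fun x => g.inner x (grad g f x) (grad g h x)
      + scalarCurv g x / 4 * f x * h x) (vol g) :=
    integrable_of_continuous g (((continuous_inner_grad g hh).comp (continuous_grad g hf)).add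
      ((((continuous_scalarCurv g).div_const 4).mul hf.continuous).mul hh.continuous))
  rw [energy, energy, energy, weakForm, ← integral_add_mul_add_mul i1 i3 i2]
  refine integral_congr_ae (Eventually.of_forall fun x => ?_)
  beta_reduce
  have hth : ContMDiff (𝓡 n) 𝓘(ℝ, ℝ) ∞ fun x => t * h x := contMDiff_const.mul hh
  rw [grad_add g hf hth, grad_smul g hh, vnorm_add_smul_sq]
  ring

theorem integral_add_smul_sq (g : Metric n M) {f h : M → ℝ} (hf : Continuous f)
    (hh : Continuous h) (t : ℝ) :
    ∫ x, (f x + t * h x) ^ 2 ∂(vol g) = ∫ x, f x ^ 2 ∂(vol g)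
      + 2 * t * ∫ x, f x * h x ∂(vol g) + t ^ 2 * ∫ x, h x ^ 2 ∂(vol g) := by
  have i1 : Integrable (fun x => f x ^ 2) (vol g) := integrable_of_continuous g (hf.pow 2)
  have i2 : Integrable (fun x => h x ^ 2) (vol g) := integrable_of_continuous g (hh.pow 2)
  have i3 : Integrable (fun x => f x * h x) (vol g) := integrable_of_continuous g (hf.mul hh)
  rw [← integral_add_mul_add_mul i1 i3 i2]
  refine integral_congr_ae (Eventually.of_forall fun x => ?_)
  beta_reduce
  ring

/-- The nonnegative quadratic form `⟨(-Δ + R/4 - m) f, f⟩`, where `m` is the bottom of the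
spectrum. -/
noncomputable def excess (g : Metric n M) (f : M → ℝ) : ℝ :=
  energy g f (grad g f) - bottom g * ∫ x, f x ^ 2 ∂(vol g)

theorem excess_nonneg (g : Metric n M) {f : M → ℝ} (hf : ContMDiff (𝓡 n) 𝓘(ℝ, ℝ) ∞ f) :
    0 ≤ excess g f := sub_nonneg.2 (bottom_mul_le g hf)

theorem excess_add_smul (g : Metric n M) {f h : M → ℝ} (hf : ContMDiff (𝓡 n) 𝓘(ℝ, ℝ) ∞ f)
    (hh : ContMDiff (𝓡 n) 𝓘(ℝ, ℝ) ∞ h) (t : ℝ) :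
    excess g (fun x => f x + t * h x) = excess g f
      + 2 * t * (weakForm g f (grad g f) h (grad g h) - bottom g * ∫ x, f x * h x ∂(vol g))
      + t ^ 2 * excess g h := by
  rw [excess, excess, excess, energy_add_smul g hf hh,
    integral_add_smul_sq g hf.continuous hh.continuous]
  ring

/-- The parallelogram law, with the nonnegative excess of the sum discarded. It forces minimising
sequences to be Cauchy for the excess. -/
theorem excess_sub_le (g : Metric n M) {f h : M → ℝ} (hf : ContMDiff (𝓡 n) 𝓘(ℝ, ℝ) ∞ f)
    (hh : ContMDiff (𝓡 n) 𝓘(ℝ, ℝ) ∞ h) :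
    excess g (fun x => f x - h x) ≤ 2 * excess g f + 2 * excess g h := by
  have h1 := excess_add_smul g hf hh 1
  have h2 := excess_add_smul g hf hh (-1)
  have h3 := excess_nonneg g (f := fun x => f x + 1 * h x) (hf.add (contMDiff_const.mul hh))
  simp only [neg_mul, one_mul, ← sub_eq_add_neg] at h1 h2 h3
  linarith

/-- Cauchy–Schwarz for the semidefinite form `excess`: a function of small excess almost satisfies
the weak eigenvalue equation. -/
theorem weak_sq_le_excess_mul (g : Metric n M) {f h : M → ℝ}
    (hf : ContMDiff (𝓡 n) 𝓘(ℝ, ℝ) ∞ f) (hh : ContMDiff (𝓡 n) 𝓘(ℝ, ℝ) ∞ h) :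
    (weakForm g f (grad g f) h (grad g h) - bottom g * ∫ x, f x * h x ∂(vol g)) ^ 2
      ≤ excess g f * excess g h := by
  set b := weakForm g f (grad g f) h (grad g h) - bottom g * ∫ x, f x * h x ∂(vol g) with hb
  have key : ∀ t : ℝ, 0 ≤ excess g h * (t * t) + 2 * b * t + excess g f := by
    intro t
    have h1 := excess_add_smul g hf hh t
    have h3 := excess_nonneg g (f := fun x => f x + t * h x) (hf.add (contMDiff_const.mul hh))
    rw [h1, ← hb] at h3
    nlinarith
  have := discrim_le_zero key
  rw [discrim] at this
  nlinarith

theorem tendsto_integral_sub_sq (g : Metric n M) {f : ℕ → M → ℝ} {u : M → ℝ}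
    (hf : ∀ k, Continuous (f k)) (hu : MemLp u 2 (vol g))
    (ht : Tendsto (fun k => eLpNorm (fun x => f k x - u x) 2 (vol g)) atTop (𝓝 0)) :
    Tendsto (fun k => ∫ x, (f k x - u x) ^ 2 ∂(vol g)) atTop (𝓝 0) := by
  have := tendsto_integral_of_le_mul (μ := vol g) (a := fun k x => (f k x - u x) ^ 2) (b := 0)
    (C := 1) (w := fun k x => |f k x - u x|) (v := 0)
    (fun k => ((memLp_of_continuous g (hf k) 2).sub hu).integrable_sq) (integrable_zero _ _ _)
    (fun k => ((hf k).aestronglyMeasurable.sub hu.1).norm) MemLp.zero (fun k x => by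
      simp only [Pi.zero_apply, sub_zero, one_mul, zero_add]
      rw [abs_mul_abs_self, abs_of_nonneg (sq_nonneg _), sq]) (by
      refine ht.congr fun k => ?_
      exact (eLpNorm_norm _).symm)
  simpa using this

theorem integral_sub_sq_le (g : Metric n M) {f h u : M → ℝ} (hf : Continuous f)
    (hh : Continuous h) (hu : MemLp u 2 (vol g)) :
    ∫ x, (f x - h x) ^ 2 ∂(vol g) ≤ 2 * ∫ x, (f x - u x) ^ 2 ∂(vol g)
      + 2 * ∫ x, (h x - u x) ^ 2 ∂(vol g) := by
  have i1 : Integrable (fun x => (f x - u x) ^ 2) (vol g) :=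
    ((memLp_of_continuous g hf 2).sub hu).integrable_sq
  have i2 : Integrable (fun x => (h x - u x) ^ 2) (vol g) :=
    ((memLp_of_continuous g hh 2).sub hu).integrable_sq
  rw [← integral_const_mul, ← integral_const_mul,
    ← integral_add (i1.const_mul 2) (i2.const_mul 2)]
  refine integral_mono (integrable_of_continuous g ((hf.sub hh).pow 2))
    ((i1.const_mul 2).add (i2.const_mul 2)) fun x => ?_
  nlinarith [sq_nonneg ((f x - u x) + (h x - u x))]

/-- The direct method. A normalised minimising sequence has bounded gradients, so Rellich gives an
`L²` limit. Its excess tends to zero, which makes the gradients Cauchy and yields a `W^{1,2}` limit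
of norm one; Cauchy–Schwarz for the excess gives the equation. -/
theorem isEigenvalue_bottom [T2Space M] (g : Metric n M) : IsEigenvalue g (bottom g) := by
  obtain ⟨K, hK, hE⟩ := exists_abs_energy_sub_le g
  choose f hf hN hlt using fun k : ℕ =>
    exists_energy_lt g (ε := 1 / ((k : ℝ) + 1)) (by positivity)
  have hQ : ∀ k, excess g (f k) ≤ 1 / ((k : ℝ) + 1) := by
    intro k
    rw [excess, hN k, mul_one]
    linarith [hlt k]
  have hD : ∀ k, ∫ x, vnorm g (grad g (f k) x) ^ 2 ∂(vol g) ≤ max 1 (bottom g + 1 + K) := by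
    intro k
    have h1 := (abs_le.1 (hE _ (hf k))).1
    have h2 : 1 / ((k : ℝ) + 1) ≤ 1 := by
      rw [div_le_one (by positivity)]
      linarith [Nat.cast_nonneg (α := ℝ) k]
    rw [hN k] at h1
    exact le_max_of_le_right (by linarith [hlt k])
  obtain ⟨φ, hφ, u, hu, hφu⟩ := exists_subseq_tendsto_L2 g hf
    (fun k => (hN k).trans_le (le_max_left _ _)) hD
  have hr := tendsto_integral_sub_sq g (fun k => (hf (φ k)).continuous) hu hφu
  set r : ℕ → ℝ := fun k => ∫ x, (f (φ k) x - u x) ^ 2 ∂(vol g) with hrdef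
  set L := |bottom g| + K with hL
  have hL0 : 0 ≤ L := by positivity
  have hQφ : ∀ k, excess g (f (φ k)) ≤ 1 / ((k : ℝ) + 1) := by
    intro k
    refine (hQ (φ k)).trans ?_
    gcongr
    exact hφ.le_apply
  -- The Dirichlet integral of a difference is at most its excess plus `L` times its squared `L²`
  -- norm. The first is small by the parallelogram law, the second by Rellich, so gradients converge
  -- strongly.
  have hDij : ∀ i j, ∫ x, vnorm g (grad g (f (φ i)) x - grad g (f (φ j)) x) ^ 2 ∂(vol g)
      ≤ (2 * (1 / ((i : ℝ) + 1)) + L * (2 * r i)) + (2 * (1 / ((j : ℝ) + 1)) + L * (2 * r j)) := by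
    intro i j
    have hs : ContMDiff (𝓡 n) 𝓘(ℝ, ℝ) ∞ (fun x => f (φ i) x - f (φ j) x) := (hf _).sub (hf _)
    have h1 := (abs_le.1 (hE _ hs)).1
    have h2 := excess_sub_le g (hf (φ i)) (hf (φ j))
    have h3 := integral_sub_sq_le g (hf (φ i)).continuous (hf (φ j)).continuous hu
    have h4 := integral_sq_nonneg g (fun x => f (φ i) x - f (φ j) x)
    simp only [grad_sub g (hf (φ i)) (hf (φ j))] at h1
    rw [excess] at h2
    have h5 : bottom g * ∫ x, (f (φ i) x - f (φ j) x) ^ 2 ∂(vol g)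
        ≤ |bottom g| * ∫ x, (f (φ i) x - f (φ j) x) ^ 2 ∂(vol g) :=
      mul_le_mul_of_nonneg_right (le_abs_self _) h4
    have h6 : L * ∫ x, (f (φ i) x - f (φ j) x) ^ 2 ∂(vol g) ≤ L * (2 * r i + 2 * r j) :=
      mul_le_mul_of_nonneg_left h3 hL0
    have h7 := hQφ i
    have h8 := hQφ j
    rw [hL] at h6 ⊢
    linarith
  have hs : Tendsto (fun k : ℕ => 2 * (1 / ((k : ℝ) + 1)) + L * (2 * r k)) atTop (𝓝 0) := by
    have := ((tendsto_one_div_add_atTop_nhds_zero_nat (𝕜 := ℝ)).const_mul 2).add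
      ((hr.const_mul 2).const_mul L)
    simpa using this
  obtain ⟨X, ψ, hψ, hW, hX⟩ := exists_isW12_of_cauchy g (fun k => hf (φ k)) hu hφu (by
    intro ε hε
    set t := (min ε 1).toReal with ht
    have htop : min ε 1 ≠ ⊤ := (min_le_right _ _).trans_lt ENNReal.one_lt_top |>.ne
    have ht0 : 0 < t := ENNReal.toReal_pos (lt_min hε one_pos).ne' htop
    obtain ⟨N, hN'⟩ := eventually_atTop.1 (hs.eventually (gt_mem_nhds
      (show (0 : ℝ) < t ^ 2 / 2 by positivity)))
    refine ⟨N, fun i hi j hj => ?_⟩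
    have hc : Continuous fun x => vnorm g (grad g (f (φ i)) x - grad g (f (φ j)) x) := by
      refine (continuous_vnorm_grad g ((hf (φ i)).sub (hf (φ j)))).congr fun x => ?_
      congr 1
      exact grad_sub g (hf (φ i)) (hf (φ j)) x
    rw [eLpNorm_two_eq g hc]
    refine le_trans ?_ (min_le_left ε 1)
    rw [← ENNReal.ofReal_toReal htop, ← ht]
    refine ENNReal.ofReal_le_ofReal (Real.sqrt_le_iff.2 ⟨ht0.le, ?_⟩)
    linarith [hDij i j, hN' i hi, hN' j hj])
  have hψu := hφu.comp hψ.tendsto_atTop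
  refine ⟨u, X, hW, fun h0 => ?_, fun φ' hφ' => ?_⟩
  · have h1 := tendsto_integral_sq g (fun k => (hf (φ k)).continuous) hu hφu
    simp only [hN] at h1
    have h2 := tendsto_nhds_unique h1 tendsto_const_nhds
    have h3 : ∫ x, u x ^ 2 ∂(vol g) = 0 := by
      rw [← integral_zero M ℝ (μ := vol g)]
      refine integral_congr_ae ?_
      filter_upwards [h0] with x hx
      rw [hx]
      simp
    linarith
  · have t1 := tendsto_weakForm g (fun k => hf (φ (ψ k))) hu hW.aestronglyMeasurable hW.memLp_grad
      (memLp_of_continuous g hφ'.continuous 2) (aestronglyMeasurable_grad g hφ')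
      (memLp_vnorm_grad g hφ') (aestronglyMeasurable_inner_grad g hφ' hW.aestronglyMeasurable)
      hψu hX
    have t2 := tendsto_integral_mul g (fun k => (hf (φ (ψ k))).continuous) hu
      (memLp_of_continuous g hφ'.continuous 2) hψu
    have t3 := (t1.sub (t2.const_mul (bottom g))).pow 2
    have t4 : Tendsto (fun k : ℕ => 1 / ((k : ℝ) + 1) * excess g φ') atTop (𝓝 0) := by
      simpa using (tendsto_one_div_add_atTop_nhds_zero_nat (𝕜 := ℝ)).mul_const (excess g φ')
    -- The squared defect in the weak equation is at most the vanishing excess of the sequence times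
    -- that of the test function.
    have h5 := le_of_tendsto_of_tendsto' t3 t4 fun k =>
      (weak_sq_le_excess_mul g (hf (φ (ψ k))) hφ').trans (by
        refine mul_le_mul_of_nonneg_right ((hQφ (ψ k)).trans ?_) (excess_nonneg g hφ')
        gcongr
        exact hψ.le_apply)
    have h6 := pow_eq_zero_iff two_ne_zero |>.1 (le_antisymm h5 (sq_nonneg _))
    exact sub_eq_zero.1 h6

theorem IsW12.bottom_mul_le {g : Metric n M} {u : M → ℝ} {X : ∀ x : M, TangentSpace (𝓡 n) x}
    (h : IsW12 g u X) : bottom g * ∫ x, u x ^ 2 ∂(vol g) ≤ energy g u X := by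
  obtain ⟨f, hf, h1, h2⟩ := h.approx
  exact le_of_tendsto_of_tendsto'
    ((tendsto_integral_sq g (fun k => (hf k).continuous) h.memLp h1).const_mul _)
    (tendsto_energy g hf h.memLp h.aestronglyMeasurable h.memLp_grad h1 h2)
    fun k => RiemannLogSobolev.bottom_mul_le g (hf k)

/-- The weak equation is tested with smooth approximations of the eigenfunction itself; in the limit
its energy is `μ ∫ u²`, and `∫ u² > 0`. -/
theorem IsEigenvalue.bottom_le [T2Space M] {g : Metric n M} {μ : ℝ} (h : IsEigenvalue g μ) :
    bottom g ≤ μ := by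
  obtain ⟨u, X, hW, hne, hweak⟩ := h
  obtain ⟨f, hf, h1, h2⟩ := hW.approx
  have t1 := tendsto_weakForm g hf hW.memLp hW.aestronglyMeasurable hW.memLp_grad hW.memLp
    hW.aestronglyMeasurable hW.memLp_grad (aestronglyMeasurable_inner_self g hW.memLp_grad) h1 h2
  have t2 := (tendsto_integral_mul g (fun k => (hf k).continuous) hW.memLp hW.memLp h1).const_mul μ
  have e : ∀ k, weakForm g (f k) (grad g (f k)) u X = μ * ∫ x, f k x * u x ∂(vol g) := by
    intro k
    rw [weakForm_comm]
    refine (hweak (f k) (hf k)).trans ?_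
    congr 1
    exact integral_congr_ae (Eventually.of_forall fun x => mul_comm _ _)
  have h3 := tendsto_nhds_unique (t1.congr e) t2
  rw [weakForm_self] at h3
  have h4 := hW.bottom_mul_le
  have h5 : ∫ x, u x * u x ∂(vol g) = ∫ x, u x ^ 2 ∂(vol g) := by simp only [sq]
  rw [h3, h5] at h4
  have hpos : 0 < ∫ x, u x ^ 2 ∂(vol g) := by
    refine (integral_sq_nonneg g u).lt_of_ne fun h0 => hne ?_
    have := (integral_eq_zero_iff_of_nonneg (fun x => sq_nonneg (u x)) hW.memLp.integrable_sq).1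
      h0.symm
    filter_upwards [this] with x hx
    exact pow_eq_zero_iff two_ne_zero |>.1 hx
  exact le_of_mul_le_mul_right h4 hpos

theorem lambda0_eq_bottom [T2Space M] (g : Metric n M) : lambda0 g = bottom g :=
  IsLeast.csInf_eq ⟨isEigenvalue_bottom g, fun _ h => IsEigenvalue.bottom_le h⟩

/-- The variational characterization of the first eigenvalue. -/
theorem IsW12.lambda0_mul_le [T2Space M] {g : Metric n M} {u : M → ℝ}
    {X : ∀ x : M, TangentSpace (𝓡 n) x} (h : IsW12 g u X) :
    lambda0 g * ∫ x, u x ^ 2 ∂(vol g) ≤ energy g u X :=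
  lambda0_eq_bottom g ▸ h.bottom_mul_le

end FirstEigenvalue

/-! ### From Sobolev to logarithmic Sobolev -/

section Entropy

/-- Below, `s log s ≥ s - 1 ≥ -1`; above, `log s ≤ s^δ/δ`. -/
theorem abs_mul_log_le {s δ : ℝ} (hs : 0 ≤ s) (hδ : 0 < δ) :
    |s * Real.log s| ≤ 1 + s ^ (1 + δ) / δ := by
  rcases hs.eq_or_lt with rfl | hs0
  · rw [zero_mul, abs_zero]
    positivity
  have h1 : s - 1 ≤ s * Real.log s := by
    have := mul_le_mul_of_nonneg_left (Real.one_sub_inv_le_log_of_pos hs0) hs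
    rwa [mul_sub, mul_one, mul_inv_cancel₀ hs0.ne'] at this
  have h2 : s * Real.log s ≤ s ^ (1 + δ) / δ := by
    have := mul_le_mul_of_nonneg_left (Real.log_le_rpow_div hs hδ) hs
    rwa [← mul_div_assoc, ← Real.rpow_one_add' hs (by positivity)] at this
  have h3 : 0 ≤ s ^ (1 + δ) / δ := by positivity
  rw [abs_le]
  constructor <;> linarith

/-- With `δ = q/2 - 1` the majorant `(u²)^(1+δ)` is exactly `|u|^q`. -/
theorem integrable_sq_mul_log {α : Type*} [MeasurableSpace α] {μ : Measure α} [IsFiniteMeasure μ]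
    {u : α → ℝ} {q : ℝ} (hq : 2 < q) (hu : MemLp u (ENNReal.ofReal q) μ) :
    Integrable (fun x => u x ^ 2 * Real.log (u x ^ 2)) μ := by
  have h1 := hu.integrable_norm_rpow (by simp; linarith) ENNReal.ofReal_ne_top
  rw [ENNReal.toReal_ofReal (by linarith)] at h1
  refine ((integrable_const (1 : ℝ)).add (h1.div_const (q / 2 - 1))).mono' ?_
    (Eventually.of_forall fun x => ?_)
  · have hm := hu.1.aemeasurable.pow_const 2
    exact (hm.mul hm.log).aestronglyMeasurable
  · refine (abs_mul_log_le (sq_nonneg (u x)) (δ := q / 2 - 1) (by linarith)).trans (le_of_eq ?_)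
    simp only [Pi.add_apply]
    rw [show (1 : ℝ) + (q / 2 - 1) = q / 2 by ring, ← sq_abs, ← Real.rpow_natCast,
      ← Real.rpow_mul (abs_nonneg _), Real.norm_eq_abs]
    congr 3
    push_cast
    ring

/-- Jensen's inequality for the probability measure `u² dμ`. -/
theorem integral_sq_mul_log_le {α : Type*} [MeasurableSpace α] {μ : Measure α} [IsFiniteMeasure μ]
    {u : α → ℝ} {q : ℝ} (hq : 2 < q) (hu : MemLp u (ENNReal.ofReal q) μ) (h2 : MemLp u 2 μ)
    (h1 : ∫ x, u x ^ 2 ∂μ = 1) :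
    0 < ∫ x, |u x| ^ q ∂μ ∧
      (q / 2 - 1) * ∫ x, u x ^ 2 * Real.log (u x ^ 2) ∂μ ≤ Real.log (∫ x, |u x| ^ q ∂μ) := by
  have hi : Integrable (fun x => |u x| ^ q) μ := by
    have h1 := hu.integrable_norm_rpow (by simp; linarith) ENNReal.ofReal_ne_top
    rwa [ENNReal.toReal_ofReal (by linarith)] at h1
  have hA : 0 < ∫ x, |u x| ^ q ∂μ := by
    refine (integral_nonneg fun x => by positivity).lt_of_ne fun h0 => ?_
    have := (integral_eq_zero_iff_of_nonneg (fun x => by positivity) hi).1 h0.symm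
    have h3 : ∫ x, u x ^ 2 ∂μ = 0 := by
      rw [← integral_zero α ℝ (μ := μ)]
      refine integral_congr_ae ?_
      filter_upwards [this] with x hx
      have hx0 : |u x| = 0 := by
        by_contra hne
        exact hne (((Real.rpow_eq_zero (abs_nonneg _) (by linarith)).1 hx))
      rw [← sq_abs, hx0]
      simp
    linarith
  refine ⟨hA, ?_⟩
  set A := ∫ x, |u x| ^ q ∂μ with hAd
  -- Jensen by the tangent line: `log t ≤ t - 1` at `t = |u|^(q-2)/A`, weighted by `u²`. Since `A =
  -- ∫|u|^q` and `∫u² = 1`, the right side integrates to `log A`.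
  have hpt : ∀ x, (q / 2 - 1) * (u x ^ 2 * Real.log (u x ^ 2))
      ≤ A⁻¹ * |u x| ^ q + (Real.log A - 1) * u x ^ 2 := by
    intro x
    by_cases hx : u x = 0
    · simp only [hx, abs_zero]
      rw [Real.zero_rpow (by linarith)]
      simp
    have hp : 0 < |u x| := abs_pos.2 hx
    have e1 : |u x| ^ q = u x ^ 2 * |u x| ^ (q - 2) := by
      rw [← sq_abs, ← Real.rpow_natCast, ← Real.rpow_add hp]
      congr 1
      push_cast; ring
    have e2 : (q / 2 - 1) * Real.log (u x ^ 2) = Real.log (|u x| ^ (q - 2)) := by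
      rw [Real.log_rpow hp, ← sq_abs, Real.log_pow]
      push_cast; ring
    have h3 := Real.log_le_sub_one_of_pos (x := |u x| ^ (q - 2) / A) (by positivity)
    rw [Real.log_div (by positivity) hA.ne', ← e2] at h3
    have h4 := mul_le_mul_of_nonneg_left h3 (sq_nonneg (u x))
    rw [e1]
    have e3 : u x ^ 2 * (|u x| ^ (q - 2) / A - 1) = A⁻¹ * (u x ^ 2 * |u x| ^ (q - 2)) - u x ^ 2 := by
      ring
    rw [e3] at h4
    linarith
  rw [← integral_const_mul]
  refine (integral_mono ((integrable_sq_mul_log hq hu).const_mul _)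
    ((hi.const_mul _).add (h2.integrable_sq.const_mul _)) hpt).trans (le_of_eq ?_)
  refine (integral_add (hi.const_mul _) (h2.integrable_sq.const_mul _)).trans ?_
  rw [integral_const_mul, integral_const_mul, h1, ← hAd, inv_mul_cancel₀ hA.ne']
  ring

variable {n : ℕ} {M : Type*} [TopologicalSpace M]
  [ChartedSpace (EuclideanSpace ℝ (Fin n)) M] [IsManifold (𝓡 n) ∞ M]
  [MeasurableSpace M] [BorelSpace M] [CompactSpace M] [Nonempty M]

theorem two_lt_sobolevExp (hn : 3 ≤ n) : 2 < 2 * (n : ℝ) / (n - 2) := by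
  have h3 : (3 : ℝ) ≤ n := by exact_mod_cast hn
  rw [lt_div_iff₀ (by linarith)]
  linarith

theorem eLpNorm_two_toReal (g : Metric n M) {f : M → ℝ} (hf : MemLp f 2 (vol g)) :
    (eLpNorm f 2 (vol g)).toReal ^ 2 = ∫ x, f x ^ 2 ∂(vol g) := by
  rw [← ENNReal.toReal_pow, eLpNorm_two_sq, integral_eq_lintegral_of_nonneg_ae
    (Eventually.of_forall fun x => sq_nonneg (f x)) (hf.1.pow 2)]
  congr 1
  refine lintegral_congr fun x => ?_
  rw [← ofReal_norm, ← ENNReal.ofReal_pow (norm_nonneg _), Real.norm_eq_abs, sq_abs]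

theorem IsW12.memLp_sobolevExp (hn : 3 ≤ n) [ConnectedSpace M] {g : Metric n M} {u : M → ℝ}
    {X : ∀ x : M, TangentSpace (𝓡 n) x} (h : IsW12 g u X) :
    MemLp u (ENNReal.ofReal (2 * n / (n - 2))) (vol g) := by
  refine ⟨h.memLp.1, (h.sobolev hn).trans_lt (ENNReal.add_lt_top.2
    ⟨ENNReal.mul_lt_top ENNReal.ofReal_lt_top h.memLp_grad.2,
      ENNReal.mul_lt_top ENNReal.ofReal_lt_top h.memLp.2⟩)⟩

theorem IsW12.energy_eq {g : Metric n M} {u : M → ℝ}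
    {X : ∀ x : M, TangentSpace (𝓡 n) x} (h : IsW12 g u X) :
    energy g u X = ∫ x, vnorm g (X x) ^ 2 ∂(vol g)
      + ∫ x, scalarCurv g x / 4 * u x * u x ∂(vol g) := by
  rw [energy, ← integral_add h.memLp_grad.integrable_sq
    (integrable_scalarCurv_mul g h.memLp h.memLp)]
  exact integral_congr_ae (Eventually.of_forall fun x => by ring)

theorem IsW12.integral_vnorm_sq_le {g : Metric n M} {u : M → ℝ}
    {X : ∀ x : M, TangentSpace (𝓡 n) x} (h : IsW12 g u X) (h1 : ∫ x, u x ^ 2 ∂(vol g) = 1) :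
    ∫ x, vnorm g (X x) ^ 2 ∂(vol g) ≤ energy g u X - minScalarNeg g / 4 := by
  have h2 : minScalarNeg g / 4 ≤ ∫ x, scalarCurv g x / 4 * u x * u x ∂(vol g) := by
    calc minScalarNeg g / 4 = ∫ x, minScalarNeg g / 4 * u x ^ 2 ∂(vol g) := by
          rw [integral_const_mul, h1, mul_one]
      _ ≤ _ := by
          refine integral_mono (h.memLp.integrable_sq.const_mul _)
            (integrable_scalarCurv_mul g h.memLp h.memLp) fun x => ?_
          beta_reduce
          rw [mul_assoc, ← sq]
          have := minScalarNeg_le g x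
          gcongr
  rw [h.energy_eq]
  linarith

theorem IsW12.integral_eq_energy_add {g : Metric n M} {u : M → ℝ}
    {X : ∀ x : M, TangentSpace (𝓡 n) x} (h : IsW12 g u X) (h1 : ∫ x, u x ^ 2 ∂(vol g) = 1)
    (a : ℝ) : ∫ x, (vnorm g (X x) ^ 2 + (scalarCurv g x / 4 + a) * u x ^ 2) ∂(vol g)
      = energy g u X + a := by
  have i1 : Integrable (fun x => vnorm g (X x) ^ 2 + scalarCurv g x / 4 * u x * u x) (vol g) :=
    h.memLp_grad.integrable_sq.add (integrable_scalarCurv_mul g h.memLp h.memLp)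
  have e : a = ∫ x, a * u x ^ 2 ∂(vol g) := by rw [integral_const_mul, h1, mul_one]
  rw [h.energy_eq, ← integral_add h.memLp_grad.integrable_sq
    (integrable_scalarCurv_mul g h.memLp h.memLp)]
  conv_rhs => rw [e]
  rw [← integral_add i1 (h.memLp.integrable_sq.const_mul a)]
  exact integral_congr_ae (Eventually.of_forall fun x => by ring)

/-- The logarithmic Sobolev inequality deduced from the Sobolev inequality. -/
theorem IsW12.entropy_le (hn : 3 ≤ n) [T2Space M] [ConnectedSpace M] {g : Metric n M} {u : M → ℝ}
    {X : ∀ x : M, TangentSpace (𝓡 n) x} (h : IsW12 g u X) (h1 : ∫ x, u x ^ 2 ∂(vol g) = 1) :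
    entropy g u ≤ (n : ℝ) / 2 * Real.log (∫ x, vnorm g (X x) ^ 2 ∂(vol g)
        + sobolevConst g ^ (-2 : ℤ) * totalVol g ^ (-(2 / (n : ℝ))))
      + (n : ℝ) / 2 * Real.log (2 * sobolevConst g ^ 2) := by
  have h3 : (3 : ℝ) ≤ n := by exact_mod_cast hn
  have hq := two_lt_sobolevExp hn
  have hL := h.memLp_sobolevExp hn
  have hS := h.sobolev hn
  set q := 2 * (n : ℝ) / (n - 2) with hqd
  have hC := sobolevConst_pos hn g
  have hV := totalVol_pos g
  obtain ⟨hA, hJ⟩ := integral_sq_mul_log_le hq hL h.memLp h1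
  set C := sobolevConst g
  set N := (eLpNorm u (ENNReal.ofReal q) (vol g)).toReal with hN
  set G := (eLpNorm (fun x => vnorm g (X x)) 2 (vol g)).toReal with hG
  have hG2 : G ^ 2 = ∫ x, vnorm g (X x) ^ 2 ∂(vol g) := eLpNorm_two_toReal g h.memLp_grad
  have hu1 : (eLpNorm u 2 (vol g)).toReal = 1 := by
    have := eLpNorm_two_toReal g h.memLp
    rw [h1] at this
    exact (pow_eq_one_iff_of_nonneg ENNReal.toReal_nonneg two_ne_zero).1 this
  have hNle : N ≤ C * G + totalVol g ^ (-(1 / (n : ℝ))) := by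
    have := ENNReal.toReal_mono (ENNReal.add_ne_top.2
      ⟨ENNReal.mul_ne_top ENNReal.ofReal_ne_top h.memLp_grad.eLpNorm_ne_top,
        ENNReal.mul_ne_top ENNReal.ofReal_ne_top h.memLp.eLpNorm_ne_top⟩) hS
    rwa [ENNReal.toReal_add (ENNReal.mul_ne_top ENNReal.ofReal_ne_top h.memLp_grad.eLpNorm_ne_top)
      (ENNReal.mul_ne_top ENNReal.ofReal_ne_top h.memLp.eLpNorm_ne_top), ENNReal.toReal_mul,
      ENNReal.toReal_mul, hu1, mul_one, ENNReal.toReal_ofReal hC.le,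
      ENNReal.toReal_ofReal (by positivity)] at this
  have hNq : ∫ x, |u x| ^ q ∂(vol g) = N ^ q := by
    rw [hN, hL.eLpNorm_eq_integral_rpow_norm (by simp; linarith) ENNReal.ofReal_ne_top,
      ENNReal.toReal_ofReal (by positivity), ENNReal.toReal_ofReal (by linarith), ← Real.rpow_mul (by positivity), inv_mul_cancel₀ (by linarith), Real.rpow_one]
    rfl
  have hN0 : 0 < N := by
    refine ENNReal.toReal_nonneg.lt_of_ne fun h0 => ?_
    rw [hNq, hN, ← h0, Real.zero_rpow (by linarith)] at hA
    exact lt_irrefl _ hA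
  -- As `q/2 - 1 = 2/(n-2)`, multiplying Jensen's inequality by `(n-2)/2` turns `q log N` into `n
  -- log N`.
  have hE : entropy g u ≤ n * Real.log N := by
    rw [hNq, Real.log_rpow hN0] at hJ
    have e1 : q / 2 - 1 = 2 / (n - 2) := by
      rw [hqd]
      have : (n : ℝ) - 2 ≠ 0 := by linarith
      field_simp
      ring
    have h4 : (0 : ℝ) < n - 2 := by linarith
    rw [e1, hqd] at hJ
    have h5 := mul_le_mul_of_nonneg_left hJ (show (0 : ℝ) ≤ (n - 2) / 2 by linarith)
    have e2 : ((n : ℝ) - 2) / 2 * (2 / (n - 2) * ∫ x, u x ^ 2 * Real.log (u x ^ 2) ∂(vol g))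
        = entropy g u := by
      rw [entropy]
      field_simp
    have e3 : ((n : ℝ) - 2) / 2 * (2 * n / (n - 2) * Real.log N) = n * Real.log N := by
      field_simp
    rwa [e2, e3] at h5
  set β := C ^ (-2 : ℤ) * totalVol g ^ (-(2 / (n : ℝ))) with hβ
  have hβ0 : 0 < β := by positivity
  -- The factor `2` comes from `(x+y)² ≤ 2x² + 2y²`, and `β` is chosen so that `β C² = V^(-2/n)`,
  -- letting `2C²` be taken out of both terms.
  have hN2 : N ^ 2 ≤ (G ^ 2 + β) * (2 * C ^ 2) := by
    have e : β * C ^ 2 = (totalVol g ^ (-(1 / (n : ℝ)))) ^ 2 := by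
      rw [hβ, ← Real.rpow_natCast (totalVol g ^ (-(1 / (n : ℝ)))), ← Real.rpow_mul hV.le,
        mul_right_comm, zpow_neg, zpow_ofNat, inv_mul_cancel₀ (by positivity), one_mul]
      congr 1
      push_cast; ring
    calc N ^ 2 ≤ (C * G + totalVol g ^ (-(1 / (n : ℝ)))) ^ 2 := by gcongr
      _ ≤ 2 * (C * G) ^ 2 + 2 * (totalVol g ^ (-(1 / (n : ℝ)))) ^ 2 := by
          nlinarith [sq_nonneg (C * G - totalVol g ^ (-(1 / (n : ℝ))))]
      _ = _ := by rw [← e]; ring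
  rw [← hG2, ← mul_add, ← Real.log_mul (by positivity) (by positivity)]
  refine hE.trans ?_
  have h6 : 2 * Real.log N ≤ Real.log ((G ^ 2 + β) * (2 * C ^ 2)) := by
    have := Real.log_le_log (by positivity) hN2
    rwa [Real.log_pow, Nat.cast_ofNat] at this
  have h7 := mul_le_mul_of_nonneg_left h6 (show (0 : ℝ) ≤ n / 2 by positivity)
  linarith

/-- If the entropy is controlled by the logarithm of the energy, then so is the logarithmic Sobolev
constant. -/
theorem le_logSobolevConst [T2Space M] (g : Metric n M) {a L : ℝ}
    (h : ∀ (u : M → ℝ) (X : ∀ x : M, TangentSpace (𝓡 n) x), IsW12 g u X →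
      ∫ x, u x ^ 2 ∂(vol g) = 1 →
        entropy g u ≤ (n : ℝ) / 2 * Real.log (energy g u X + a) + L) :
    -L ≤ logSobolevConst g a := by
  refine le_csInf ?_ ?_
  -- The set must be nonempty, as the real infimum of the empty set is zero; the normalised constant
  -- function is a competitor.
  · have hc : ContMDiff (𝓡 n) 𝓘(ℝ, ℝ) ∞ fun _ : M => (√(totalVol g))⁻¹ := contMDiff_const
    refine ⟨_, _, _, isW12_grad g hc, ?_, rfl⟩
    rw [integral_const, inv_pow, Real.sq_sqrt (totalVol_pos g).le, smul_eq_mul]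
    exact mul_inv_cancel₀ (totalVol_pos g).ne'
  · rintro y ⟨u, X, hW, h1, rfl⟩
    rw [hW.integral_eq_energy_add h1]
    have := h u X hW h1
    rw [entropy] at this
    linarith

end Entropy

end RiemannLogSobolev
-- The two cases of the logarithmic Sobolev inequality
theorem proposition3p2 {n : ℕ} (hn : 3 ≤ n) {M : Type*} [TopologicalSpace M] [T2Space M]
    [CompactSpace M] [ConnectedSpace M] [ChartedSpace (EuclideanSpace ℝ (Fin n)) M]
    [IsManifold (𝓡 n) ∞ M] [MeasurableSpace M] [BorelSpace M]
    (g : RiemannLogSobolev.Metric n M) (a B : ℝ) (ha : -RiemannLogSobolev.lambda0 g < a)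
    (hB : B = -a - RiemannLogSobolev.minScalarNeg g / 4
      + RiemannLogSobolev.sobolevConst g ^ (-2 : ℤ)
        * RiemannLogSobolev.totalVol g ^ (-(2 / (n : ℝ)))) :
    -- the quantities in the estimates are well defined
    0 < RiemannLogSobolev.totalVol g ∧ 0 < RiemannLogSobolev.sobolevConst g ∧
    (∀ (u : M → ℝ) (X : ∀ x : M, TangentSpace (𝓡 n) x), RiemannLogSobolev.IsW12 g u X →
      ∫ x, u x ^ 2 ∂(RiemannLogSobolev.vol g) = 1 →
      Integrable (fun x => u x ^ 2 * Real.log (u x ^ 2)) (RiemannLogSobolev.vol g) ∧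
      0 < RiemannLogSobolev.energy g u X + a) ∧
    -- the first case
    (-RiemannLogSobolev.minScalarNeg g / 4 + RiemannLogSobolev.sobolevConst g ^ (-2 : ℤ)
        * RiemannLogSobolev.totalVol g ^ (-(2 / (n : ℝ))) ≤ a →
      (∀ (u : M → ℝ) (X : ∀ x : M, TangentSpace (𝓡 n) x), RiemannLogSobolev.IsW12 g u X →
        ∫ x, u x ^ 2 ∂(RiemannLogSobolev.vol g) = 1 →
        RiemannLogSobolev.entropy g u
          ≤ (n : ℝ) / 2 * Real.log (RiemannLogSobolev.energy g u X + a)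
            + (n : ℝ) / 2 * Real.log (2 * RiemannLogSobolev.sobolevConst g ^ 2)) ∧
      -((n : ℝ) / 2 * Real.log (2 * RiemannLogSobolev.sobolevConst g ^ 2))
        ≤ RiemannLogSobolev.logSobolevConst g a) ∧
    -- the second case
    (a < -RiemannLogSobolev.minScalarNeg g / 4 + RiemannLogSobolev.sobolevConst g ^ (-2 : ℤ)
        * RiemannLogSobolev.totalVol g ^ (-(2 / (n : ℝ))) →
      (∀ (u : M → ℝ) (X : ∀ x : M, TangentSpace (𝓡 n) x), RiemannLogSobolev.IsW12 g u X →
        ∫ x, u x ^ 2 ∂(RiemannLogSobolev.vol g) = 1 →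
        RiemannLogSobolev.entropy g u
          ≤ (n : ℝ) / 2 * Real.log (RiemannLogSobolev.energy g u X + a)
            + (n : ℝ) / 2 * Real.log (1 + B / (a + RiemannLogSobolev.lambda0 g))
            + (n : ℝ) / 2 * Real.log (2 * RiemannLogSobolev.sobolevConst g ^ 2)) ∧
      -((n : ℝ) / 2 * Real.log (1 + B / (a + RiemannLogSobolev.lambda0 g)))
          - (n : ℝ) / 2 * Real.log (2 * RiemannLogSobolev.sobolevConst g ^ 2)
        ≤ RiemannLogSobolev.logSobolevConst g a) := by
  have hpos : ∀ (u : M → ℝ) (X : ∀ x : M, TangentSpace (𝓡 n) x), RiemannLogSobolev.IsW12 g u X →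
      ∫ x, u x ^ 2 ∂(RiemannLogSobolev.vol g) = 1 →
        a + RiemannLogSobolev.lambda0 g ≤ RiemannLogSobolev.energy g u X + a := by
    intro u X h h1
    have := h.lambda0_mul_le
    rw [h1, mul_one] at this
    linarith
  have hlam : 0 < a + RiemannLogSobolev.lambda0 g := by linarith
  have hC := RiemannLogSobolev.sobolevConst_pos hn g
  have hV := RiemannLogSobolev.totalVol_pos g
  have hβ : 0 < RiemannLogSobolev.sobolevConst g ^ (-2 : ℤ)
      * RiemannLogSobolev.totalVol g ^ (-(2 / (n : ℝ))) := by positivity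
  set β := RiemannLogSobolev.sobolevConst g ^ (-2 : ℤ)
      * RiemannLogSobolev.totalVol g ^ (-(2 / (n : ℝ)))
  -- By the choice of `B`, `E + a + B = E - min R⁻/4 + β`, which dominates the argument of the
  -- logarithm in `IsW12.entropy_le`. The free bound `T` serves both cases.
  have key : ∀ (u : M → ℝ) (X : ∀ x : M, TangentSpace (𝓡 n) x), RiemannLogSobolev.IsW12 g u X →
      ∫ x, u x ^ 2 ∂(RiemannLogSobolev.vol g) = 1 → ∀ T : ℝ,
      RiemannLogSobolev.energy g u X + a + B ≤ T →
        RiemannLogSobolev.entropy g u ≤ (n : ℝ) / 2 * Real.log T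
          + (n : ℝ) / 2 * Real.log (2 * RiemannLogSobolev.sobolevConst g ^ 2) := by
    intro u X h h1 T hT
    refine (h.entropy_le hn h1).trans (add_le_add ?_ le_rfl)
    have h2 := RiemannLogSobolev.integral_vnorm_sq_nonneg g X
    have h3 := h.integral_vnorm_sq_le h1
    refine mul_le_mul_of_nonneg_left (Real.log_le_log (by positivity) ?_) (by positivity)
    linarith
  refine ⟨hV, hC, fun u X h h1 => ⟨RiemannLogSobolev.integrable_sq_mul_log
    (RiemannLogSobolev.two_lt_sobolevExp hn) (h.memLp_sobolevExp hn),
    hlam.trans_le (hpos u X h h1)⟩, fun hcase => ?_, fun hcase => ?_⟩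
  · have h1 : ∀ (u : M → ℝ) (X : ∀ x : M, TangentSpace (𝓡 n) x), RiemannLogSobolev.IsW12 g u X →
        ∫ x, u x ^ 2 ∂(RiemannLogSobolev.vol g) = 1 → RiemannLogSobolev.entropy g u
          ≤ (n : ℝ) / 2 * Real.log (RiemannLogSobolev.energy g u X + a)
            + (n : ℝ) / 2 * Real.log (2 * RiemannLogSobolev.sobolevConst g ^ 2) :=
      -- Here `B ≤ 0`, so `T = E + a` is admissible.
      fun u X h h1 => key u X h h1 _ (by linarith)
    exact ⟨h1, RiemannLogSobolev.le_logSobolevConst g h1⟩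
  · have hB0 : 0 < B := by linarith
    have h1 : ∀ (u : M → ℝ) (X : ∀ x : M, TangentSpace (𝓡 n) x), RiemannLogSobolev.IsW12 g u X →
        ∫ x, u x ^ 2 ∂(RiemannLogSobolev.vol g) = 1 → RiemannLogSobolev.entropy g u
          ≤ (n : ℝ) / 2 * Real.log (RiemannLogSobolev.energy g u X + a)
            + ((n : ℝ) / 2 * Real.log (1 + B / (a + RiemannLogSobolev.lambda0 g))
            + (n : ℝ) / 2 * Real.log (2 * RiemannLogSobolev.sobolevConst g ^ 2)) := by
      intro u X h h1
      have h2 := hpos u X h h1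
      have h3 : 0 < RiemannLogSobolev.energy g u X + a := hlam.trans_le h2
      have h4 : 0 < 1 + B / (a + RiemannLogSobolev.lambda0 g) := by positivity
      refine (key u X h h1 ((RiemannLogSobolev.energy g u X + a)
        * (1 + B / (a + RiemannLogSobolev.lambda0 g))) ?_).trans (le_of_eq ?_)
      -- Since `B > 0` and `E + a ≥ a + λ₀ > 0`, the additive `B` is absorbed into a factor that
      -- does not depend on `u`.
      · have h5 : B ≤ (RiemannLogSobolev.energy g u X + a)
            * (B / (a + RiemannLogSobolev.lambda0 g)) := by
          rw [← mul_div_assoc, le_div_iff₀ hlam, mul_comm B]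
          exact mul_le_mul_of_nonneg_right h2 hB0.le
        linarith
      · rw [Real.log_mul h3.ne' h4.ne']
        ring
    refine ⟨fun u X h hu => (h1 u X h hu).trans_eq (by ring), ?_⟩
    have := RiemannLogSobolev.le_logSobolevConst g h1
    linarith
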